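/- **Setting.** Let $m\ge n$ be nonnegative integers, $\Omega_{\bf x}=\mathbb R^n\times\mathbb R^n\times\mathbb R^m\ni x=(q,p,s)$ and $z=(p,s)$. Let $\beta>0$, let $M\in\mathbb R^{n\times n}$ be symmetric positive definite, let $\Gamma=\begin{pmatrix}\Gamma_{11}&\Gamma_{12}\\ \Gamma_{21}&\Gamma_{22}\end{pmatrix}$ and $\Sigma$ be real $(n+m)\times(n+m)$ matrices, and put $\Gamma_M=\Gamma\,\mathrm{diag}(M^{-1},I_m)$. Consider the quasi-Markovian generalized Langevin equation $$\dot q=M^{-1}p,\qquad \begin{pmatrix}\dot p\\ \dot s\end{pmatrix}=\begin{pmatrix}-\nabla U(q)\\0\end{pmatrix}-\Gamma_M\begin{pmatrix}p\\ s\end{pmatrix}+\beta^{-1/2}\Sigma\dot W ,$$ whose generator is $$\mathcal L_U=-\nabla U(q)\cdot\nabla_p+M^{-1}p\cdot\nabla_q-\Gamma_M z\cdot\nabla_z+\tfrac{1}{2\beta}\,\Sigma\Sigma^T:\nabla_z^2 .$$ **Assumptions.** 1. There is a symmetric positive definite $Q\in\mathbb R^{m\times m}$ with $\Gamma\,\mathrm{diag}(I_n,Q)+\mathrm{diag}(I_n,Q)\,\Gamma^T=\Sigma\Sigma^T$;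 all eigenvalues of $\Gamma_M$ have positive real part; and $\Gamma_{11}M=M\Gamma_{11}$. 2. $U(q)=U_1(q)+U_2(q)$ with $U_1(q)=\frac12q^T\Omega q$, where $\Omega$ is symmetric positive definite and $U_2\in C^\infty(\mathbb R^n,\mathbb R)$ has bounded partial derivatives of every order $k\ge1$. 3. The operator $\partial_t-\mathcal L_{U_1}$ (that is, with the quadratic part $U_1$ as potential) is hypoelliptic on $\mathbb R\times\Omega_{\bf x}$: on every open set, a distribution that it maps to a smooth function is itself a smooth function. Moreover the vectors $\Gamma_M^k\Sigma_i$, $0\le k\le n+m$, where $\Sigma_1,\dots,\Sigma_{n+m}$ are the columns of $\Sigma$, span $\mathbb R^{n+m}$. **Schemes.** For $h>0$ let $F_h=e^{-h\Gamma_M}$, let $S_h$ be any matrix with $S_hS_h^T=\beta^{-1}\left[\mathrm{diag}(M,Q)-F_h\,\mathrm{diag}(M,Q)\,F_h^T\right]$, and put $$\Phi^A_h(q,p,s)=(q+hM^{-1}p,p,s),\qquad \Phi^B_h(q,p,s)=(q,p-h\nabla U(q),s),\qquad \Phi^O_h(q,z)=(q,F_hz+S_h\mathcal R),$$ where $\mathcal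 R\sim\mathcal N(0,I_{n+m})$ is drawn independently at each application of $\Phi^O$. Let $(X,Y,Z)$ be any ordering of the three letters $A,B,O$, and let $\mathcal P_h$ be the evolution operator (one-step transition operator) of the Markov chain of the scheme gle-XYZYX, $x_{k+1}=\Phi^X_{h/2}\circ\Phi^Y_{h/2}\circ\Phi^Z_h\circ\Phi^Y_{h/2}\circ\Phi^X_{h/2}(x_k)$. **Weights.** Let $G=\begin{pmatrix}0&-M^{-1}&0\\ \Omega&\Gamma_{11}M^{-1}&\Gamma_{12}\\0&\Gamma_{21}M^{-1}&\Gamma_{22}\end{pmatrix}$, so that $-Gx$ is the linear part of the drift. For a symmetric positive definite $C\in\mathbb R^{(2n+m)\times(2n+m)}$ let $\mathcal K_l(x)=(x^TCx)^l+1$, let $\|\varphi\|_{L^\infty_{\mathcal K_l}}=\sup_x|\varphi(x)/\mathcal K_l(x)|$, and let $L^\infty_{\mathcal K_l}$ be the space of measurable $\varphi:\Omega_{\bf x}\to\mathbb R$ for which this is finite. **Theorem.** There is a symmetric positive definite $C$ such that $G^TC+CG$ is positive definite. For every such $C$ and every integer $l\ge1$ there is $h^*>0$ such that for every $h\in(0,h^*)$: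 1. the Markov chain has a unique invariant probability measure $\pi_h$; $\pi_h$ has a density with respect to the Lebesgue measure on $\Omega_{\bf x}$, and $\int\mathcal K_{l'}\,d\pi_h<\infty$ for all $l'\in\mathbb N$; 2. there are constants $C_l>0$ and $r_l\in(0,1)$ such that for all $\varphi\in L^\infty_{\mathcal K_l}$ and all integers $k\ge0$, $$\left\|\mathcal P_h^k\varphi-\int\varphi\,d\pi_h\right\|_{L^\infty_{\mathcal K_l}}\le C_l\,r_l^k\,\|\varphi\|_{L^\infty_{\mathcal K_l}}$$ (in particular all integrals that occur here converge absolutely). -/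

import Mathlib

open MeasureTheory ProbabilityTheory Matrix

open scoped ContDiff Distributions

namespace GLE

noncomputable section

/-- Index set of `z = (p, s)`, with `p ∈ ℝⁿ` and `s ∈ ℝᵐ`. -/
abbrev ZIdx (n m : ℕ) := Fin n ⊕ Fin m

/-- Index set of `x = (q, p, s) = (q, z)`. -/
abbrev XIdx (n m : ℕ) := Fin n ⊕ ZIdx n m

/-- The state space `ℝⁿ × ℝⁿ × ℝᵐ`; its `volume` is the Lebesgue measure. -/
abbrev State (n m : ℕ) := XIdx n m → ℝ

/-- The position component of `x = (q, p, s)`. -/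
def qPart {n m : ℕ} (x : State n m) : Fin n → ℝ := fun i => x (Sum.inl i)

/-- The component `z = (p, s)` of `x = (q, p, s)`. -/
def zPart {n m : ℕ} (x : State n m) : ZIdx n m → ℝ := fun a => x (Sum.inr a)

/-- The momentum component of `x = (q, p, s)`. -/
def pPart {n m : ℕ} (x : State n m) : Fin n → ℝ := fun i => x (Sum.inr (Sum.inl i))

/-- The auxiliary component of `x = (q, p, s)`. -/
def sPart {n m : ℕ} (x : State n m) : Fin m → ℝ := fun j => x (Sum.inr (Sum.inr j))

/-- The state `(q, z)`. -/
def mkState {n m : ℕ} (q : Fin n → ℝ) (z : ZIdx n m → ℝ) : State n m := Sum.elim q z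

/-- The state `(q, p, s)`. -/
def mkState3 {n m : ℕ} (q p : Fin n → ℝ) (s : Fin m → ℝ) : State n m :=
  mkState q (Sum.elim p s)

/-- The partial derivative of `f` in the coordinate `i`. -/
def pd {ι : Type*} [Fintype ι] [DecidableEq ι] (i : ι) (f : (ι → ℝ) → ℝ) (x : ι → ℝ) : ℝ :=
  fderiv ℝ f x (Pi.single i 1)

/-- The gradient of `f`. -/
def grad {ι : Type*} [Fintype ι] [DecidableEq ι] (f : (ι → ℝ) → ℝ) (x : ι → ℝ) : ι → ℝ :=
  fun i => pd i f x

/-! ### The equation -/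

/-- The coefficients of the quasi-Markovian generalized Langevin equation
`q' = M⁻¹ p`, `(p, s)' = (-∇U(q), 0) - Γ (M⁻¹ p, s) + β^(-1/2) Σ W'`,
with `Sig` standing for `Σ`. -/
structure Coeffs (n m : ℕ) where
  M : Matrix (Fin n) (Fin n) ℝ
  Γ : Matrix (ZIdx n m) (ZIdx n m) ℝ
  Sig : Matrix (ZIdx n m) (ZIdx n m) ℝ
  β : ℝ

variable {n m : ℕ}

/-- `Γ_M = Γ diag(M⁻¹, I)`. -/
def Coeffs.ΓM (c : Coeffs n m) : Matrix (ZIdx n m) (ZIdx n m) ℝ :=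
  c.Γ * Matrix.fromBlocks c.M⁻¹ 0 0 1

/-- The generator of the equation with potential `U`,
`L v = -∇U(q)·∇_p v + M⁻¹ p·∇_q v - Γ_M z·∇_z v + (2β)⁻¹ ΣΣᵀ : ∇_z² v`. -/
def Coeffs.generator (c : Coeffs n m) (U : (Fin n → ℝ) → ℝ) (v : State n m → ℝ)
    (x : State n m) : ℝ :=
  -(∑ i : Fin n, pd i U (qPart x) * pd (Sum.inr (Sum.inl i)) v x)
    + (∑ i : Fin n, (c.M⁻¹ *ᵥ pPart x) i * pd (Sum.inl i) v x)
    - (∑ a : ZIdx n m, (c.ΓM *ᵥ zPart x) a * pd (Sum.inr a) v x)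
    + c.β⁻¹ / 2 * ∑ a : ZIdx n m, ∑ b : ZIdx n m,
        (c.Sig * c.Sigᵀ) a b * pd (Sum.inr a) (pd (Sum.inr b) v) x

/-- The operator `∂_t - L` on functions of `(t, x)`. -/
def Coeffs.kolmogorovOp (c : Coeffs n m) (U : (Fin n → ℝ) → ℝ) (v : ℝ × State n m → ℝ)
    (y : ℝ × State n m) : ℝ :=
  deriv (fun t => v (t, y.2)) y.1 - c.generator U (fun x => v (y.1, x)) y.2

/-- Hypoellipticity of a linear differential operator `P` with smooth coefficients: on every open
set `O`, a distribution `u` for which `P u` is a smooth function is itself a smooth function.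
`P u = f` on `O` means `u (ᵗP φ) = ∫ f φ` for every test function `φ`, and `ψ = ᵗP φ` is
expressed by the duality `∫ v ψ = ∫ (P v) φ` for all smooth `v`. -/
def IsHypoelliptic {E : Type*} [NormedAddCommGroup E] [NormedSpace ℝ E] [MeasureSpace E]
    (P : (E → ℝ) → E → ℝ) : Prop :=
  ∀ (O : TopologicalSpace.Opens E) (u : 𝓓'(O, ℝ)) (f : E → ℝ),
    ContDiffOn ℝ ∞ f (O : Set E) →
    (∀ φ ψ : 𝓓(O, ℝ),
      (∀ v : E → ℝ, ContDiff ℝ ∞ v → ∫ y, v y * ψ y = ∫ y, P v y * φ y) →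
        u ψ = ∫ y, f y * φ y) →
    ∃ g : E → ℝ, ContDiffOn ℝ ∞ g (O : Set E) ∧ ∀ φ : 𝓓(O, ℝ), u φ = ∫ y, g y * φ y

/-- The quadratic potential `q ↦ ½ qᵀ Ω q`. -/
def quadPotential (Ω : Matrix (Fin n) (Fin n) ℝ) (q : Fin n → ℝ) : ℝ :=
  1 / 2 * (q ⬝ᵥ Ω *ᵥ q)

/-! ### Assumptions -/

/-- Structural assumptions on the coefficients (fluctuation-dissipation relation with the
matrix `Q`, stability of `-Γ_M`, and `Γ₁₁ M = M Γ₁₁`). -/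
structure Coeffs.Structural (c : Coeffs n m) (Q : Matrix (Fin m) (Fin m) ℝ) : Prop where
  M_posDef : c.M.PosDef
  β_pos : 0 < c.β
  Q_posDef : Q.PosDef
  fluctuation_dissipation :
    c.Γ * Matrix.fromBlocks 1 0 0 Q + Matrix.fromBlocks 1 0 0 Q * c.Γᵀ = c.Sig * c.Sigᵀ
  stable : ∀ μ : ℂ,
    Module.End.HasEigenvalue (Matrix.toLin' (c.ΓM.map ((↑) : ℝ → ℂ))) μ → 0 < μ.re
  commute : Commute c.Γ.toBlocks₁₁ c.M

/-- The hypoellipticity assumption: `∂_t - L` is hypoelliptic for the harmonic potential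
`½ qᵀ Ω q`, and the vectors `Γ_M^k Σ_i` with `0 ≤ k ≤ n + m` span `ℝ^(n+m)`. -/
structure Coeffs.Hypo (c : Coeffs n m) (Ω : Matrix (Fin n) (Fin n) ℝ) : Prop where
  hypoelliptic : IsHypoelliptic (c.kolmogorovOp (quadPotential Ω))
  span_eq_top : Submodule.span ℝ
    {w : ZIdx n m → ℝ | ∃ k : ℕ, k ≤ n + m ∧ ∃ i : ZIdx n m, w = (c.ΓM ^ k) *ᵥ c.Sig.col i} = ⊤

/-- `U = ½ qᵀ Ω q + U₂` with `Ω` symmetric positive definite and `U₂` smooth, all of whose partial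
derivatives of order at least one are bounded. -/
structure PotentialAssumption (U : (Fin n → ℝ) → ℝ) (Ω : Matrix (Fin n) (Fin n) ℝ)
    (U₂ : (Fin n → ℝ) → ℝ) : Prop where
  Ω_posDef : Ω.PosDef
  smooth : ContDiff ℝ ∞ U₂
  bounded : ∀ k : ℕ, 1 ≤ k → ∀ i : Fin k → Fin n, ∃ b : ℝ, ∀ q : Fin n → ℝ,
    |iteratedFDeriv ℝ k U₂ q (fun j => Pi.single (i j) 1)| ≤ b
  eq_add : ∀ q, U q = quadPotential Ω q + U₂ q

/-! ### The splitting schemes -/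

/-- `F_h = exp(-h Γ_M)`. -/
def Coeffs.F (c : Coeffs n m) (h : ℝ) : Matrix (ZIdx n m) (ZIdx n m) ℝ :=
  NormedSpace.exp (-(h • c.ΓM))

/-- `S h` is, for each `h > 0`, a solution of
`S_h S_hᵀ = β⁻¹ (diag(M, Q) - F_h diag(M, Q) F_hᵀ)`. -/
def Coeffs.IsNoiseFactor (c : Coeffs n m) (Q : Matrix (Fin m) (Fin m) ℝ)
    (S : ℝ → Matrix (ZIdx n m) (ZIdx n m) ℝ) : Prop :=
  ∀ h : ℝ, 0 < h → S h * (S h)ᵀ = c.β⁻¹ •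
    (Matrix.fromBlocks c.M 0 0 Q - c.F h * Matrix.fromBlocks c.M 0 0 Q * (c.F h)ᵀ)

/-- `Φ^A_h (q, p, s) = (q + h M⁻¹ p, p, s)`. -/
def Coeffs.flowA (c : Coeffs n m) (h : ℝ) (x : State n m) : State n m :=
  mkState3 (qPart x + h • (c.M⁻¹ *ᵥ pPart x)) (pPart x) (sPart x)

/-- `Φ^B_h (q, p, s) = (q, p - h ∇U(q), s)`. -/
def flowB (U : (Fin n → ℝ) → ℝ) (h : ℝ) (x : State n m) : State n m :=
  mkState3 (qPart x) (pPart x - h • grad U (qPart x)) (sPart x)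

/-- `Φ^O_h (q, z) = (q, F_h z + S_h R)`, as a function of the state and of the value of `R`. -/
def Coeffs.flowO (c : Coeffs n m) (S : ℝ → Matrix (ZIdx n m) (ZIdx n m) ℝ) (h : ℝ)
    (y : State n m × (ZIdx n m → ℝ)) : State n m :=
  mkState (qPart y.1) (c.F h *ᵥ zPart y.1 + S h *ᵥ y.2)

lemma measurable_qPart : Measurable (qPart : State n m → Fin n → ℝ) :=
  measurable_pi_lambda _ fun _ => measurable_pi_apply _

lemma measurable_zPart : Measurable (zPart : State n m → ZIdx n m → ℝ) :=
  measurable_pi_lambda _ fun _ => measurable_pi_apply _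

lemma measurable_pPart : Measurable (pPart : State n m → Fin n → ℝ) :=
  measurable_pi_lambda _ fun _ => measurable_pi_apply _

lemma measurable_sPart : Measurable (sPart : State n m → Fin m → ℝ) :=
  measurable_pi_lambda _ fun _ => measurable_pi_apply _

lemma measurable_mulVec {ι κ : Type*} [Fintype κ] (A : Matrix ι κ ℝ) :
    Measurable fun v : κ → ℝ => A *ᵥ v := by
  refine measurable_pi_lambda _ fun i => ?_
  simp only [Matrix.mulVec, dotProduct]
  fun_prop

lemma measurable_grad (U : (Fin n → ℝ) → ℝ) : Measurable (grad U) :=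
  measurable_pi_lambda _ fun _ => measurable_fderiv_apply_const ℝ U _

lemma measurable_mkState {α : Type*} [MeasurableSpace α] {f : α → Fin n → ℝ}
    {g : α → ZIdx n m → ℝ} (hf : Measurable f) (hg : Measurable g) :
    Measurable fun a => mkState (f a) (g a) := by
  refine measurable_pi_lambda _ fun i => ?_
  cases i with
  | inl i => exact (measurable_pi_apply i).comp hf
  | inr i => exact (measurable_pi_apply i).comp hg

lemma measurable_mkState3 {α : Type*} [MeasurableSpace α] {f g : α → Fin n → ℝ}
    {k : α → Fin m → ℝ} (hf : Measurable f) (hg : Measurable g) (hk : Measurable k) :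
    Measurable fun a => mkState3 (f a) (g a) (k a) := by
  refine measurable_mkState hf (measurable_pi_lambda _ fun i => ?_)
  cases i with
  | inl i => exact (measurable_pi_apply i).comp hg
  | inr i => exact (measurable_pi_apply i).comp hk

lemma Coeffs.measurable_flowA (c : Coeffs n m) (h : ℝ) : Measurable (c.flowA h) :=
  measurable_mkState3
    (measurable_qPart.add (((measurable_mulVec _).comp measurable_pPart).const_smul h))
    measurable_pPart measurable_sPart

lemma measurable_flowB (U : (Fin n → ℝ) → ℝ) (h : ℝ) :
    Measurable (flowB U h : State n m → State n m) :=
  measurable_mkState3 measurable_qPart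
    (measurable_pPart.sub (((measurable_grad U).comp measurable_qPart).const_smul h))
    measurable_sPart

lemma Coeffs.measurable_flowO (c : Coeffs n m) (S : ℝ → Matrix (ZIdx n m) (ZIdx n m) ℝ) (h : ℝ) :
    Measurable (c.flowO S h) :=
  measurable_mkState (measurable_qPart.comp measurable_fst)
    (((measurable_mulVec _).comp (measurable_zPart.comp measurable_fst)).add
      ((measurable_mulVec _).comp measurable_snd))

/-- The labels of the three parts of the splitting. -/
inductive Part
  | A
  | B
  | O

/-- The law of `R`: independent standard normal components. -/
def stdNormal (n m : ℕ) : Measure (ZIdx n m → ℝ) :=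
  Measure.pi fun _ => gaussianReal 0 1

instance (n m : ℕ) : IsProbabilityMeasure (stdNormal n m) := by
  unfold stdNormal; infer_instance

/-- The transition kernel of one substep of length `h`. The O-step draws a fresh `R`. -/
def Coeffs.partKernel (c : Coeffs n m) (U : (Fin n → ℝ) → ℝ)
    (S : ℝ → Matrix (ZIdx n m) (ZIdx n m) ℝ) (h : ℝ) : Part → Kernel (State n m) (State n m)
  | Part.A => Kernel.deterministic (c.flowA h) (c.measurable_flowA h)
  | Part.B => Kernel.deterministic (flowB U h) (measurable_flowB U h)
  | Part.O => Kernel.deterministic (c.flowO S h) (c.measurable_flowO S h) ∘ₖ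
      (Kernel.id ×ₖ Kernel.const (State n m) (stdNormal n m))

/-- The transition kernel of the scheme gle-XYZYX with stepsize `h`,
`Φ^X_{h/2} ∘ Φ^Y_{h/2} ∘ Φ^Z_h ∘ Φ^Y_{h/2} ∘ Φ^X_{h/2}`. -/
def Coeffs.schemeKernel (c : Coeffs n m) (U : (Fin n → ℝ) → ℝ)
    (S : ℝ → Matrix (ZIdx n m) (ZIdx n m) ℝ) (X Y Z : Part) (h : ℝ) :
    Kernel (State n m) (State n m) :=
  c.partKernel U S (h / 2) X ∘ₖ c.partKernel U S (h / 2) Y ∘ₖ c.partKernel U S h Z ∘ₖ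
    c.partKernel U S (h / 2) Y ∘ₖ c.partKernel U S (h / 2) X

/-- The `k`-step transition kernel. -/
def iterKernel {α : Type*} [MeasurableSpace α] (κ : Kernel α α) : ℕ → Kernel α α
  | 0 => Kernel.id
  | k + 1 => κ ∘ₖ iterKernel κ k

/-- The evolution operator `(P^k φ)(x) = E[φ(x_k) | x_0 = x]` of the Markov chain with transition
kernel `κ`. -/
def evolve {α : Type*} [MeasurableSpace α] (κ : Kernel α α) (k : ℕ) (φ : α → ℝ) (x : α) : ℝ :=
  ∫ y, φ y ∂(iterKernel κ k x)

/-! ### Weighted norms -/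

/-- Membership in the weighted space `L^∞_K`. -/
def MemLinfWeight {α : Type*} [MeasurableSpace α] (K φ : α → ℝ) : Prop :=
  Measurable φ ∧ BddAbove (Set.range fun x => |φ x / K x|)

/-- The norm `sup_x |φ(x) / K(x)|` of `L^∞_K`. -/
def normLinfWeight {α : Type*} (K φ : α → ℝ) : ℝ :=
  ⨆ x, |φ x / K x|

/-- `K_l(x) = (xᵀ C x)^l + 1`. -/
def lyapunov (C : Matrix (XIdx n m) (XIdx n m) ℝ) (l : ℕ) (x : State n m) : ℝ :=
  (x ⬝ᵥ C *ᵥ x) ^ l + 1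

/-- The matrix `G` of the linear part of the drift: for `U = ½ qᵀ Ω q` the drift at `x` is `-G x`.
In blocks with respect to `(q, z)`, `G = [[0, (-M⁻¹, 0)], [(Ω; 0), Γ_M]]`. -/
def Coeffs.G (c : Coeffs n m) (Ω : Matrix (Fin n) (Fin n) ℝ) :
    Matrix (XIdx n m) (XIdx n m) ℝ :=
  Matrix.fromBlocks 0 (Matrix.fromCols (-c.M⁻¹) 0) (Matrix.fromRows Ω 0) c.ΓM

/-- The matrices `C` that define the weights: symmetric positive definite with `Gᵀ C + C G`
positive definite. -/
def Coeffs.IsWeightMatrix (c : Coeffs n m) (Ω : Matrix (Fin n) (Fin n) ℝ)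
    (C : Matrix (XIdx n m) (XIdx n m) ℝ) : Prop :=
  C.PosDef ∧ ((c.G Ω)ᵀ * C + C * c.G Ω).PosDef

/-- The Markov chain with transition kernel `κ` converges geometrically to `π` in `L^∞_K`. -/
def GeometricallyErgodic {α : Type*} [MeasurableSpace α] (κ : Kernel α α) (π : Measure α)
    (K : α → ℝ) : Prop :=
  ∃ A r : ℝ, 0 < A ∧ 0 < r ∧ r < 1 ∧ ∀ φ : α → ℝ, MemLinfWeight K φ →
    Integrable φ π ∧ ∀ k : ℕ, (∀ x, Integrable φ (iterKernel κ k x)) ∧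
      MemLinfWeight K (fun x => evolve κ k φ x - ∫ y, φ y ∂π) ∧
      normLinfWeight K (fun x => evolve κ k φ x - ∫ y, φ y ∂π) ≤ A * r ^ k * normLinfWeight K φ

end

end GLE

/-!
The theorem is Harris' theorem for the chain and its two-step kernel. The drift condition comes from
the linear part of the equation, and the minorization from its noise.

*Drift.* For the quadratic potential and without noise a step of the scheme is a matrix
`L h = 1 - h G + o(h)`, because the generators of the three substeps add up to the drift matrix `G`
(`Coeffs.hasDerivAt_schemeLin`). If `Gᵀ C + C G` is positive definite, then `L h` contracts the
quadratic form `C` for small `h` (`exists_contraction_of_hasDerivAt`). The true step differs from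
`L h` only by the noise and by the bounded force `-∇U₂`, so the deviation has moments bounded
uniformly in the starting point (`DevBound`), and every power of `xᵀ C x` satisfies a drift
condition (`DevBound.drift`).

*Existence of `C`.* With the covariance `D = diag(Ω⁻¹, M, Q)` and the noise matrix `B` of the full
system, the fluctuation-dissipation relation reads `G D + D Gᵀ = B Bᵀ`. If the pair `(G, B)`
satisfies the Kalman rank condition, the average `W` of `exp(-tG) D exp(-tG)ᵀ` over `[0, 1]` turns
this into a strict Lyapunov inequality, and `C = W⁻¹` is as required (`exists_posDef_lyapunov`).
The Kalman condition follows from hypoellipticity: if it failed, there would be a covector `a(t)`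
along which no noise acts and `a(t)ᵀ x` is constant along the flow, so that `|a(t)ᵀ x|` would be a
solution of `∂_t v = L v` in the sense of distributions that is not smooth
(`Coeffs.controllable_of_hypoelliptic`).

*Minorization.* The span condition on `Γ_M^k Σ_i` is the Kalman condition for the pair `(Γ_M, Σ)`;
it makes `S_h` invertible (`Coeffs.IsNoiseFactor.isUnit_det`), so an O-substep has a Gaussian
density in `z`. In two steps of any of the six schemes there are two O-substeps separated by A-
and B-substeps only, under which, for small `h`, the new position is a bi-Lipschitz function of
the old momentum onto `ℝⁿ` (`IsMixing`). The first O-substep then spreads the position and the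
second one spreads `z`. This bounds the two-step law from below by a fixed measure, uniformly on
balls (`Coeffs.exists_le_twoNoise`), and makes it absolutely continuous
(`Coeffs.twoNoise_absolutelyContinuous`). The area formula is not needed: a Lipschitz map onto the
space increases the Hausdorff measure at most by a constant factor, and preimages of null sets
under an antilipschitz map are null.

`harris` is proved by the oscillation contraction of Hairer and Mattingly. The invariant measure
is the setwise limit of the laws of the chain; it inherits the moments from the drift conditions
and the density from the two-step kernel.
-/

namespace GLE

noncomputable section

/-! ### Linear flows and the generator on functions of one linear coordinate -/

section LinearFlow

open scoped Matrix.Norms.Operator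

variable {ι : Type*} [Fintype ι] [DecidableEq ι]

lemma hasDerivAt_exp_neg_smul (A : Matrix ι ι ℝ) (t : ℝ) :
    HasDerivAt (fun s : ℝ => NormedSpace.exp (-(s • A))) (-(A * NormedSpace.exp (-(t • A)))) t := by
  have h := hasDerivAt_exp_smul_const' (𝕂 := ℝ) (-A) t
  simp only [smul_neg, neg_mul] at h
  exact h

lemma hasDerivAt_exp_neg_smul_mulVec (A : Matrix ι ι ℝ) (v : ι → ℝ) (t : ℝ) :
    HasDerivAt (fun s : ℝ => NormedSpace.exp (-(s • A)) *ᵥ v)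
      (-(A *ᵥ (NormedSpace.exp (-(t • A)) *ᵥ v))) t := by
  have h := hasDerivAt_exp_neg_smul A t
  let T : Matrix ι ι ℝ →L[ℝ] (ι → ℝ) :=
    LinearMap.toContinuousLinearMap ((Matrix.mulVecBilin ℝ ℝ).flip v)
  have h2 := T.hasFDerivAt.comp_hasDerivAt t h
  have e : T (-(A * NormedSpace.exp (-(t • A)))) =
      -(A *ᵥ (NormedSpace.exp (-(t • A)) *ᵥ v)) := by
    rw [Matrix.mulVec_mulVec, ← Matrix.neg_mulVec]
    rfl
  exact h2.congr_deriv e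

end LinearFlow

section Curves

variable {ι κ : Type*} [Fintype ι] [Fintype κ]

lemma hasDerivAt_dotProduct {a b : ℝ → ι → ℝ} {a' b' : ι → ℝ} {t : ℝ} (ha : HasDerivAt a a' t)
    (hb : HasDerivAt b b' t) :
    HasDerivAt (fun s => a s ⬝ᵥ b s) (a' ⬝ᵥ b t + a t ⬝ᵥ b') t := by
  simp only [dotProduct, ← Finset.sum_add_distrib]
  exact HasDerivAt.fun_sum fun i _ => ((hasDerivAt_pi.1 ha) i).mul ((hasDerivAt_pi.1 hb) i)

lemma hasDerivAt_mulVec {a : ℝ → ι → ℝ} {a' : ι → ℝ} {t : ℝ} (B : Matrix κ ι ℝ)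
    (ha : HasDerivAt a a' t) : HasDerivAt (fun s => B *ᵥ a s) (B *ᵥ a') t := by
  have := (LinearMap.toContinuousLinearMap (Matrix.mulVecLin B)).hasFDerivAt.comp_hasDerivAt t ha
  simpa [Function.comp_def] using this

lemma contDiff_exp_neg_smul_mulVec [DecidableEq ι] (A : Matrix ι ι ℝ) (v : ι → ℝ) :
    ContDiff ℝ ∞ (fun s : ℝ => NormedSpace.exp (-(s • A)) *ᵥ v) := by
  rw [contDiff_infty]
  intro k
  have hd := hasDerivAt_exp_neg_smul_mulVec A v
  induction k with
  | zero => exact contDiff_zero.2 (continuous_iff_continuousAt.2 fun t => (hd t).continuousAt)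
  | succ k ih =>
    rw [Nat.cast_succ, contDiff_succ_iff_deriv]
    refine ⟨fun t => (hd t).differentiableAt, by simp, ?_⟩
    rw [show deriv (fun s : ℝ => NormedSpace.exp (-(s • A)) *ᵥ v) =
      fun t => -(A *ᵥ (NormedSpace.exp (-(t • A)) *ᵥ v)) from funext fun t => (hd t).deriv]
    exact ((LinearMap.toContinuousLinearMap (Matrix.mulVecLin A)).contDiff.comp ih).neg

end Curves

variable {n m : ℕ}

lemma qPart_def (x : State n m) : qPart x = fun i => x (Sum.inl i) := rfl

lemma zPart_def (x : State n m) : zPart x = fun a => x (Sum.inr a) := rfl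

lemma pPart_def (x : State n m) : pPart x = fun i => x (Sum.inr (Sum.inl i)) := rfl

lemma pd_comp_dotProduct {ι : Type*} [Fintype ι] [DecidableEq ι] {g : ℝ → ℝ}
    (hg : Differentiable ℝ g) (b : ι → ℝ) (i : ι) (x : ι → ℝ) :
    pd i (fun x => g (b ⬝ᵥ x)) x = deriv g (b ⬝ᵥ x) * b i := by
  let T : (ι → ℝ) →L[ℝ] ℝ := LinearMap.toContinuousLinearMap (dotProductBilin ℝ ℝ b)
  have h : HasFDerivAt (fun x => g (b ⬝ᵥ x)) (deriv g (b ⬝ᵥ x) • T) x :=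
    (hg (T x)).hasDerivAt.comp_hasFDerivAt x T.hasFDerivAt
  rw [pd, h.fderiv]
  simp [T]

lemma differentiable_quadPotential (Ω : Matrix (Fin n) (Fin n) ℝ) :
    Differentiable ℝ (quadPotential Ω) := by
  unfold quadPotential
  simp only [dotProduct, Matrix.mulVec]
  fun_prop

lemma pd_quadPotential {Ω : Matrix (Fin n) (Fin n) ℝ} (hΩ : Ω.IsSymm) (i : Fin n)
    (q : Fin n → ℝ) : pd i (quadPotential Ω) q = (Ω *ᵥ q) i := by
  let T : (Fin n → ℝ) →L[ℝ] (Fin n → ℝ) := LinearMap.toContinuousLinearMap (Matrix.mulVecLin Ω)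
  have hl : HasDerivAt (fun s : ℝ => q + s • (Pi.single i 1 : Fin n → ℝ)) (Pi.single i 1) 0 := by
    simpa using ((hasDerivAt_id (0 : ℝ)).smul_const (Pi.single i 1 : Fin n → ℝ)).const_add q
  have h1 := (hasDerivAt_dotProduct hl (hasDerivAt_mulVec Ω hl)).const_mul (1 / 2 : ℝ)
  have h2 := (differentiable_quadPotential Ω
    (q + (0 : ℝ) • Pi.single i 1)).hasFDerivAt.comp_hasDerivAt 0 hl
  have h3 := h2.unique h1
  simp only [zero_smul, add_zero] at h3
  rw [pd, h3]
  have : q ⬝ᵥ Ω *ᵥ Pi.single i 1 = (Ω *ᵥ q) i := by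
    rw [Matrix.dotProduct_mulVec, ← Matrix.mulVec_transpose, hΩ.eq]
    simp
  rw [this]
  simp
  ring

/-- The noise matrix of the equation on the full state space: no noise acts on `q`. -/
def Coeffs.noiseMatrix (c : Coeffs n m) : Matrix (XIdx n m) (ZIdx n m) ℝ :=
  Matrix.fromRows 0 c.Sig

/-- On a function of a linear coordinate `b ⬝ x` on which no noise acts, the generator is a first
order operator. -/
lemma Coeffs.generator_comp_dotProduct (c : Coeffs n m) {Ω : Matrix (Fin n) (Fin n) ℝ}
    (hΩ : Ω.IsSymm) {g : ℝ → ℝ} (hg : ContDiff ℝ 2 g) (b : State n m)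
    (hb : c.noiseMatrixᵀ *ᵥ b = 0) (x : State n m) :
    c.generator (quadPotential Ω) (fun x => g (b ⬝ᵥ x)) x =
      -(deriv g (b ⬝ᵥ x) * (b ⬝ᵥ (c.G Ω *ᵥ x))) := by
  have hg1 : Differentiable ℝ g := hg.differentiable (by norm_num)
  have hg2 : Differentiable ℝ (deriv g) := by
    have : ContDiff ℝ (1 + 1) g := by simpa [one_add_one_eq_two] using hg
    exact (contDiff_succ_iff_deriv.1 this).2.2.differentiable (by norm_num)
  have hpd : ∀ i, pd i (fun x => g (b ⬝ᵥ x)) = fun x => b i * deriv g (b ⬝ᵥ x) := fun i =>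
    funext fun x => by rw [pd_comp_dotProduct hg1, mul_comm]
  have hpd2 : ∀ i j, pd i (pd j (fun x => g (b ⬝ᵥ x))) x =
      b j * (deriv (deriv g) (b ⬝ᵥ x) * b i) := fun i j => by
    rw [hpd j, ← pd_comp_dotProduct hg2]
    simp only [pd]
    rw [fderiv_const_mul]
    · rfl
    · exact (hg2 _).comp x (LinearMap.toContinuousLinearMap
        (dotProductBilin ℝ ℝ b)).differentiableAt
  have hs : c.Sigᵀ *ᵥ zPart b = 0 := by
    have h : c.noiseMatrixᵀ *ᵥ b = c.Sigᵀ *ᵥ zPart b := by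
      conv_lhs => rw [← Sum.elim_comp_inl_inr b]
      rw [Coeffs.noiseMatrix, Matrix.transpose_fromRows, Matrix.fromCols_mulVec_sumElim]
      simp [Function.comp_def, zPart_def]
    rw [← h, hb]
  have hdiff : ∑ a : ZIdx n m, ∑ a' : ZIdx n m, (c.Sig * c.Sigᵀ) a a' *
      pd (Sum.inr a) (pd (Sum.inr a') (fun x => g (b ⬝ᵥ x))) x = 0 := by
    have h0 : (c.Sig * c.Sigᵀ) *ᵥ zPart b = 0 := by rw [← Matrix.mulVec_mulVec, hs]; simp
    refine Finset.sum_eq_zero fun a _ => ?_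
    have h1 := congrFun h0 a
    simp only [Matrix.mulVec, dotProduct, zPart, Pi.zero_apply] at h1
    calc _ = (∑ a', (c.Sig * c.Sigᵀ) a a' * b (Sum.inr a')) *
          (deriv (deriv g) (b ⬝ᵥ x) * b (Sum.inr a)) := by
            rw [Finset.sum_mul]
            exact Finset.sum_congr rfl fun a' _ => by rw [hpd2]; ring
      _ = 0 := by rw [h1, zero_mul]
  have hG : c.G Ω *ᵥ x = Sum.elim (-(c.M⁻¹ *ᵥ pPart x))
      (Sum.elim (Ω *ᵥ qPart x) 0 + c.ΓM *ᵥ zPart x) := by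
    conv_lhs => rw [← Sum.elim_comp_inl_inr x]
    rw [Coeffs.G, Matrix.fromBlocks_mulVec]
    have h1 : Matrix.fromCols (-c.M⁻¹) (0 : Matrix (Fin n) (Fin m) ℝ) *ᵥ (x ∘ Sum.inr) =
        -(c.M⁻¹ *ᵥ pPart x) := by
      conv_lhs => rw [← Sum.elim_comp_inl_inr (x ∘ Sum.inr)]
      rw [Matrix.fromCols_mulVec_sumElim]
      simp [Matrix.neg_mulVec, Function.comp_def, pPart_def]
    have h2 : Matrix.fromRows Ω (0 : Matrix (Fin m) (Fin n) ℝ) *ᵥ (x ∘ Sum.inl) =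
        Sum.elim (Ω *ᵥ qPart x) 0 := by
      rw [Matrix.fromRows_mulVec]
      simp [Function.comp_def, qPart_def]
    simp only [Sum.elim_comp_inl, Sum.elim_comp_inr, h1, h2]
    simp [Function.comp_def, zPart_def]
  have hsum : ∀ {ι : Type} [Fintype ι] (f d : ι → ℝ) (k : ℝ),
      ∑ i, f i * (d i * k) = k * ∑ i, d i * f i := fun f d k => by
    rw [Finset.mul_sum]
    exact Finset.sum_congr rfl fun i _ => by ring
  rw [generator, hdiff, hG]
  simp only [hpd, pd_quadPotential hΩ, hsum]
  generalize deriv g (b ⬝ᵥ x) = k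
  simp only [dotProduct, Fintype.sum_sum_type, Sum.elim_inl, Sum.elim_inr, Pi.neg_apply,
    Pi.add_apply, Pi.zero_apply, mul_zero, add_zero, mul_neg, mul_add,
    Finset.sum_add_distrib, Finset.sum_neg_distrib, Finset.sum_const_zero]
  ring

/-! ### Hypoellipticity implies controllability -/

/-- A continuous function that is a uniform limit of smooth solutions of `P v = 0` is
smooth if `P` is hypoelliptic. -/
lemma IsHypoelliptic.contDiff_of_approx {E : Type*} [NormedAddCommGroup E] [NormedSpace ℝ E]
    [FiniteDimensional ℝ E] [MeasureSpace E] [BorelSpace E]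
    [(volume : Measure E).IsAddHaarMeasure]
    {P : (E → ℝ) → E → ℝ} (hP : IsHypoelliptic P) {u : E → ℝ} (hu : Continuous u)
    (happrox : ∀ ε : ℝ, 0 < ε → ∃ v : E → ℝ, ContDiff ℝ ∞ v ∧ (∀ y, P v y = 0) ∧
      ∀ y, |u y - v y| ≤ ε) : ContDiff ℝ ∞ u := by
  have hloc : ∀ {w : E → ℝ}, Continuous w → LocallyIntegrable w := fun h => h.locallyIntegrable
  let T : 𝓓'((⊤ : TopologicalSpace.Opens E), ℝ) :=
    TestFunction.integralAgainstBilinCLM (ContinuousLinearMap.mul ℝ ℝ) volume u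
  have hT : ∀ φ : 𝓓((⊤ : TopologicalSpace.Opens E), ℝ), T φ = ∫ y, φ y * u y := fun φ =>
    TestFunction.integralAgainstBilinCLM_eq_integral ((hloc hu).locallyIntegrableOn _)
  have hint : ∀ (φ : 𝓓((⊤ : TopologicalSpace.Opens E), ℝ)) {w : E → ℝ}, Continuous w →
      Integrable fun y => φ y * w y := fun φ w hw =>
    (φ.continuous.mul hw).integrable_of_hasCompactSupport φ.hasCompactSupport.mul_right
  obtain ⟨g, hg, hug⟩ := hP ⊤ T 0 contDiffOn_const (fun φ ψ hψ => by
    simp only [Pi.zero_apply, zero_mul, integral_zero]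
    rw [hT]
    have hI : Integrable fun y => |ψ y| := by
      simpa using (hint ψ (w := fun _ => 1) continuous_const).abs
    -- `ψ` is the formal adjoint applied to `φ`, so that `∫ ψ v = ∫ φ (P v) = 0` for the
    -- approximating solutions `v`
    have key : ∀ ε : ℝ, 0 < ε → |∫ y, ψ y * u y| ≤ ε * ∫ y, |ψ y| := fun ε hε => by
      obtain ⟨v, hv, hPv, hb⟩ := happrox ε hε
      have h0 : ∫ y, ψ y * v y = 0 := by
        have := hψ v hv
        simpa [hPv, mul_comm] using this
      have h1 : ∫ y, ψ y * u y = ∫ y, ψ y * (u y - v y) := by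
        simp only [mul_sub]
        rw [integral_sub (hint ψ hu) (hint ψ hv.continuous), h0, sub_zero]
      rw [h1, ← integral_const_mul]
      refine (abs_integral_le_integral_abs).trans ?_
      refine integral_mono (hint ψ (hu.sub hv.continuous)).abs (hI.const_mul ε) fun y => ?_
      rw [abs_mul, mul_comm]
      exact mul_le_mul_of_nonneg_right (hb y) (abs_nonneg _)
    have hnn : 0 ≤ ∫ y, |ψ y| := integral_nonneg fun _ => abs_nonneg _
    by_contra hne
    have hpos := abs_pos.2 hne
    have := key (|∫ y, ψ y * u y| / (2 * ((∫ y, |ψ y|) + 1))) (by positivity)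
    have h2 : |∫ y, ψ y * u y| / (2 * ((∫ y, |ψ y|) + 1)) * ∫ y, |ψ y| <
        |∫ y, ψ y * u y| := by
      rw [div_mul_eq_mul_div, div_lt_iff₀ (by positivity)]
      nlinarith
    linarith)
  have hg' : ContDiff ℝ ∞ g := contDiffOn_univ.1 (by simpa using hg)
  -- `u` and `g` define the same distribution
  have hae : ∀ᵐ y : E, u y = g y := by
    refine ae_eq_of_integral_contDiff_smul_eq (hloc hu) (hloc hg'.continuous) fun φ hφ hφc => ?_
    let Φ : 𝓓((⊤ : TopologicalSpace.Opens E), ℝ) := ⟨φ, hφ, hφc, by simp⟩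
    have h1 := hT Φ
    rw [hug Φ] at h1
    have hΦ : ∀ y, Φ y = φ y := fun y => rfl
    simp only [hΦ] at h1
    simp only [smul_eq_mul]
    rw [← h1]
    simp only [mul_comm]
  have : u = g := hu.ae_eq_iff_eq volume hg'.continuous |>.1 hae
  exact this ▸ hg'

lemma mulVec_exp_neg_smul_mulVec_eq_zero {ι κ : Type*} [Fintype ι] [DecidableEq ι] [Fintype κ]
    {A : Matrix ι ι ℝ} {B : Matrix κ ι ℝ} {v : ι → ℝ} (h : ∀ k : ℕ, B *ᵥ ((A ^ k) *ᵥ v) = 0)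
    (t : ℝ) : B *ᵥ (NormedSpace.exp (-(t • A)) *ᵥ v) = 0 := by
  let _ : NormedRing (Matrix ι ι ℝ) := Matrix.linftyOpNormedRing
  let _ : NormedAlgebra ℝ (Matrix ι ι ℝ) := Matrix.linftyOpNormedAlgebra
  let T : Matrix ι ι ℝ →ₗ[ℝ] (κ → ℝ) :=
    (Matrix.mulVecLin B) ∘ₗ ((Matrix.mulVecBilin ℝ ℝ).flip v)
  have hT : ∀ X, T X = B *ᵥ (X *ᵥ v) := fun X => rfl
  have hs := (NormedSpace.exp_series_hasSum_exp' (𝕂 := ℝ) (-(t • A))).mapL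
    (LinearMap.toContinuousLinearMap T)
  refine hs.unique ?_
  convert! hasSum_zero with k
  change T _ = 0
  rw [hT, ← neg_smul, smul_pow, Matrix.smul_mulVec, Matrix.smul_mulVec, Matrix.mulVec_smul,
    Matrix.mulVec_smul, h, smul_zero, smul_zero]

/-- Hypoellipticity of `∂_t - L` forces the Kalman condition for the pair of the drift matrix and
the noise matrix. Otherwise some `v ≠ 0` is annihilated by all `Bᵀ (Gᵀ)^k`, no noise reaches the
coordinate `exp(-t Gᵀ) v ⬝ x`, which is constant along the flow, and its absolute value is a
nonsmooth solution. -/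
lemma Coeffs.controllable_of_hypoelliptic (c : Coeffs n m) {Ω : Matrix (Fin n) (Fin n) ℝ}
    (hΩ : Ω.IsSymm) (hP : IsHypoelliptic (c.kolmogorovOp (quadPotential Ω))) (v : State n m)
    (hv : ∀ k : ℕ, c.noiseMatrixᵀ *ᵥ (((c.G Ω)ᵀ ^ k) *ᵥ v) = 0) : v = 0 := by
  by_contra hne
  set a : ℝ → State n m := fun t => NormedSpace.exp (-(t • (c.G Ω)ᵀ)) *ᵥ v with ha
  have hda : ∀ t, HasDerivAt a (-((c.G Ω)ᵀ *ᵥ a t)) t := hasDerivAt_exp_neg_smul_mulVec _ v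
  have hBa : ∀ t, c.noiseMatrixᵀ *ᵥ a t = 0 := mulVec_exp_neg_smul_mulVec_eq_zero hv
  have ha0 : a 0 = v := by simp [ha]
  have hw : ContDiff ℝ ∞ fun y : ℝ × State n m => a y.1 ⬝ᵥ y.2 := by
    simp only [dotProduct]
    refine ContDiff.sum fun i _ => ?_
    exact (((contDiff_pi.1 (contDiff_exp_neg_smul_mulVec _ v)) i).comp contDiff_fst).mul
      ((contDiff_apply ℝ ℝ i).comp contDiff_snd)
  have : (volume : Measure (ℝ × State n m)).IsAddHaarMeasure := by
    rw [Measure.volume_eq_prod]; infer_instance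
  have hu : ContDiff ℝ ∞ fun y : ℝ × State n m => |a y.1 ⬝ᵥ y.2| := by
    refine hP.contDiff_of_approx hw.continuous.abs fun ε hε => ?_
    -- smooth functions of `a(t) ⬝ x` are solutions, and `√(ε² + r²)` approximates `|r|`
    set g : ℝ → ℝ := fun r => √(ε ^ 2 + r ^ 2) with hgdef
    have hpos : ∀ r : ℝ, 0 < ε ^ 2 + r ^ 2 := fun r => by positivity
    have hg : ContDiff ℝ ∞ g :=
      ContDiff.sqrt (contDiff_const.add (contDiff_id.pow 2)) fun r => (hpos r).ne'
    refine ⟨fun y => g (a y.1 ⬝ᵥ y.2), hg.comp hw, fun y => ?_, fun y => ?_⟩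
    · rw [kolmogorovOp]
      simp only
      rw [c.generator_comp_dotProduct hΩ (contDiff_infty.1 hg 2) _ (hBa _)]
      have h1 := hasDerivAt_dotProduct (hda y.1) (hasDerivAt_const y.1 y.2)
      have h2 := ((hg.differentiable (by simp)) (a y.1 ⬝ᵥ y.2)).hasDerivAt.comp y.1 h1
      have h3 : deriv (fun t => g (a t ⬝ᵥ y.2)) y.1 = _ := h2.deriv
      rw [h3]
      have h4 : (c.G Ω)ᵀ *ᵥ a y.1 ⬝ᵥ y.2 = a y.1 ⬝ᵥ (c.G Ω *ᵥ y.2) := by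
        rw [Matrix.mulVec_transpose, Matrix.dotProduct_mulVec]
      simp [h4]
    · simp only
      generalize a y.1 ⬝ᵥ y.2 = r
      have h1 : |r| ≤ g r := Real.abs_le_sqrt (by nlinarith [sq_nonneg ε])
      have h2 : g r ≤ |r| + ε := by
        refine Real.sqrt_le_iff.2 ⟨by positivity, ?_⟩
        nlinarith [sq_abs r, mul_nonneg (abs_nonneg r) hε.le]
      rw [abs_le]
      constructor <;> linarith
  have hvv : 0 < v ⬝ᵥ v := by
    simpa using (Matrix.dotProduct_star_self_pos_iff.2 hne)
  -- on the line `s ↦ (0, s v)` the solution is a multiple of `|s|`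
  refine not_differentiableAt_abs_zero ?_
  have hcurve : Differentiable ℝ fun s : ℝ => ((0 : ℝ), s • v) :=
    (differentiable_const _).prodMk (differentiable_id.smul_const v)
  have h := ((hu.differentiable (by simp)).comp hcurve).const_mul (v ⬝ᵥ v)⁻¹
  have e : (fun s : ℝ => |s|) = fun s => (v ⬝ᵥ v)⁻¹ *
      ((fun y : ℝ × State n m => |a y.1 ⬝ᵥ y.2|) ∘ fun s : ℝ => ((0 : ℝ), s • v)) s := by
    funext s
    simp only [Function.comp_apply, ha0, dotProduct_smul, smul_eq_mul, abs_mul, abs_of_pos hvv]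
    field_simp
  change DifferentiableAt ℝ (fun s : ℝ => |s|) 0
  rw [e]
  exact h 0

/-! ### Lyapunov equations of controllable pairs -/

section Gramian

variable {ι κ : Type*} [Fintype ι]

lemma posDef_of_dotProduct {C : Matrix ι ι ℝ} (hs : C.IsSymm)
    (h : ∀ x : ι → ℝ, x ≠ 0 → 0 < x ⬝ᵥ C *ᵥ x) : C.PosDef := by
  refine Matrix.PosDef.of_dotProduct_mulVec_pos ?_ fun x hx => by simpa using h x hx
  rw [Matrix.IsHermitian, Matrix.conjTranspose_eq_transpose_of_trivial]
  exact hs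

lemma _root_.Matrix.PosDef.dotProduct_pos {C : Matrix ι ι ℝ} (hC : C.PosDef) {x : ι → ℝ}
    (hx : x ≠ 0) : 0 < x ⬝ᵥ C *ᵥ x := by
  simpa using hC.dotProduct_mulVec_pos hx

omit [Fintype ι] in
lemma _root_.Matrix.PosDef.isSymm {C : Matrix ι ι ℝ} (hC : C.PosDef) : C.IsSymm := by
  have := hC.isHermitian
  rwa [Matrix.IsHermitian, Matrix.conjTranspose_eq_transpose_of_trivial] at this

variable [DecidableEq ι] [Fintype κ]

/-- The flow `exp(-tA) D exp(-tA)ᵀ` of a covariance matrix `D`. -/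
def conjFlow (A D : Matrix ι ι ℝ) (t : ℝ) : Matrix ι ι ℝ :=
  NormedSpace.exp (-(t • A)) * D * (NormedSpace.exp (-(t • A)))ᵀ

lemma conjFlow_zero (A D : Matrix ι ι ℝ) : conjFlow A D 0 = D := by
  simp [conjFlow]

lemma exp_neg_smul_transpose (A : Matrix ι ι ℝ) (t : ℝ) :
    (NormedSpace.exp (-(t • A)))ᵀ = NormedSpace.exp (-(t • Aᵀ)) := by
  rw [← Matrix.exp_transpose, Matrix.transpose_neg, Matrix.transpose_smul]

lemma dotProduct_conjFlow (A D : Matrix ι ι ℝ) (t : ℝ) (x y : ι → ℝ) :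
    x ⬝ᵥ conjFlow A D t *ᵥ y = (NormedSpace.exp (-(t • Aᵀ)) *ᵥ x) ⬝ᵥ
      D *ᵥ (NormedSpace.exp (-(t • Aᵀ)) *ᵥ y) := by
  rw [conjFlow, ← exp_neg_smul_transpose, ← Matrix.mulVec_mulVec, ← Matrix.mulVec_mulVec,
    Matrix.dotProduct_mulVec, ← Matrix.mulVec_transpose]

lemma mul_exp_neg_smul_comm (A : Matrix ι ι ℝ) (t : ℝ) :
    A * NormedSpace.exp (-(t • A)) = NormedSpace.exp (-(t • A)) * A := by
  have : Commute A (-(t • A)) := ((Commute.refl A).smul_right t).neg_right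
  exact (this.exp_right : Commute A _)

omit [Fintype κ] in
lemma hasDerivAt_conjFlow {A D : Matrix ι ι ℝ} (x y : ι → ℝ) (t : ℝ) :
    HasDerivAt (fun s => x ⬝ᵥ conjFlow A D s *ᵥ y)
      (-(x ⬝ᵥ (A * conjFlow A D t + conjFlow A D t * Aᵀ) *ᵥ y)) t := by
  simp only [dotProduct_conjFlow]
  have h1 := hasDerivAt_exp_neg_smul_mulVec Aᵀ x t
  have h2 := hasDerivAt_mulVec D (hasDerivAt_exp_neg_smul_mulVec Aᵀ y t)
  refine (hasDerivAt_dotProduct h1 h2).congr_deriv ?_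
  have c1 : ∀ z, Aᵀ *ᵥ (NormedSpace.exp (-(t • Aᵀ)) *ᵥ z) =
      NormedSpace.exp (-(t • Aᵀ)) *ᵥ (Aᵀ *ᵥ z) := fun z => by
    rw [Matrix.mulVec_mulVec, mul_exp_neg_smul_comm, Matrix.mulVec_mulVec]
  rw [Matrix.add_mulVec, dotProduct_add, ← Matrix.mulVec_mulVec, Matrix.dotProduct_mulVec x A,
    ← Matrix.mulVec_transpose, ← Matrix.mulVec_mulVec, dotProduct_conjFlow, dotProduct_conjFlow,
    c1, c1]
  simp [Matrix.mulVec_neg]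
  ring

/-- The Gramian of a controllable pair `(A, B)` is positive definite: if `A D + D Aᵀ = B Bᵀ`, then
`D - exp(-TA) D exp(-TA)ᵀ` is the integral of `exp(-tA) B Bᵀ exp(-tA)ᵀ` over `[0, T]`. -/
lemma posDef_sub_conjFlow {A D : Matrix ι ι ℝ} {B : Matrix ι κ ℝ} (hD : D.IsSymm)
    (hL : A * D + D * Aᵀ = B * Bᵀ)
    (hctrl : ∀ v : ι → ℝ, (∀ k : ℕ, Bᵀ *ᵥ ((Aᵀ ^ k) *ᵥ v) = 0) → v = 0) {T : ℝ} (hT : 0 < T) :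
    (D - conjFlow A D T).PosDef := by
  refine posDef_of_dotProduct ?_ fun v hv => ?_
  · rw [Matrix.IsSymm, Matrix.transpose_sub, hD.eq, conjFlow]
    simp [Matrix.transpose_mul, hD.eq, Matrix.mul_assoc]
  set w : ℝ → ι → ℝ := fun t => NormedSpace.exp (-(t • Aᵀ)) *ᵥ v with hw
  have hdw : ∀ t, HasDerivAt w (-(Aᵀ *ᵥ w t)) t := hasDerivAt_exp_neg_smul_mulVec Aᵀ v
  set f : ℝ → ℝ := fun t => w t ⬝ᵥ D *ᵥ w t with hf
  have hdf : ∀ t, HasDerivAt f (-((Bᵀ *ᵥ w t) ⬝ᵥ (Bᵀ *ᵥ w t))) t := fun t => by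
    refine (hasDerivAt_dotProduct (hdw t) (hasDerivAt_mulVec D (hdw t))).congr_deriv ?_
    have e : (Bᵀ *ᵥ w t) ⬝ᵥ (Bᵀ *ᵥ w t) = w t ⬝ᵥ (A * D + D * Aᵀ) *ᵥ w t := by
      rw [hL, ← Matrix.mulVec_mulVec, Matrix.dotProduct_mulVec (w t) B, ← Matrix.mulVec_transpose]
    rw [e, Matrix.add_mulVec, dotProduct_add, ← Matrix.mulVec_mulVec,
      Matrix.dotProduct_mulVec (w t) A, ← Matrix.mulVec_transpose, ← Matrix.mulVec_mulVec]
    simp [Matrix.mulVec_neg]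
    ring
  have hanti : Antitone f := by
    refine antitone_of_deriv_nonpos (fun t => (hdf t).differentiableAt) fun t => ?_
    rw [(hdf t).deriv, neg_nonpos]
    exact Finset.sum_nonneg fun i _ => mul_self_nonneg _
  have hval : v ⬝ᵥ (D - conjFlow A D T) *ᵥ v = f 0 - f T := by
    rw [Matrix.sub_mulVec, dotProduct_sub, dotProduct_conjFlow]
    simp [hf, hw]
  rw [hval, sub_pos]
  -- otherwise `f` is constant on `[0, T]`, and repeated differentiation of `Bᵀ w = 0` contradicts
  -- the Kalman condition
  by_contra! hle
  have hconst : ∀ t ∈ Set.Icc 0 T, f t = f 0 := fun t ht =>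
    le_antisymm (hanti ht.1) (hle.trans (hanti ht.2))
  have hzero : ∀ k : ℕ, ∀ t ∈ Set.Ioo 0 T, Bᵀ *ᵥ ((Aᵀ ^ k) *ᵥ w t) = 0 := by
    intro k
    induction k with
    | zero =>
      intro t ht
      have h1 : f =ᶠ[nhds t] fun _ => f 0 :=
        Filter.eventually_of_mem (Icc_mem_nhds ht.1 ht.2) hconst
      have h2 := (hdf t).unique ((hasDerivAt_const t (f 0)).congr_of_eventuallyEq h1)
      simpa using h2
    | succ k ih =>
      intro t ht
      have h1 : (fun s => Bᵀ *ᵥ ((Aᵀ ^ k) *ᵥ w s)) =ᶠ[nhds t] fun _ => 0 :=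
        Filter.eventually_of_mem (Ioo_mem_nhds ht.1 ht.2) ih
      have h2 := hasDerivAt_mulVec Bᵀ (hasDerivAt_mulVec (Aᵀ ^ k) (hdw t))
      have h3 := h2.unique ((hasDerivAt_const t (0 : κ → ℝ)).congr_of_eventuallyEq h1)
      rw [Matrix.mulVec_neg, Matrix.mulVec_neg, neg_eq_zero] at h3
      rw [pow_succ, ← Matrix.mulVec_mulVec]
      exact h3
  have hw0 : w (T / 2) = 0 :=
    hctrl _ fun k => hzero k _ ⟨by linarith, by linarith⟩
  have hinj := Matrix.mulVec_injective_iff_isUnit.2 (Matrix.isUnit_exp (-((T / 2) • Aᵀ)))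
  exact hv (hinj (by simpa [hw] using hw0))

/-- The Lyapunov equation of a controllable pair has a strict solution. The average of
`exp(-tA) D exp(-tA)ᵀ` over a time interval satisfies a strict Lyapunov inequality for `Aᵀ`, and
its inverse one for `A`. -/
lemma exists_posDef_lyapunov {A D : Matrix ι ι ℝ} {B : Matrix ι κ ℝ} (hD : D.PosDef)
    (hL : A * D + D * Aᵀ = B * Bᵀ)
    (hctrl : ∀ v : ι → ℝ, (∀ k : ℕ, Bᵀ *ᵥ ((Aᵀ ^ k) *ᵥ v) = 0) → v = 0) :
    ∃ C : Matrix ι ι ℝ, C.PosDef ∧ (Aᵀ * C + C * A).PosDef := by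
  have hDs := hD.isSymm
  have hYs : ∀ t, (conjFlow A D t).IsSymm := fun t => by
    simp [Matrix.IsSymm, conjFlow, Matrix.transpose_mul, hDs.eq, Matrix.mul_assoc]
  have hcont : ∀ x y : ι → ℝ, Continuous fun t => x ⬝ᵥ conjFlow A D t *ᵥ y := fun x y =>
    continuous_iff_continuousAt.2 fun t => (hasDerivAt_conjFlow x y t).continuousAt
  have hentry : ∀ i j t, conjFlow A D t i j =
      (Pi.single i 1 : ι → ℝ) ⬝ᵥ conjFlow A D t *ᵥ (Pi.single j 1 : ι → ℝ) := fun i j t => by simp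
  -- the average of the flow over `[0, 1]`; the derivative of the flow integrates to `hLW`
  let W : Matrix ι ι ℝ := Matrix.of fun i j => ∫ t in (0 : ℝ)..1, conjFlow A D t i j
  have hW : ∀ x y : ι → ℝ, x ⬝ᵥ W *ᵥ y = ∫ t in (0 : ℝ)..1, x ⬝ᵥ conjFlow A D t *ᵥ y := by
    intro x y
    have hci : ∀ i j, Continuous fun t => conjFlow A D t i j := fun i j => by
      simp only [hentry]; exact hcont _ _
    simp only [dotProduct, Matrix.mulVec, Finset.mul_sum, W, Matrix.of_apply]
    have hc1 : ∀ i j, Continuous fun t => x i * (conjFlow A D t i j * y j) := fun i j =>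
      ((hci i j).mul continuous_const).const_mul _
    have hc2 : ∀ i, Continuous fun t => ∑ j, x i * (conjFlow A D t i j * y j) := fun i =>
      continuous_finsetSum _ fun j _ => hc1 i j
    rw [intervalIntegral.integral_finsetSum fun i _ => (hc2 i).intervalIntegrable _ _]
    refine Finset.sum_congr rfl fun i _ => ?_
    rw [intervalIntegral.integral_finsetSum fun j _ => (hc1 i j).intervalIntegrable _ _]
    refine Finset.sum_congr rfl fun j _ => ?_
    rw [intervalIntegral.integral_const_mul, intervalIntegral.integral_mul_const]
  have hWs : W.IsSymm := by
    ext i j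
    simp only [W, Matrix.transpose_apply, Matrix.of_apply]
    congr 1
    funext t
    exact (hYs t).apply i j
  have hWpos : W.PosDef := by
    refine posDef_of_dotProduct hWs fun x hx => ?_
    rw [hW]
    refine intervalIntegral.intervalIntegral_pos_of_pos ((hcont x x).intervalIntegrable _ _)
      (fun t => ?_) one_pos
    rw [dotProduct_conjFlow]
    refine hD.dotProduct_pos fun h0 => hx ?_
    exact Matrix.mulVec_injective_iff_isUnit.2 (Matrix.isUnit_exp (-(t • Aᵀ))) (by simpa using h0)
  have hLW : A * W + W * Aᵀ = D - conjFlow A D 1 := by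
    have key : ∀ x y : ι → ℝ, x ⬝ᵥ (A * W + W * Aᵀ) *ᵥ y =
        x ⬝ᵥ (D - conjFlow A D 1) *ᵥ y := fun x y => by
      have e1 : ∀ V : Matrix ι ι ℝ, x ⬝ᵥ (A * V + V * Aᵀ) *ᵥ y =
          (Aᵀ *ᵥ x) ⬝ᵥ V *ᵥ y + x ⬝ᵥ V *ᵥ (Aᵀ *ᵥ y) := fun V => by
        rw [Matrix.add_mulVec, dotProduct_add, ← Matrix.mulVec_mulVec,
          Matrix.dotProduct_mulVec x A, ← Matrix.mulVec_transpose, ← Matrix.mulVec_mulVec]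
      rw [e1, hW, hW, ← intervalIntegral.integral_add ((hcont _ _).intervalIntegrable _ _)
        ((hcont _ _).intervalIntegrable _ _)]
      simp only [← e1]
      have h2 := intervalIntegral.integral_eq_sub_of_hasDerivAt (a := 0) (b := 1)
        (fun t _ => hasDerivAt_conjFlow (A := A) (D := D) x y t)
        (Continuous.intervalIntegrable (by simp only [e1]; exact
          ((hcont _ _).add (hcont _ _)).neg) _ _)
      rw [intervalIntegral.integral_neg, conjFlow_zero] at h2
      rw [Matrix.sub_mulVec, dotProduct_sub]
      linarith
    ext i j
    simpa using key (Pi.single i 1) (Pi.single j 1)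
  have hU : IsUnit W.det := (Matrix.isUnit_iff_isUnit_det _).1 hWpos.isUnit
  refine ⟨W⁻¹, hWpos.inv, ?_⟩
  have e : Aᵀ * W⁻¹ + W⁻¹ * A = (W⁻¹)ᴴ * (D - conjFlow A D 1) * W⁻¹ := by
    rw [hWpos.inv.isHermitian.eq, ← hLW, mul_add, add_mul, ← mul_assoc W⁻¹ W,
      Matrix.nonsing_inv_mul _ hU, one_mul, mul_assoc W⁻¹ (A * W), mul_assoc A,
      Matrix.mul_nonsing_inv _ hU, mul_one, add_comm]
  rw [e]
  exact (posDef_sub_conjFlow hDs hL hctrl one_pos).conjTranspose_mul_mul_same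
    (Matrix.mulVec_injective_iff_isUnit.2 hWpos.inv.isUnit)

end Gramian

lemma posDef_fromBlocks_diag {ι κ : Type*} [Fintype ι] [Fintype κ] {A : Matrix ι ι ℝ}
    {B : Matrix κ κ ℝ} (hA : A.PosDef) (hB : B.PosDef) : (Matrix.fromBlocks A 0 0 B).PosDef := by
  refine posDef_of_dotProduct ?_ fun x hx => ?_
  · rw [Matrix.IsSymm, Matrix.fromBlocks_transpose, hA.isSymm.eq, hB.isSymm.eq]
    simp
  have e : x ⬝ᵥ Matrix.fromBlocks A 0 0 B *ᵥ x =
      (x ∘ Sum.inl) ⬝ᵥ A *ᵥ (x ∘ Sum.inl) + (x ∘ Sum.inr) ⬝ᵥ B *ᵥ (x ∘ Sum.inr) := by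
    rw [Matrix.fromBlocks_mulVec]
    simp [dotProduct]
  rw [e]
  have hA0 : 0 ≤ (x ∘ Sum.inl) ⬝ᵥ A *ᵥ (x ∘ Sum.inl) := by
    simpa using hA.posSemidef.dotProduct_mulVec_nonneg (x ∘ Sum.inl)
  have hB0 : 0 ≤ (x ∘ Sum.inr) ⬝ᵥ B *ᵥ (x ∘ Sum.inr) := by
    simpa using hB.posSemidef.dotProduct_mulVec_nonneg (x ∘ Sum.inr)
  by_cases h1 : x ∘ Sum.inl = 0
  · have h2 : x ∘ Sum.inr ≠ 0 := fun h2 => hx <| by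
      rw [← Sum.elim_comp_inl_inr x, h1, h2]
      ext i; cases i <;> rfl
    have := hB.dotProduct_pos h2
    linarith
  · have := hA.dotProduct_pos h1
    linarith

/-- `Γ_M` satisfies a Lyapunov equation with the covariance `diag(M, Q)`. -/
lemma Coeffs.Structural.lyapunov_ΓM {c : Coeffs n m} {Q : Matrix (Fin m) (Fin m) ℝ}
    (hc : c.Structural Q) :
    c.ΓM * Matrix.fromBlocks c.M 0 0 Q + Matrix.fromBlocks c.M 0 0 Q * c.ΓMᵀ =
      c.Sig * c.Sigᵀ := by
  have hU : IsUnit c.M.det := (Matrix.isUnit_iff_isUnit_det _).1 hc.M_posDef.isUnit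
  have h1 : c.ΓM * Matrix.fromBlocks c.M 0 0 Q = c.Γ * Matrix.fromBlocks 1 0 0 Q := by
    rw [Coeffs.ΓM, mul_assoc, Matrix.fromBlocks_multiply]
    simp [Matrix.nonsing_inv_mul _ hU]
  have h2 : Matrix.fromBlocks c.M 0 0 Q * c.ΓMᵀ = (c.ΓM * Matrix.fromBlocks c.M 0 0 Q)ᵀ := by
    rw [Matrix.transpose_mul, Matrix.fromBlocks_transpose, hc.M_posDef.isSymm.eq,
      hc.Q_posDef.isSymm.eq]
    simp
  have h3 : (c.Γ * Matrix.fromBlocks 1 0 0 Q)ᵀ = Matrix.fromBlocks 1 0 0 Q * c.Γᵀ := by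
    rw [Matrix.transpose_mul, Matrix.fromBlocks_transpose, hc.Q_posDef.isSymm.eq]
    simp
  rw [h2, h1, h3, hc.fluctuation_dissipation]

/-- The drift matrix `G` satisfies a Lyapunov equation with the covariance `diag(Ω⁻¹, M, Q)` of
the Gaussian invariant measure. -/
lemma Coeffs.Structural.lyapunov_G {c : Coeffs n m} {Q : Matrix (Fin m) (Fin m) ℝ}
    (hc : c.Structural Q) {Ω : Matrix (Fin n) (Fin n) ℝ} (hΩ : Ω.PosDef) :
    c.G Ω * Matrix.fromBlocks Ω⁻¹ 0 0 (Matrix.fromBlocks c.M 0 0 Q) +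
      Matrix.fromBlocks Ω⁻¹ 0 0 (Matrix.fromBlocks c.M 0 0 Q) * (c.G Ω)ᵀ =
      c.noiseMatrix * c.noiseMatrixᵀ := by
  have hU : IsUnit c.M.det := (Matrix.isUnit_iff_isUnit_det _).1 hc.M_posDef.isUnit
  have hV : IsUnit Ω.det := (Matrix.isUnit_iff_isUnit_det _).1 hΩ.isUnit
  set D := Matrix.fromBlocks Ω⁻¹ 0 0 (Matrix.fromBlocks c.M 0 0 Q) with hDdef
  have hDs : Dᵀ = D := (posDef_fromBlocks_diag hΩ.inv
    (posDef_fromBlocks_diag hc.M_posDef hc.Q_posDef)).isSymm.eq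
  have h1 : c.G Ω * D = Matrix.fromBlocks 0 (Matrix.fromCols (-1) 0) (Matrix.fromRows 1 0)
      (c.ΓM * Matrix.fromBlocks c.M 0 0 Q) := by
    rw [Coeffs.G, hDdef, Matrix.fromBlocks_multiply]
    congr 1
    · simp
    · rw [Matrix.fromCols_mul_fromBlocks]
      simp [Matrix.nonsing_inv_mul _ hU]
    · rw [Matrix.fromRows_mul]
      simp [Matrix.mul_nonsing_inv _ hV]
    · simp
  have h2 : D * (c.G Ω)ᵀ = (c.G Ω * D)ᵀ := by rw [Matrix.transpose_mul, hDs]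
  have h3 : c.ΓM * Matrix.fromBlocks c.M 0 0 Q + (c.ΓM * Matrix.fromBlocks c.M 0 0 Q)ᵀ =
      c.Sig * c.Sigᵀ := by
    rw [← hc.lyapunov_ΓM, Matrix.transpose_mul,
      (posDef_fromBlocks_diag hc.M_posDef hc.Q_posDef).isSymm.eq]
  have h4 : c.noiseMatrix * c.noiseMatrixᵀ = Matrix.fromBlocks 0 0 0 (c.Sig * c.Sigᵀ) := by
    rw [Coeffs.noiseMatrix, Matrix.transpose_fromRows]
    ext (i | i) (j | j) <;> simp [Matrix.mul_apply]
  rw [h2, h1, h4, ← h3, Matrix.fromBlocks_transpose, Matrix.fromBlocks_add]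
  congr 1
  · simp
  · ext i (j | j) <;> simp [Matrix.one_apply, eq_comm]
  · ext (i | i) j <;> simp [Matrix.one_apply, eq_comm]

lemma Coeffs.exists_isWeightMatrix {c : Coeffs n m} {Q : Matrix (Fin m) (Fin m) ℝ}
    (hc : c.Structural Q) {Ω : Matrix (Fin n) (Fin n) ℝ} (hΩ : Ω.PosDef)
    (hP : IsHypoelliptic (c.kolmogorovOp (quadPotential Ω))) :
    ∃ C : Matrix (XIdx n m) (XIdx n m) ℝ, c.IsWeightMatrix Ω C :=
  exists_posDef_lyapunov (posDef_fromBlocks_diag hΩ.inv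
    (posDef_fromBlocks_diag hc.M_posDef hc.Q_posDef)) (hc.lyapunov_G hΩ)
    (c.controllable_of_hypoelliptic hΩ.isSymm hP)

/-- The span condition is the Kalman condition for the pair `(Γ_M, Σ)`. -/
lemma Coeffs.Hypo.controllable_ΓM {c : Coeffs n m} {Ω : Matrix (Fin n) (Fin n) ℝ}
    (hh : c.Hypo Ω) (v : ZIdx n m → ℝ) (hv : ∀ k : ℕ, c.Sigᵀ *ᵥ ((c.ΓMᵀ ^ k) *ᵥ v) = 0) :
    v = 0 := by
  have h : ∀ w ∈ (⊤ : Submodule ℝ (ZIdx n m → ℝ)), v ⬝ᵥ w = 0 := by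
    rw [← hh.span_eq_top]
    intro w hw
    induction hw using Submodule.span_induction with
    | mem w hw =>
      obtain ⟨k, -, i, rfl⟩ := hw
      have := congrFun (hv k) i
      rw [← Matrix.transpose_pow] at this
      rw [Matrix.dotProduct_mulVec, ← Matrix.mulVec_transpose]
      simpa [Matrix.mulVec, dotProduct, mul_comm] using this
    | zero => simp
    | add x y _ _ hx hy => rw [dotProduct_add, hx, hy, add_zero]
    | smul a x _ hx => rw [dotProduct_smul, hx, smul_zero]
  exact dotProduct_self_eq_zero.1 (h v trivial)

/-- The noise of the O-step is nondegenerate: its covariance is the Gramian of `(Γ_M, Σ)` over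
`[0, h]`, up to the factor `β⁻¹`. -/
lemma Coeffs.IsNoiseFactor.isUnit_det {c : Coeffs n m} {Q : Matrix (Fin m) (Fin m) ℝ}
    (hc : c.Structural Q) {Ω : Matrix (Fin n) (Fin n) ℝ} (hh : c.Hypo Ω)
    {S : ℝ → Matrix (ZIdx n m) (ZIdx n m) ℝ} (hS : c.IsNoiseFactor Q S) {h : ℝ} (hpos : 0 < h) :
    IsUnit (S h).det := by
  have h1 := (posDef_sub_conjFlow (posDef_fromBlocks_diag hc.M_posDef hc.Q_posDef).isSymm
    hc.lyapunov_ΓM hh.controllable_ΓM hpos).smul (inv_pos.2 hc.β_pos)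
  have h2 : S h * (S h)ᵀ = _ := hS h hpos
  have h3 : IsUnit (S h * (S h)ᵀ) := by
    rw [h2]; exact h1.isUnit
  have h4 := (Matrix.isUnit_iff_isUnit_det _).1 h3
  rw [Matrix.det_mul] at h4
  exact isUnit_of_mul_isUnit_left h4

/-! ### Setwise limits of measures -/

section SetwiseLimits

open Filter Topology

variable {α : Type*} [MeasurableSpace α]

/-- Fatou's lemma for setwise convergence of measures. -/
lemma lintegral_le_of_tendsto_setwise {μ : ℕ → Measure α} {π : Measure α}
    (hμ : ∀ E, MeasurableSet E → Tendsto (fun k => μ k E) atTop (𝓝 (π E)))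
    {f : α → ENNReal} {b : ℕ → ENNReal} {B : ENNReal} (hb : Tendsto b atTop (𝓝 B))
    (hf : ∀ k, ∫⁻ x, f x ∂(μ k) ≤ b k) : ∫⁻ x, f x ∂π ≤ B := by
  rw [lintegral_eq_nnreal]
  refine iSup₂_le fun g hg => ?_
  have h1 : Tendsto (fun k => (g.map ((↑) : NNReal → ENNReal)).lintegral (μ k)) atTop
      (𝓝 ((g.map ((↑) : NNReal → ENNReal)).lintegral π)) := by
    simp only [SimpleFunc.map_lintegral]
    refine tendsto_finsetSum _ fun r _ => ENNReal.Tendsto.const_mul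
      (hμ _ (g.measurableSet_fiber r)) (Or.inr ENNReal.coe_ne_top)
  refine le_of_tendsto_of_tendsto' h1 hb fun k => le_trans ?_ (hf k)
  rw [← SimpleFunc.lintegral_eq_lintegral]
  exact lintegral_mono fun x => hg x

/-- A uniform limit of probability measures is a probability measure. -/
lemma exists_measure_of_uniform_limit {μ : ℕ → Measure α} [∀ k, IsProbabilityMeasure (μ k)]
    {ℓ : Set α → ℝ} {ε : ℕ → ℝ} (hε : Tendsto ε atTop (𝓝 0))
    (hℓ : ∀ E, MeasurableSet E → ∀ k, |(μ k).real E - ℓ E| ≤ ε k) :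
    ∃ π : Measure α, IsProbabilityMeasure π ∧
      ∀ E, MeasurableSet E → Tendsto (fun k => μ k E) atTop (𝓝 (π E)) := by
  have hlim : ∀ E, MeasurableSet E → Tendsto (fun k => (μ k).real E) atTop (𝓝 (ℓ E)) :=
    fun E hE => by
      rw [tendsto_iff_dist_tendsto_zero]
      exact squeeze_zero (fun _ => dist_nonneg) (fun k => hℓ E hE k) hε
  have hnn : ∀ E, MeasurableSet E → 0 ≤ ℓ E := fun E hE =>
    ge_of_tendsto' (hlim E hE) fun k => measureReal_nonneg
  have h0 : ℓ ∅ = 0 := tendsto_nhds_unique (hlim ∅ .empty) (by simp)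
  have hsum : ∀ ⦃f : ℕ → Set α⦄, (∀ i, MeasurableSet (f i)) → Pairwise (Function.onFun Disjoint f) →
      HasSum (fun i => ℓ (f i)) (ℓ (⋃ i, f i)) := fun f hf hd => by
    rw [hasSum_iff_tendsto_nat_of_nonneg fun i => hnn _ (hf i)]
    have hfin : ∀ N, MeasurableSet (⋃ i ∈ Finset.range N, f i) := fun N =>
      Finset.measurableSet_biUnion _ fun i _ => hf i
    have hpart : ∀ N k, ∑ i ∈ Finset.range N, (μ k).real (f i) =
        (μ k).real (⋃ i ∈ Finset.range N, f i) := fun N k =>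
      (measureReal_biUnion_finset (fun i _ j _ hij => hd hij) fun i _ => hf i).symm
    have hpart' : ∀ N, ∑ i ∈ Finset.range N, ℓ (f i) = ℓ (⋃ i ∈ Finset.range N, f i) := fun N => by
      refine tendsto_nhds_unique (tendsto_finsetSum _ fun i _ => hlim _ (hf i)) ?_
      simp only [hpart]
      exact hlim _ (hfin N)
    have hk : ∀ k, Tendsto (fun N => ∑ i ∈ Finset.range N, (μ k).real (f i)) atTop
        (𝓝 ((μ k).real (⋃ i, f i))) := fun k => by
      have h1 : HasSum (fun i => (μ k).real (f i)) ((μ k).real (⋃ i, f i)) := by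
        have h2 := (ENNReal.hasSum_toReal (f := fun i => μ k (f i))
          (by rw [← measure_iUnion hd hf]; exact measure_ne_top _ _))
        rwa [← ENNReal.tsum_toReal_eq (fun i => measure_ne_top _ _),
          ← measure_iUnion hd hf] at h2
      exact h1.tendsto_sum_nat
    -- the error in `k` is uniform over sets, so that the partial sums and the union may be compared
    -- for one fixed `k`
    rw [Metric.tendsto_atTop]
    intro δ hδ
    obtain ⟨k, hk1⟩ := ((hε.eventually (gt_mem_nhds (show (0 : ℝ) < δ / 3 by positivity)))).exists
    obtain ⟨N, hN⟩ := Metric.tendsto_atTop.1 (hk k) (δ / 3) (by positivity)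
    refine ⟨N, fun M hM => ?_⟩
    have h1 := hN M hM
    have h2 := hℓ _ (hfin M) k
    have h3 := hℓ _ (MeasurableSet.iUnion hf) k
    rw [Real.dist_eq, abs_lt] at h1 ⊢
    rw [hpart] at h1
    rw [hpart']
    rw [abs_le] at h2 h3
    constructor <;> linarith [h1.1, h1.2, h2.1, h2.2, h3.1, h3.2]
  let π : Measure α := Measure.ofMeasurable (fun E _ => ENNReal.ofReal (ℓ E)) (by simp [h0])
    (fun f hf hd => by
      rw [← (hsum hf hd).tsum_eq, ENNReal.ofReal_tsum_of_nonneg (fun i => hnn _ (hf i))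
        (hsum hf hd).summable])
  have hπ : ∀ E, MeasurableSet E → π E = ENNReal.ofReal (ℓ E) := fun E hE =>
    Measure.ofMeasurable_apply E hE
  have htend : ∀ E, MeasurableSet E → Tendsto (fun k => μ k E) atTop (𝓝 (π E)) := fun E hE => by
    rw [hπ E hE]
    have := (ENNReal.continuous_ofReal.tendsto _).comp (hlim E hE)
    simpa [Function.comp_def] using this
  refine ⟨π, ⟨?_⟩, htend⟩
  exact tendsto_nhds_unique (htend _ .univ) (by simp)

end SetwiseLimits

/-! ### Harris' theorem -/

section Harris

open Filter Topology

variable {α : Type*} [MeasurableSpace α]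

/-- `φ` oscillates at most by `t` with respect to the weight `W`. -/
def OscLE (W φ : α → ℝ) (t : ℝ) : Prop := ∀ u v, |φ u - φ v| ≤ t * (W u + W v)

omit [MeasurableSpace α] in
/-- Bounded oscillation means a small distance to a constant in the weighted supremum norm. -/
lemma OscLE.exists_abs_sub_le [Nonempty α] {W φ : α → ℝ} {t : ℝ} (h : OscLE W φ t) :
    ∃ c : ℝ, ∀ u, |φ u - c| ≤ t * W u := by
  have hle : ∀ u v, φ u - t * W u ≤ φ v + t * W v := fun u v => by
    have := (abs_le.1 (h u v)).2
    linarith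
  have hbdd : BddAbove (Set.range fun u => φ u - t * W u) := by
    obtain ⟨v⟩ := ‹Nonempty α›
    exact ⟨_, by rintro _ ⟨u, rfl⟩; exact hle u v⟩
  refine ⟨⨆ u, (φ u - t * W u), fun u => abs_le.2 ⟨?_, ?_⟩⟩
  · have := ciSup_le fun v => hle v u
    linarith
  · have := le_ciSup hbdd u
    linarith

/-- The action of a kernel on functions. -/
def kernelOp (κ : Kernel α α) (φ : α → ℝ) (x : α) : ℝ := ∫ y, φ y ∂(κ x)

lemma integrable_of_abs_sub_le {μ : Measure α} [IsFiniteMeasure μ] {W φ : α → ℝ} {t c : ℝ}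
    (hφ : Measurable φ) (hW : Integrable W μ) (h : ∀ u, |φ u - c| ≤ t * W u) :
    Integrable φ μ := by
  refine ((hW.const_mul t).add (integrable_const |c|)).mono' hφ.aestronglyMeasurable
    (ae_of_all _ fun u => ?_)
  have := abs_sub_abs_le_abs_sub (φ u) c
  have := h u
  simp only [Pi.add_apply, Real.norm_eq_abs]
  linarith

lemma OscLE.integrable [Nonempty α] {μ : Measure α} [IsFiniteMeasure μ] {W φ : α → ℝ} {t : ℝ}
    (h : OscLE W φ t) (hφ : Measurable φ) (hW : Integrable W μ) : Integrable φ μ :=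
  let ⟨_, hc⟩ := h.exists_abs_sub_le
  integrable_of_abs_sub_le hφ hW hc

lemma measurable_kernelOp (κ : Kernel α α) [IsMarkovKernel κ] {φ : α → ℝ} (hφ : Measurable φ) :
    Measurable (kernelOp κ φ) :=
  (hφ.stronglyMeasurable.integral_kernel).measurable

lemma OscLE.abs_kernelOp_sub_le [Nonempty α] {κ : Kernel α α} [IsMarkovKernel κ] {W φ : α → ℝ}
    {t : ℝ} (h : OscLE W φ t) (hφ : Measurable φ) (hW : ∀ x, Integrable W (κ x)) (x y : α) :
    |kernelOp κ φ x - kernelOp κ φ y| ≤ t * (kernelOp κ W x + kernelOp κ W y) := by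
  obtain ⟨c, hc⟩ := h.exists_abs_sub_le
  have h1 : ∀ x, |kernelOp κ φ x - c| ≤ t * kernelOp κ W x := fun x => by
    have e : kernelOp κ φ x - c = ∫ y, (φ y - c) ∂(κ x) := by
      rw [integral_sub (h.integrable hφ (hW x)) (integrable_const c)]
      simp [kernelOp]
    rw [e, kernelOp, ← integral_const_mul]
    exact norm_integral_le_of_norm_le ((hW x).const_mul t)
      (ae_of_all _ fun u => (Real.norm_eq_abs _).trans_le (hc u))
  have := h1 x
  have := h1 y
  calc _ = |(kernelOp κ φ x - c) - (kernelOp κ φ y - c)| := by ring_nf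
    _ ≤ _ := abs_sub _ _
    _ ≤ _ := by linarith

/-- On a set of states where the transition probabilities have the common part `ν`, the mass of
`ν` is gained in the comparison of two transition probabilities. -/
lemma OscLE.abs_kernelOp_sub_le_of_minorization [Nonempty α] {κ : Kernel α α} [IsMarkovKernel κ]
    {W φ : α → ℝ} {t : ℝ} (h : OscLE W φ t) (ht : 0 ≤ t) (hW1 : ∀ x, 1 ≤ W x)
    (hφ : Measurable φ) (hW : ∀ x, Integrable W (κ x)) {ν : Measure α} {x y : α}
    (hx : ν ≤ κ x) (hy : ν ≤ κ y) :
    |kernelOp κ φ x - kernelOp κ φ y| ≤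
      t * (kernelOp κ W x + kernelOp κ W y - 2 * ν.real Set.univ) := by
  obtain ⟨c, hc⟩ := h.exists_abs_sub_le
  have : IsFiniteMeasure ν := isFiniteMeasure_of_le _ hx
  have hWν : Integrable W ν := (hW x).mono_measure hx
  have hφν : Integrable φ ν := h.integrable hφ hWν
  have hν1 : ν.real Set.univ ≤ ∫ u, W u ∂ν := by
    have := integral_mono (integrable_const (1 : ℝ)) hWν hW1
    simpa using this
  have h1 : ∀ x, ν ≤ κ x → |(kernelOp κ φ x - c) - ∫ u, (φ u - c) ∂ν| ≤
      t * (kernelOp κ W x - ∫ u, W u ∂ν) := fun x hx => by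
    have hφx := h.integrable hφ (hW x)
    have e : kernelOp κ φ x - c = ∫ y, (φ y - c) ∂(κ x) := by
      rw [integral_sub hφx (integrable_const c)]
      simp [kernelOp]
    have hcx : Integrable (fun y => φ y - c) (κ x) := hφx.sub (integrable_const c)
    have hcν : Integrable (fun y => φ y - c) ν := hφν.sub (integrable_const c)
    have i1 := integral_mono_measure hx (f := fun u => t * W u - (φ u - c))
      (ae_of_all _ fun u => sub_nonneg.2 (abs_le.1 (hc u)).2) (((hW x).const_mul t).sub hcx)
    have i2 := integral_mono_measure hx (f := fun u => t * W u + (φ u - c))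
      (ae_of_all _ fun u => by
        have := (abs_le.1 (hc u)).1
        simp only [Pi.zero_apply]
        linarith) (((hW x).const_mul t).add hcx)
    rw [integral_sub (hWν.const_mul t) hcν, integral_sub ((hW x).const_mul t) hcx,
      integral_const_mul, integral_const_mul] at i1
    rw [integral_add (hWν.const_mul t) hcν, integral_add ((hW x).const_mul t) hcx,
      integral_const_mul, integral_const_mul] at i2
    rw [e, kernelOp, abs_le]
    constructor <;> linarith
  have h2 := h1 x hx
  have h3 := h1 y hy
  have h4 := mul_le_mul_of_nonneg_left hν1 ht
  calc _ = |((kernelOp κ φ x - c) - ∫ u, (φ u - c) ∂ν) -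
        ((kernelOp κ φ y - c) - ∫ u, (φ u - c) ∂ν)| := by ring_nf
    _ ≤ _ := abs_sub _ _
    _ ≤ _ := by linarith

/-- The contraction estimate of Hairer and Mattingly. The drift condition contracts the
oscillation between two points one of which has large `V`, the minorization between two points
with small `V`. -/
lemma exists_osc_contraction [Nonempty α] {κ : Kernel α α} [IsMarkovKernel κ] {V : α → ℝ}
    (hV0 : ∀ x, 0 ≤ V x) {γ b R β : ℝ} (hγ0 : 0 ≤ γ) (hγ1 : γ < 1) (hβ : 0 < β)
    (hVi : ∀ x, Integrable V (κ x)) (hdrift : ∀ x, kernelOp κ V x ≤ γ * V x + b)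
    (hR : 4 * b ≤ (1 - γ) * R) (hR0 : 0 < R) {ν : Measure α} (hν0 : 0 < ν.real Set.univ)
    (hβν : 2 * β * b ≤ ν.real Set.univ) (hν : ∀ x, V x ≤ R → ν ≤ κ x) :
    ∃ ρ : ℝ, 0 < ρ ∧ ρ < 1 ∧ ∀ φ : α → ℝ, Measurable φ → ∀ t, 0 ≤ t →
      OscLE (fun x => 1 + β * V x) φ t →
      OscLE (fun x => 1 + β * V x) (kernelOp κ φ) (ρ * t) := by
  set a := ν.real Set.univ
  set W : α → ℝ := fun x => 1 + β * V x with hWdef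
  have hWi : ∀ x, Integrable W (κ x) := fun x => (integrable_const 1).add ((hVi x).const_mul β)
  have hWop : ∀ x, kernelOp κ W x ≤ 1 + β * (γ * V x + b) := fun x => by
    have : kernelOp κ W x = 1 + β * kernelOp κ V x := by
      simp only [kernelOp, hWdef]
      rw [integral_add (integrable_const 1) ((hVi x).const_mul β), integral_const_mul]
      simp
    rw [this]
    have := mul_le_mul_of_nonneg_left (hdrift x) hβ.le
    linarith
  -- `γ₀` is between `γ` and `1`; `ρ₁` is the rate at points with `V x + V y = R`
  set γ₀ := (1 + γ) / 2 with hγ₀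
  set ρ₁ := (2 + β * γ₀ * R) / (2 + β * R)
  have hden : 0 < 2 + β * R := by positivity
  have hγ₀1 : γ₀ < 1 := by rw [hγ₀]; linarith
  have hγ₀0 : 0 < γ₀ := by rw [hγ₀]; linarith
  have hρ₁ : ρ₁ < 1 := by
    rw [div_lt_one hden]
    have : 0 < β * R := by positivity
    nlinarith
  refine ⟨max ρ₁ (max (1 - a / 2) γ₀), lt_max_of_lt_right (lt_max_of_lt_right hγ₀0),
    max_lt hρ₁ (max_lt (by linarith) hγ₀1), fun φ hφ t ht hosc x y => ?_⟩
  set ρ := max ρ₁ (max (1 - a / 2) γ₀)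
  have hρ1 : ρ₁ ≤ ρ := le_max_left _ _
  have hρ2 : 1 - a / 2 ≤ ρ := (le_max_left _ _).trans (le_max_right _ _)
  have hρ3 : γ₀ ≤ ρ := (le_max_right _ _).trans (le_max_right _ _)
  have hS0 : 0 ≤ V x + V y := add_nonneg (hV0 x) (hV0 y)
  suffices hs : ∃ s, |kernelOp κ φ x - kernelOp κ φ y| ≤ t * s ∧ s ≤ ρ * (W x + W y) by
    obtain ⟨s, h1, h2⟩ := hs
    exact h1.trans ((mul_le_mul_of_nonneg_left h2 ht).trans_eq (by ring))
  have hWW : W x + W y = 2 + β * (V x + V y) := by simp only [hWdef]; ring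
  rw [hWW]
  rcases le_total R (V x + V y) with hS | hS
  · refine ⟨_, hosc.abs_kernelOp_sub_le hφ hWi x y, ?_⟩
    have h1 : kernelOp κ W x + kernelOp κ W y ≤ 2 + β * γ₀ * (V x + V y) := by
      have e : 2 * b ≤ (1 - γ) / 2 * (V x + V y) := by nlinarith
      have := hWop x
      have := hWop y
      have := mul_le_mul_of_nonneg_left e hβ.le
      rw [hγ₀]
      linarith
    refine h1.trans (le_trans ?_ (mul_le_mul_of_nonneg_right hρ1 (by positivity)))
    -- `(2 + β γ₀ S) / (2 + β S)` decreases in `S`, so that its value at `S ≥ R` is at most `ρ₁`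
    rw [div_mul_eq_mul_div, le_div_iff₀ hden]
    have : 0 ≤ β * (1 - γ₀) * (V x + V y - R) := by
      have := sub_nonneg.2 hS
      have := sub_nonneg.2 hγ₀1.le
      positivity
    nlinarith
  · refine ⟨_, hosc.abs_kernelOp_sub_le_of_minorization ht
      (fun x => le_add_of_nonneg_right (mul_nonneg hβ.le (hV0 x))) hφ hWi
      (hν x (by linarith [hV0 y])) (hν y (by linarith [hV0 x])), ?_⟩
    have := hWop x
    have := hWop y
    have h2 : β * γ * (V x + V y) ≤ ρ * (β * (V x + V y)) := by
      have : γ ≤ ρ := le_trans (by rw [hγ₀]; linarith) hρ3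
      have := mul_le_mul_of_nonneg_right this (mul_nonneg hβ.le hS0)
      linarith
    linarith

end Harris

section HarrisTheorem

open Filter Topology

variable {α : Type*} [MeasurableSpace α]

instance (κ : Kernel α α) [IsMarkovKernel κ] (k : ℕ) : IsMarkovKernel (iterKernel κ k) := by
  induction k with
  | zero => rw [iterKernel]; infer_instance
  | succ k ih => rw [iterKernel]; infer_instance

/-- A drift condition bounds `V` in mean along the chain, uniformly in time. -/
lemma lintegral_iterKernel_le {κ : Kernel α α} [IsMarkovKernel κ] {V : α → ℝ} (hVm : Measurable V)
    (hV0 : ∀ x, 0 ≤ V x) {γ b : ℝ} (hγ0 : 0 ≤ γ) (hγ1 : γ < 1) (hb : 0 ≤ b)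
    (hdrift : ∀ x, ∫⁻ y, ENNReal.ofReal (V y) ∂(κ x) ≤ ENNReal.ofReal (γ * V x + b))
    (k : ℕ) (x : α) :
    ∫⁻ y, ENNReal.ofReal (V y) ∂(iterKernel κ k x) ≤ ENNReal.ofReal (V x + b / (1 - γ)) := by
  have hB : 0 ≤ b / (1 - γ) := div_nonneg hb (by linarith)
  have hm : Measurable fun y => ENNReal.ofReal (V y) := hVm.ennreal_ofReal
  induction k with
  | zero =>
    rw [iterKernel, Kernel.id_apply, lintegral_dirac' _ hm]
    exact ENNReal.ofReal_le_ofReal (by linarith)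
  | succ k ih =>
    rw [iterKernel, Kernel.lintegral_comp _ _ _ hm]
    calc ∫⁻ z, ∫⁻ y, ENNReal.ofReal (V y) ∂(κ z) ∂(iterKernel κ k x)
        ≤ ∫⁻ z, (ENNReal.ofReal γ * ENNReal.ofReal (V z) + ENNReal.ofReal b)
            ∂(iterKernel κ k x) := lintegral_mono fun z => by
          rw [← ENNReal.ofReal_mul hγ0, ← ENNReal.ofReal_add (mul_nonneg hγ0 (hV0 z)) hb]
          exact hdrift z
      _ = ENNReal.ofReal γ * ∫⁻ z, ENNReal.ofReal (V z) ∂(iterKernel κ k x) +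
            ENNReal.ofReal b := by
          rw [lintegral_add_right _ measurable_const, lintegral_const_mul _ hm]
          simp
      _ ≤ ENNReal.ofReal γ * ENNReal.ofReal (V x + b / (1 - γ)) + ENNReal.ofReal b := by gcongr
      _ = ENNReal.ofReal (γ * (V x + b / (1 - γ)) + b) := by
          rw [← ENNReal.ofReal_mul hγ0,
            ← ENNReal.ofReal_add (mul_nonneg hγ0 (add_nonneg (hV0 x) hB)) hb]
      _ ≤ ENNReal.ofReal (V x + b / (1 - γ)) := by
          refine ENNReal.ofReal_le_ofReal ?_
          have h1 : γ * (b / (1 - γ)) + b = b / (1 - γ) := by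
            field_simp [show (1 - γ) ≠ 0 by linarith]
            ring
          have h2 : γ * V x ≤ V x := by nlinarith [hV0 x]
          linarith

lemma integrable_of_lintegral_ofReal_le {μ : Measure α} {V : α → ℝ} (hVm : Measurable V)
    (hV0 : ∀ x, 0 ≤ V x) {B : ℝ}
    (h : ∫⁻ y, ENNReal.ofReal (V y) ∂μ ≤ ENNReal.ofReal B) : Integrable V μ :=
  ⟨hVm.aestronglyMeasurable, by
    rw [hasFiniteIntegral_iff_ofReal (ae_of_all _ hV0)]
    exact h.trans_lt ENNReal.ofReal_lt_top⟩

lemma integral_le_of_lintegral_ofReal_le {μ : Measure α} {V : α → ℝ} (hVm : Measurable V)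
    (hV0 : ∀ x, 0 ≤ V x) {B : ℝ} (hB : 0 ≤ B)
    (h : ∫⁻ y, ENNReal.ofReal (V y) ∂μ ≤ ENNReal.ofReal B) : ∫ y, V y ∂μ ≤ B := by
  rw [integral_eq_lintegral_of_nonneg_ae (ae_of_all _ hV0) hVm.aestronglyMeasurable]
  exact ENNReal.toReal_le_of_le_ofReal hB h

lemma kernelOp_comp {κ η : Kernel α α} {φ : α → ℝ} {x : α}
    (h : Integrable φ ((η ∘ₖ κ) x)) : kernelOp (η ∘ₖ κ) φ x = kernelOp κ (kernelOp η φ) x :=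
  Kernel.integral_comp h

/-- The iterates of a Markov kernel act on functions as the powers of its action. -/
lemma evolve_succ {κ : Kernel α α} [IsMarkovKernel κ] {φ : α → ℝ} {k : ℕ} {x : α}
    (h : Integrable φ (iterKernel κ (k + 1) x)) :
    evolve κ (k + 1) φ x = evolve κ k (kernelOp κ φ) x :=
  Kernel.integral_comp h

lemma integral_kernelOp_of_invariant {κ : Kernel α α} {π : Measure α} (hπ : Kernel.Invariant κ π)
    {φ : α → ℝ} (hφ : Integrable φ π) : ∫ x, kernelOp κ φ x ∂π = ∫ x, φ x ∂π := by
  have h1 : (κ ∘ₖ Kernel.const Unit π) () = π := by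
    rw [← Measure.comp_eq_comp_const_apply]
    exact hπ.def
  have h2 := Kernel.integral_comp (η := κ) (κ := Kernel.const Unit π) (a := ()) (f := φ)
    (by rwa [h1])
  rw [h1, Kernel.const_apply] at h2
  exact h2.symm

lemma iterKernel_succ' (κ : Kernel α α) (k : ℕ) :
    iterKernel κ (k + 1) = iterKernel κ k ∘ₖ κ := by
  induction k with
  | zero => simp [iterKernel]
  | succ k ih =>
    calc iterKernel κ (k + 2) = κ ∘ₖ (iterKernel κ k ∘ₖ κ) := by rw [← ih]; rfl
      _ = _ := (Kernel.comp_assoc _ _ _).symm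

lemma invariant_iterKernel {κ : Kernel α α} {π : Measure α} (h : Kernel.Invariant κ π) (k : ℕ) :
    Kernel.Invariant (iterKernel κ k) π := by
  induction k with
  | zero => exact Measure.id_comp
  | succ k ih => exact h.comp ih

lemma evolve_succ' {κ : Kernel α α} [IsMarkovKernel κ] {φ : α → ℝ} {k : ℕ} {x : α}
    (h : Integrable φ (iterKernel κ (k + 1) x)) :
    evolve κ (k + 1) φ x = ∫ y, evolve κ k φ y ∂(κ x) := by
  rw [iterKernel_succ'] at h
  rw [evolve, iterKernel_succ']
  exact Kernel.integral_comp h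

/-- **Harris' theorem**: a drift condition and a minorization condition for the two-step kernel
give geometric ergodicity in the weighted supremum norm. The invariant measure is the setwise limit
of the laws of the chain. -/
theorem harris [Nonempty α] {κ : Kernel α α} [IsMarkovKernel κ] {V : α → ℝ} (hVm : Measurable V)
    (hV0 : ∀ x, 0 ≤ V x) {γ b : ℝ} (hγ0 : 0 ≤ γ) (hγ1 : γ < 1) (hb : 0 ≤ b)
    (hdrift : ∀ x, ∫⁻ y, ENNReal.ofReal (V y) ∂(κ x) ≤ ENNReal.ofReal (γ * V x + b))
    (hminor : ∀ R : ℝ, ∃ ν : Measure α, IsFiniteMeasure ν ∧ ν ≠ 0 ∧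
      ∀ x, V x ≤ R → ν ≤ (κ ∘ₖ κ) x) :
    ∃ π : Measure α, IsProbabilityMeasure π ∧ Kernel.Invariant κ π ∧
      (∀ π' : Measure α, IsProbabilityMeasure π' → Kernel.Invariant κ π' → π' = π) ∧
      (∀ x E, MeasurableSet E → Tendsto (fun k => iterKernel κ k x E) atTop (𝓝 (π E))) ∧
      GeometricallyErgodic κ π (fun x => V x + 1) := by
  have hrhs : ∀ x, 0 ≤ γ * V x + b := fun x => add_nonneg (mul_nonneg hγ0 (hV0 x)) hb
  have hVi : ∀ x, Integrable V (κ x) := fun x =>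
    integrable_of_lintegral_ofReal_le hVm hV0 (hdrift x)
  have hVd : ∀ x, kernelOp κ V x ≤ γ * V x + b := fun x =>
    integral_le_of_lintegral_ofReal_le hVm hV0 (hrhs x) (hdrift x)
  have hVk : ∀ k x, Integrable V (iterKernel κ k x) := fun k x =>
    integrable_of_lintegral_ofReal_le hVm hV0
      (lintegral_iterKernel_le hVm hV0 hγ0 hγ1 hb hdrift k x)
  -- drift condition for the two-step kernel
  have hγ2 : γ ^ 2 < 1 := by nlinarith
  have hV2i : ∀ x, Integrable V ((κ ∘ₖ κ) x) := fun x => by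
    have := hVk 2 x
    rwa [iterKernel, iterKernel, iterKernel, Kernel.comp_id] at this
  have hV2d : ∀ x, kernelOp (κ ∘ₖ κ) V x ≤ γ ^ 2 * V x + (γ * b + b) := fun x => by
    rw [kernelOp_comp (hV2i x)]
    have h1 : kernelOp κ (kernelOp κ V) x ≤ ∫ y, (γ * V y + b) ∂(κ x) :=
      integral_mono ((hV2i x).integral_comp) (((hVi x).const_mul γ).add (integrable_const b)) hVd
    have h2 : ∫ y, (γ * V y + b) ∂(κ x) = γ * kernelOp κ V x + b := by
      rw [integral_add ((hVi x).const_mul γ) (integrable_const b), integral_const_mul]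
      simp [kernelOp]
    have := mul_le_mul_of_nonneg_left (hVd x) hγ0
    rw [h2] at h1
    nlinarith
  set b₂ := γ * b + b with hb₂
  have hb₂0 : 0 ≤ b₂ := by positivity
  set R := 4 * b₂ / (1 - γ ^ 2) + 1 with hRdef
  have hR0 : 0 < R := by
    have : 0 ≤ 4 * b₂ / (1 - γ ^ 2) := div_nonneg (by positivity) (by linarith)
    linarith
  have hR : 4 * b₂ ≤ (1 - γ ^ 2) * R := by
    have : (1 - γ ^ 2) * R = 4 * b₂ + (1 - γ ^ 2) := by
      rw [hRdef]
      field_simp [show (1 - γ ^ 2) ≠ 0 by linarith]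
    linarith
  obtain ⟨ν, hνf, hν0, hν⟩ := hminor R
  have ha0 : 0 < ν.real Set.univ := by
    rw [measureReal_def]
    exact ENNReal.toReal_pos (by simpa using hν0) (measure_ne_top _ _)
  set a := ν.real Set.univ
  set β := min 1 (a / (2 * b₂ + 1)) with hβdef
  have hβ0 : 0 < β := lt_min one_pos (by positivity)
  have hβ1 : β ≤ 1 := min_le_left _ _
  have hβa : 2 * β * b₂ ≤ a := by
    have h1 : β ≤ a / (2 * b₂ + 1) := min_le_right _ _
    rw [le_div_iff₀ (by positivity)] at h1
    nlinarith
  obtain ⟨ρ, hρ0, hρ1, hcontr⟩ := exists_osc_contraction (κ := κ ∘ₖ κ) hV0 (sq_nonneg γ) hγ2 hβ0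
    hV2i hV2d hR hR0 ha0 hβa hν
  set W : α → ℝ := fun x => 1 + β * V x with hWdef
  have hW1 : ∀ x, 1 ≤ W x := fun x => le_add_of_nonneg_right (mul_nonneg hβ0.le (hV0 x))
  have hWm : Measurable W := measurable_const.add (hVm.const_mul β)
  have hWint : ∀ {μ : Measure α} [IsFiniteMeasure μ], Integrable V μ → Integrable W μ :=
    fun h => (integrable_const 1).add (h.const_mul β)
  -- a single step increases oscillations at most by the factor `A`
  set A := 1 + β * b with hAdef
  have hA1 : 1 ≤ A := le_add_of_nonneg_right (by positivity)
  have hWop : ∀ x, kernelOp κ W x ≤ A * W x := fun x => by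
    have : kernelOp κ W x = 1 + β * kernelOp κ V x := by
      simp only [kernelOp, hWdef]
      rw [integral_add (integrable_const 1) ((hVi x).const_mul β), integral_const_mul]
      simp
    rw [this, hAdef]
    have h1 := mul_le_mul_of_nonneg_left (hVd x) hβ0.le
    have h2 : γ * V x ≤ V x := by nlinarith [hV0 x]
    have h3 := mul_le_mul_of_nonneg_left h2 hβ0.le
    have h4 : (1 + β * b) * W x = (1 + β * V x) + β * b * W x := by simp only [hWdef]; ring
    have h5 : β * b ≤ β * b * W x := le_mul_of_one_le_right (by positivity) (hW1 x)
    linarith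
  have hstep : ∀ φ : α → ℝ, Measurable φ → ∀ t, 0 ≤ t → OscLE W φ t →
      OscLE W (kernelOp κ φ) (A * t) := fun φ hφ t ht h x y => by
    refine (h.abs_kernelOp_sub_le hφ (fun x => hWint (hVi x)) x y).trans ?_
    have := mul_le_mul_of_nonneg_left (add_le_add (hWop x) (hWop y)) ht
    linarith
  -- the rate of one step is the square root of the rate of two steps
  set r := √ρ with hrdef
  have hr0 : 0 < r := Real.sqrt_pos.2 hρ0
  have hr1 : r < 1 := by rw [hrdef, Real.sqrt_lt' one_pos]; simpa using hρ1
  have hrr : r * r = ρ := Real.mul_self_sqrt hρ0.le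
  set B := A / r with hBdef
  have hB1 : 1 ≤ B := by rw [hBdef, le_div_iff₀ hr0]; linarith
  have hosc : ∀ k, ∀ φ : α → ℝ, Measurable φ → ∀ t, 0 ≤ t → OscLE W φ t →
      OscLE W (evolve κ k φ) (B * r ^ k * t) := by
    have hmono : ∀ {φ : α → ℝ} {s t : ℝ}, s ≤ t → OscLE W φ s → OscLE W φ t :=
      fun hst h u v => (h u v).trans (mul_le_mul_of_nonneg_right hst
        (by linarith [hW1 u, hW1 v]))
    intro k
    induction k using Nat.twoStepInduction with
    | zero =>
      intro φ hφ t ht h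
      have : evolve κ 0 φ = φ := by
        funext x
        simp only [evolve, iterKernel]
        rw [Kernel.id_apply, integral_dirac' _ _ hφ.stronglyMeasurable]
      rw [this]
      exact hmono (by nlinarith) h
    | one =>
      intro φ hφ t ht h
      have : evolve κ 1 φ = kernelOp κ φ := by
        funext x
        simp only [evolve, iterKernel, Kernel.comp_id, kernelOp]
      rw [this]
      refine hmono (le_of_eq ?_) (hstep φ hφ t ht h)
      rw [hBdef]
      field_simp
    | more k ih _ =>
      intro φ hφ t ht h
      have hφk : ∀ k x, Integrable φ (iterKernel κ k x) := fun k x =>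
        h.integrable hφ (hWint (hVk k x))
      have e : evolve κ (k + 2) φ = evolve κ k (kernelOp (κ ∘ₖ κ) φ) := by
        funext x
        have h2 : kernelOp (κ ∘ₖ κ) φ = kernelOp κ (kernelOp κ φ) := by
          funext y
          exact kernelOp_comp (h.integrable hφ (hWint (hV2i y)))
        rw [evolve_succ (hφk _ x), evolve_succ, h2]
        exact (hstep φ hφ t ht h).integrable (measurable_kernelOp κ hφ) (hWint (hVk _ x))
      rw [e]
      refine hmono (le_of_eq ?_) (ih _ (measurable_kernelOp _ hφ) _ (by positivity)
        (hcontr φ hφ t ht h))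
      rw [pow_add, pow_two, hrr]
      ring
  -- the laws of the chain converge uniformly on measurable sets
  have hind : ∀ E : Set α, MeasurableSet E → Measurable (E.indicator (1 : α → ℝ)) ∧
      OscLE W (E.indicator (1 : α → ℝ)) 1 := fun E hE => by
    refine ⟨measurable_one.indicator hE, fun u v => ?_⟩
    have h1 : ∀ u, 0 ≤ E.indicator (1 : α → ℝ) u ∧ E.indicator (1 : α → ℝ) u ≤ 1 := fun u => by
      by_cases hu : u ∈ E <;> simp [hu]
    rw [abs_le]
    constructor <;> linarith [(h1 u).1, (h1 v).1, (h1 u).2, (h1 v).2, hW1 u, hW1 v]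
  have hevE : ∀ k x E, MeasurableSet E →
      evolve κ k (E.indicator (1 : α → ℝ)) x = (iterKernel κ k x).real E := fun k x E hE => by
    simp only [evolve]
    exact integral_indicator_one hE
  have hcauchy : ∀ x E, MeasurableSet E → ∀ k,
      dist ((iterKernel κ k x).real E) ((iterKernel κ (k + 1) x).real E) ≤
        B * (1 + A) * W x * r ^ k := fun x E hE k => by
    obtain ⟨hφ, hφo⟩ := hind E hE
    have hi : Integrable (evolve κ k (E.indicator (1 : α → ℝ))) (κ x) :=
      (hosc k _ hφ 1 zero_le_one hφo).integrable
        (measurable_kernelOp (iterKernel κ k) hφ) (hWint (hVi x))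
    rw [dist_comm, Real.dist_eq, ← hevE _ _ _ hE, ← hevE _ _ _ hE,
      evolve_succ' (hφo.integrable hφ (hWint (hVk _ x)))]
    have e : ∫ y, evolve κ k (E.indicator (1 : α → ℝ)) y ∂(κ x) -
        evolve κ k (E.indicator (1 : α → ℝ)) x =
        ∫ y, (evolve κ k (E.indicator (1 : α → ℝ)) y -
          evolve κ k (E.indicator (1 : α → ℝ)) x) ∂(κ x) := by
      rw [integral_sub hi (integrable_const _)]
      simp
    have hWx : Integrable (fun y => B * r ^ k * 1 * (W y + W x)) (κ x) :=
      ((hWint (hVi x)).add (integrable_const _)).const_mul _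
    rw [e]
    refine (norm_integral_le_of_norm_le hWx (ae_of_all _ fun y =>
      (Real.norm_eq_abs _).trans_le (hosc k _ hφ 1 zero_le_one hφo y x))).trans ?_
    rw [integral_const_mul, integral_add (hWint (hVi x)) (integrable_const _)]
    have h1 := hWop x
    have h2 : 0 ≤ B * r ^ k := by positivity
    simp only [integral_const, probReal_univ, one_smul, mul_one]
    have := mul_le_mul_of_nonneg_left h1 h2
    change B * r ^ k * (kernelOp κ W x + W x) ≤ _
    linarith
  obtain ⟨x₀⟩ := ‹Nonempty α›
  have hconv : ∀ E, ∃ l, MeasurableSet E →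
      Tendsto (fun k => (iterKernel κ k x₀).real E) atTop (𝓝 l) := fun E => by
    by_cases hE : MeasurableSet E
    · obtain ⟨l, hl⟩ := cauchySeq_tendsto_of_complete
        (cauchySeq_of_le_geometric r _ hr1 (hcauchy x₀ E hE))
      exact ⟨l, fun _ => hl⟩
    · exact ⟨0, fun h => absurd h hE⟩
  choose ℓ hℓ using hconv
  obtain ⟨π, hπp, hπlim⟩ := exists_measure_of_uniform_limit (μ := fun k => iterKernel κ k x₀)
    (ℓ := ℓ) (ε := fun k => B * (1 + A) * W x₀ * r ^ k / (1 - r))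
    (by simpa using ((tendsto_pow_atTop_nhds_zero_of_lt_one hr0.le hr1).const_mul
      (B * (1 + A) * W x₀)).div_const (1 - r))
    (fun E hE k => dist_le_of_le_geometric_of_tendsto r _ hr1 (hcauchy x₀ E hE) (hℓ E hE) k)
  have hrk : ∀ D : ℝ, Tendsto (fun k => B * r ^ k * D) atTop (𝓝 0) := fun D => by
    simpa using ((tendsto_pow_atTop_nhds_zero_of_lt_one hr0.le hr1).const_mul B).mul_const D
  have hreal : ∀ x E, MeasurableSet E →
      Tendsto (fun k => (iterKernel κ k x).real E) atTop (𝓝 (π.real E)) := fun x E hE => by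
    obtain ⟨hφ, hφo⟩ := hind E hE
    have h1 : Tendsto (fun k => (iterKernel κ k x₀).real E) atTop (𝓝 (π.real E)) :=
      (ENNReal.tendsto_toReal (measure_ne_top _ _)).comp (hπlim E hE)
    have h2 : Tendsto (fun k => (iterKernel κ k x).real E - (iterKernel κ k x₀).real E) atTop
        (𝓝 0) := by
      refine squeeze_zero_norm (fun k => ?_) (hrk (1 * (W x + W x₀)))
      rw [Real.norm_eq_abs, ← hevE _ _ _ hE, ← hevE _ _ _ hE]
      exact (hosc k _ hφ 1 zero_le_one hφo x x₀).trans_eq (by ring)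
    simpa using h2.add h1
  have hlim : ∀ x E, MeasurableSet E →
      Tendsto (fun k => iterKernel κ k x E) atTop (𝓝 (π E)) := fun x E hE => by
    have := (ENNReal.continuous_ofReal.tendsto _).comp (hreal x E hE)
    simpa [Function.comp_def] using this
  -- `π κ ≤ π` by Fatou's lemma along the chain, with equality since both are probabilities
  have hinv : Kernel.Invariant κ π := by
    have hbp : IsProbabilityMeasure (π.bind κ) := by infer_instance
    refine Measure.eq_of_le_of_measure_univ_eq (Measure.le_iff.2 fun E hE => ?_) (by simp)
    rw [Measure.bind_apply hE κ.aemeasurable]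
    refine lintegral_le_of_tendsto_setwise hπlim
      ((hlim x₀ E hE).comp (tendsto_add_atTop_nat 1)) fun k => ?_
    simp only [Function.comp_apply]
    rw [iterKernel, Kernel.comp_apply' _ _ _ hE]
  have huniq : ∀ π' : Measure α, IsProbabilityMeasure π' → Kernel.Invariant κ π' → π' = π := by
    intro π' hp' hinv'
    ext E hE
    obtain ⟨hφ, hφo⟩ := hind E hE
    have hk : ∀ k, ∫⁻ x, iterKernel κ k x E ∂π' = π' E := fun k => by
      rw [← Measure.bind_apply hE (Kernel.aemeasurable _), (invariant_iterKernel hinv' k).def]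
    have h2 : Tendsto (fun k => ∫⁻ x, iterKernel κ k x E ∂π') atTop (𝓝 (∫⁻ _, π E ∂π')) :=
      tendsto_lintegral_of_dominated_convergence (fun _ => 1)
        (fun k => Kernel.measurable_coe _ hE) (fun k => ae_of_all _ fun x => prob_le_one)
        (by simp) (ae_of_all _ fun x => hlim x E hE)
    simp only [hk] at h2
    simpa using tendsto_nhds_unique tendsto_const_nhds h2
  have hVπ : Integrable V π := integrable_of_lintegral_ofReal_le hVm hV0
    (lintegral_le_of_tendsto_setwise hπlim tendsto_const_nhds
      fun k => lintegral_iterKernel_le hVm hV0 hγ0 hγ1 hb hdrift k x₀)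
  refine ⟨π, hπp, hinv, huniq, hlim, ?_⟩
  have hWπ := hWint hVπ
  have hWπ0 : 0 ≤ ∫ y, W y ∂π := integral_nonneg fun y => zero_le_one.trans (hW1 y)
  -- `W ≤ K ≤ W / β` compares the weight of the contraction with the weight of the norm
  refine ⟨B * (1 + ∫ y, W y ∂π) / β, r, by positivity, hr0, hr1, fun φ hφ => ?_⟩
  obtain ⟨hφm, hφb⟩ := hφ
  set K : α → ℝ := fun x => V x + 1 with hK
  have hK0 : ∀ x, 0 < K x := fun x => by have := hV0 x; simp only [hK]; linarith
  set N := normLinfWeight K φ with hN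
  have hφN : ∀ x, |φ x| ≤ N * K x := fun x => by
    have := le_ciSup hφb x
    rw [abs_div, abs_of_pos (hK0 x), div_le_iff₀ (hK0 x)] at this
    exact this
  have hN0 : 0 ≤ N := Real.iSup_nonneg fun x => abs_nonneg _
  have hKW : ∀ x, K x ≤ W x / β := fun x => by
    rw [le_div_iff₀ hβ0]
    simp only [hK, hWdef]
    linarith
  have hWK : ∀ x, W x ≤ K x := fun x => by
    have := mul_le_mul_of_nonneg_right hβ1 (hV0 x)
    simp only [hK, hWdef]
    linarith
  have hφo : OscLE W φ (N / β) := fun u v => by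
    have h1 := (abs_sub (φ u) (φ v)).trans (add_le_add (hφN u) (hφN v))
    have h2 := mul_le_mul_of_nonneg_left (add_le_add (hKW u) (hKW v)) hN0
    calc _ ≤ _ := h1
      _ = N * (K u + K v) := by ring
      _ ≤ _ := h2
      _ = _ := by field_simp
  have hNβ : 0 ≤ N / β := by positivity
  have hφk : ∀ k x, Integrable φ (iterKernel κ k x) := fun k x =>
    hφo.integrable hφm (hWint (hVk k x))
  have hφπ : Integrable φ π := hφo.integrable hφm hWπ
  refine ⟨hφπ, fun k => ⟨hφk k, ?_⟩⟩
  have hevm : Measurable (evolve κ k φ) := measurable_kernelOp (iterKernel κ k) hφm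
  have hinvk : ∫ x, evolve κ k φ x ∂π = ∫ x, φ x ∂π :=
    integral_kernelOp_of_invariant (invariant_iterKernel hinv k) hφπ
  have hko := hosc k φ hφm _ hNβ hφo
  have hki : Integrable (evolve κ k φ) π := hko.integrable hevm hWπ
  have hmain : ∀ x, |(evolve κ k φ x - ∫ y, φ y ∂π) / K x| ≤
      B * (1 + ∫ y, W y ∂π) / β * r ^ k * N := fun x => by
    rw [abs_div, abs_of_pos (hK0 x), div_le_iff₀ (hK0 x)]
    have e : evolve κ k φ x - ∫ y, φ y ∂π = ∫ y, (evolve κ k φ x - evolve κ k φ y) ∂π := by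
      rw [integral_sub (integrable_const _) hki, hinvk]
      simp
    have hWx : Integrable (fun y => B * r ^ k * (N / β) * (W x + W y)) π :=
      ((integrable_const _).add hWπ).const_mul _
    rw [e]
    refine (norm_integral_le_of_norm_le hWx (ae_of_all _ fun y =>
      (Real.norm_eq_abs _).trans_le (hko x y))).trans ?_
    rw [integral_const_mul, integral_add (integrable_const _) hWπ]
    simp only [integral_const, probReal_univ, one_smul]
    have h1 : W x + ∫ y, W y ∂π ≤ (1 + ∫ y, W y ∂π) * K x := by
      have h2 : 1 ≤ K x := (hW1 x).trans (hWK x)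
      have h3 := le_mul_of_one_le_right hWπ0 h2
      have := hWK x
      linarith
    refine (mul_le_mul_of_nonneg_left h1 (by positivity)).trans_eq ?_
    field_simp
  exact ⟨⟨hevm.sub measurable_const, ⟨_, by rintro _ ⟨x, rfl⟩; exact hmain x⟩⟩, ciSup_le hmain⟩

end HarrisTheorem

/-! ### Contraction of quadratic forms -/

section QuadraticForms

variable {ι : Type*} [Fintype ι]

lemma abs_dotProduct_le (x y : ι → ℝ) : |x ⬝ᵥ y| ≤ Fintype.card ι * (‖x‖ * ‖y‖) := by
  refine (Finset.abs_sum_le_sum_abs _ _).trans ?_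
  calc ∑ i, |x i * y i| ≤ ∑ _i : ι, ‖x‖ * ‖y‖ := Finset.sum_le_sum fun i _ => by
        rw [abs_mul]
        exact mul_le_mul (norm_le_pi_norm x i) (norm_le_pi_norm y i) (abs_nonneg _)
          (norm_nonneg _)
    _ = _ := by simp

lemma continuous_dotProduct_mulVec (C : Matrix ι ι ℝ) :
    Continuous fun x : ι → ℝ => x ⬝ᵥ C *ᵥ x := by
  simp only [dotProduct, Matrix.mulVec]
  fun_prop

lemma exists_norm_sq_le_of_posDef {W : Matrix ι ι ℝ} (hW : W.PosDef) :
    ∃ w : ℝ, 0 < w ∧ ∀ x : ι → ℝ, w * ‖x‖ ^ 2 ≤ x ⬝ᵥ W *ᵥ x := by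
  rcases (Metric.sphere (0 : ι → ℝ) 1).eq_empty_or_nonempty with he | hne
  · refine ⟨1, one_pos, fun x => ?_⟩
    have hx : x = 0 := by
      by_contra hx
      have : (‖x‖⁻¹ • x) ∈ Metric.sphere (0 : ι → ℝ) 1 := by
        simp [norm_smul, inv_mul_cancel₀ (norm_ne_zero_iff.2 hx)]
      rw [he] at this
      exact this
    simp [hx]
  · obtain ⟨x₀, hx₀, hmin⟩ := (isCompact_sphere (0 : ι → ℝ) 1).exists_isMinOn hne
      (continuous_dotProduct_mulVec W).continuousOn
    have hx₀0 : x₀ ≠ 0 := by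
      rintro rfl
      simp at hx₀
    refine ⟨_, hW.dotProduct_pos hx₀0, fun x => ?_⟩
    rcases eq_or_ne x 0 with rfl | hx
    · simp
    have hn := norm_pos_iff.2 hx
    have hmem : (‖x‖⁻¹ • x) ∈ Metric.sphere (0 : ι → ℝ) 1 := by
      simp [norm_smul, inv_mul_cancel₀ hn.ne']
    have h1 : x₀ ⬝ᵥ W *ᵥ x₀ ≤ (‖x‖⁻¹ • x) ⬝ᵥ W *ᵥ (‖x‖⁻¹ • x) := hmin hmem
    rw [Matrix.mulVec_smul, smul_dotProduct, dotProduct_smul, smul_eq_mul, smul_eq_mul] at h1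
    calc _ ≤ (‖x‖⁻¹ * (‖x‖⁻¹ * (x ⬝ᵥ W *ᵥ x))) * ‖x‖ ^ 2 := by gcongr
      _ = _ := by field_simp

lemma exists_dotProduct_mulVec_le (C : Matrix ι ι ℝ) :
    ∃ D : ℝ, 0 < D ∧ ∀ x : ι → ℝ, x ⬝ᵥ C *ᵥ x ≤ D * ‖x‖ ^ 2 := by
  classical
  let T : (ι → ℝ) →L[ℝ] (ι → ℝ) := LinearMap.toContinuousLinearMap (Matrix.mulVecLin C)
  refine ⟨Fintype.card ι * ‖T‖ + 1, by positivity, fun x => ?_⟩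
  have h1 : ‖C *ᵥ x‖ ≤ ‖T‖ * ‖x‖ := T.le_opNorm x
  calc x ⬝ᵥ C *ᵥ x ≤ Fintype.card ι * (‖x‖ * ‖C *ᵥ x‖) :=
        (le_abs_self _).trans (abs_dotProduct_le _ _)
    _ ≤ Fintype.card ι * (‖x‖ * (‖T‖ * ‖x‖)) := by gcongr
    _ ≤ _ := by nlinarith [sq_nonneg ‖x‖]

lemma dotProduct_mulVec_nonneg_of_posDef {C : Matrix ι ι ℝ} (hC : C.PosDef) (x : ι → ℝ) :
    0 ≤ x ⬝ᵥ C *ᵥ x := by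
  simpa using hC.posSemidef.dotProduct_mulVec_nonneg x

/-- Young's inequality for a quadratic form. -/
lemma dotProduct_mulVec_add_le {C : Matrix ι ι ℝ} (hC : C.PosDef) {ε : ℝ} (hε : 0 < ε)
    (u v : ι → ℝ) : (u + v) ⬝ᵥ C *ᵥ (u + v) ≤
      (1 + ε) * (u ⬝ᵥ C *ᵥ u) + (1 + ε⁻¹) * (v ⬝ᵥ C *ᵥ v) := by
  have h := dotProduct_mulVec_nonneg_of_posDef hC (ε • u - v)
  have hs : v ⬝ᵥ C *ᵥ u = u ⬝ᵥ C *ᵥ v := by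
    rw [Matrix.dotProduct_mulVec, ← Matrix.mulVec_transpose, hC.isSymm.eq, dotProduct_comm]
  simp only [Matrix.mulVec_sub, Matrix.mulVec_smul, sub_dotProduct, dotProduct_sub,
    smul_dotProduct, dotProduct_smul, smul_eq_mul, hs] at h
  simp only [Matrix.mulVec_add, add_dotProduct, dotProduct_add, hs]
  have h2 : 0 ≤ ε⁻¹ * (ε * (ε * (u ⬝ᵥ C *ᵥ u)) - ε * (u ⬝ᵥ C *ᵥ v) -
      (ε * (u ⬝ᵥ C *ᵥ v) - v ⬝ᵥ C *ᵥ v)) := mul_nonneg (inv_nonneg.2 hε.le) (by linarith)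
  have h3 : ε⁻¹ * (ε * (ε * (u ⬝ᵥ C *ᵥ u)) - ε * (u ⬝ᵥ C *ᵥ v) -
      (ε * (u ⬝ᵥ C *ᵥ v) - v ⬝ᵥ C *ᵥ v)) =
      ε * (u ⬝ᵥ C *ᵥ u) - 2 * (u ⬝ᵥ C *ᵥ v) + ε⁻¹ * (v ⬝ᵥ C *ᵥ v) := by
    field_simp
    ring
  linarith

end QuadraticForms

section Contraction

open scoped Matrix.Norms.Operator
open Filter Topology

variable {ι : Type*} [Fintype ι] [DecidableEq ι]

/-- A family of matrices `1 - h G + o(h)` contracts the quadratic form `C` for small `h > 0` if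
`Gᵀ C + C G` is positive definite. -/
lemma exists_contraction_of_hasDerivAt {C G : Matrix ι ι ℝ} (hC : C.PosDef)
    (hW : (Gᵀ * C + C * G).PosDef) {L : ℝ → Matrix ι ι ℝ} (h0 : L 0 = 1)
    (hL : HasDerivAt L (-G) 0) :
    ∃ h₀ : ℝ, 0 < h₀ ∧ ∀ h, 0 < h → h < h₀ → ∃ ρ : ℝ, 0 ≤ ρ ∧ ρ < 1 ∧
      ∀ x, (L h *ᵥ x) ⬝ᵥ C *ᵥ (L h *ᵥ x) ≤ ρ * (x ⬝ᵥ C *ᵥ x) := by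
  obtain ⟨w, hw, hwle⟩ := exists_norm_sq_le_of_posDef hW
  obtain ⟨D, hD, hDle⟩ := exists_dotProduct_mulVec_le C
  have hLt : HasDerivAt (fun h => (L h)ᵀ) (-Gᵀ) 0 := by
    have h := ((LinearMap.toContinuousLinearMap
      (Matrix.transposeLinearEquiv ι ι ℝ ℝ).toLinearMap).hasFDerivAt (x := L 0)).comp_hasDerivAt
        (0 : ℝ) hL
    exact h
  have hQ : HasDerivAt (fun h => (L h)ᵀ * C * L h) (-(Gᵀ * C + C * G)) 0 := by
    refine ((hLt.mul_const C).mul hL).congr_deriv ?_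
    rw [h0]
    simp only [Matrix.transpose_one, one_mul, mul_one, neg_mul, mul_neg]
    abel
  have hlittle := (hasDerivAt_iff_isLittleO.1 hQ).def
    (show 0 < w / (2 * (Fintype.card ι + 1)) by positivity)
  obtain ⟨h₀, hh₀, hball⟩ := Metric.eventually_nhds_iff.1 hlittle
  refine ⟨h₀, hh₀, fun h hpos hlt => ⟨max 0 (1 - h * w / (2 * D)), le_max_left _ _,
    max_lt one_pos (by have : 0 < h * w / (2 * D) := by positivity
                       linarith), fun x => ?_⟩⟩
  have hb := hball (y := h) (by simpa [abs_of_pos hpos] using hlt)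
  set E := (L h)ᵀ * C * L h - (L 0)ᵀ * C * L 0 - (h - 0) • -(Gᵀ * C + C * G) with hE
  have hEle : |x ⬝ᵥ E *ᵥ x| ≤ h * w / 2 * ‖x‖ ^ 2 := by
    have h1 : ‖E *ᵥ x‖ ≤ ‖E‖ * ‖x‖ := Matrix.linfty_opNorm_mulVec E x
    have h2 : ‖E‖ ≤ w / (2 * (Fintype.card ι + 1)) * h := by
      simpa [abs_of_pos hpos] using hb
    calc |x ⬝ᵥ E *ᵥ x| ≤ Fintype.card ι * (‖x‖ * ‖E *ᵥ x‖) := abs_dotProduct_le _ _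
      _ ≤ (Fintype.card ι + 1) * (‖x‖ * (w / (2 * (Fintype.card ι + 1)) * h * ‖x‖)) := by
          gcongr
          · linarith
          · exact h1.trans (by gcongr)
      _ = _ := by field_simp
  have hval : (L h *ᵥ x) ⬝ᵥ C *ᵥ (L h *ᵥ x) =
      x ⬝ᵥ C *ᵥ x - h * (x ⬝ᵥ (Gᵀ * C + C * G) *ᵥ x) + x ⬝ᵥ E *ᵥ x := by
    have e1 : (L h *ᵥ x) ⬝ᵥ C *ᵥ (L h *ᵥ x) = x ⬝ᵥ ((L h)ᵀ * C * L h) *ᵥ x := by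
      rw [← Matrix.mulVec_mulVec, ← Matrix.mulVec_mulVec, Matrix.dotProduct_mulVec x,
        Matrix.vecMul_transpose]
    have e2 : (L h)ᵀ * C * L h = C - h • (Gᵀ * C + C * G) + E := by
      rw [hE, h0]
      simp only [Matrix.transpose_one, one_mul, mul_one, sub_zero, smul_neg]
      abel
    rw [e1, e2, Matrix.add_mulVec, Matrix.sub_mulVec, Matrix.smul_mulVec, dotProduct_add,
      dotProduct_sub, dotProduct_smul, smul_eq_mul]
  have h1 := mul_le_mul_of_nonneg_left (hwle x) hpos.le
  have h2 := (abs_le.1 hEle).2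
  have h3 := hDle x
  have h4 : h * w / (2 * D) * (x ⬝ᵥ C *ᵥ x) ≤ h * w / 2 * ‖x‖ ^ 2 := by
    calc _ ≤ h * w / (2 * D) * (D * ‖x‖ ^ 2) := by gcongr
      _ = _ := by field_simp
  calc _ ≤ (1 - h * w / (2 * D)) * (x ⬝ᵥ C *ᵥ x) := by rw [hval]; linarith
    _ ≤ _ := mul_le_mul_of_nonneg_right (le_max_right _ _)
      (dotProduct_mulVec_nonneg_of_posDef hC x)

end Contraction

/-! ### Kernels close to a linear map -/

section DevBound

variable {ι : Type*} [Fintype ι]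

/-- The transition kernel `κ` moves `x` to `L x` up to an error all of whose moments are bounded
uniformly in `x`. -/
def DevBound (κ : Kernel (ι → ℝ) (ι → ℝ)) (L : Matrix ι ι ℝ) : Prop :=
  ∀ k : ℕ, ∃ B : NNReal, ∀ x, ∫⁻ y, ‖y - L *ᵥ x‖ₑ ^ k ∂(κ x) ≤ B

lemma _root_.ENNReal.add_pow_le_two_pow_mul (a b : ENNReal) (k : ℕ) :
    (a + b) ^ k ≤ 2 ^ k * (a ^ k + b ^ k) := by
  calc (a + b) ^ k ≤ (2 * max a b) ^ k := by
        gcongr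
        rw [two_mul]
        exact add_le_add (le_max_left _ _) (le_max_right _ _)
    _ = 2 ^ k * max a b ^ k := mul_pow _ _ _
    _ ≤ _ := by
        gcongr
        rcases max_choice a b with h | h <;> rw [h]
        · exact le_self_add
        · exact le_add_self

lemma measurable_enorm_sub_pow (v : ι → ℝ) (k : ℕ) :
    Measurable fun y : ι → ℝ => ‖y - v‖ₑ ^ k := by fun_prop

lemma DevBound.comp [DecidableEq ι] {κ η : Kernel (ι → ℝ) (ι → ℝ)} [IsMarkovKernel κ]
    [IsMarkovKernel η]
    {L L' : Matrix ι ι ℝ} (hη : DevBound η L') (hκ : DevBound κ L) :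
    DevBound (η ∘ₖ κ) (L' * L) := by
  intro k
  obtain ⟨B, hB⟩ := hκ k
  obtain ⟨B', hB'⟩ := hη k
  let T : (ι → ℝ) →L[ℝ] (ι → ℝ) := LinearMap.toContinuousLinearMap (Matrix.mulVecLin L')
  refine ⟨2 ^ k * (B' + ‖T‖₊ ^ k * B), fun x => ?_⟩
  rw [Kernel.lintegral_comp _ _ _ (measurable_enorm_sub_pow _ _)]
  have hpt : ∀ y z, ‖z - (L' * L) *ᵥ x‖ₑ ^ k ≤
      2 ^ k * (‖z - L' *ᵥ y‖ₑ ^ k + ‖T‖ₑ ^ k * ‖y - L *ᵥ x‖ₑ ^ k) := fun y z => by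
    have e : z - (L' * L) *ᵥ x = (z - L' *ᵥ y) + T (y - L *ᵥ x) := by
      simp [T, Matrix.mulVec_sub, Matrix.mulVec_mulVec]
    rw [e, ← mul_pow]
    refine le_trans ?_ (ENNReal.add_pow_le_two_pow_mul _ _ _)
    gcongr
    exact (enorm_add_le _ _).trans (add_le_add le_rfl (T.le_opENorm _))
  calc ∫⁻ y, ∫⁻ z, ‖z - (L' * L) *ᵥ x‖ₑ ^ k ∂(η y) ∂(κ x)
      ≤ ∫⁻ y, 2 ^ k * (B' + ‖T‖ₑ ^ k * ‖y - L *ᵥ x‖ₑ ^ k) ∂(κ x) := by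
        refine lintegral_mono fun y => ?_
        refine (lintegral_mono fun z => hpt y z).trans ?_
        rw [lintegral_const_mul _ (by fun_prop), lintegral_add_right _ measurable_const,
          lintegral_const, measure_univ, mul_one]
        gcongr
        exact hB' y
    _ = 2 ^ k * (B' + ‖T‖ₑ ^ k * ∫⁻ y, ‖y - L *ᵥ x‖ₑ ^ k ∂(κ x)) := by
        rw [lintegral_const_mul _ (by fun_prop), lintegral_add_left measurable_const,
          lintegral_const_mul _ (by fun_prop)]
        simp
    _ ≤ 2 ^ k * (B' + ‖T‖ₑ ^ k * B) := by
        gcongr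
        exact hB x
    _ = _ := by push_cast; rfl

lemma DevBound.deterministic {f : (ι → ℝ) → ι → ℝ} (hf : Measurable f) {L : Matrix ι ι ℝ} {D : ℝ}
    (hD : ∀ x, ‖f x - L *ᵥ x‖ ≤ D) : DevBound (Kernel.deterministic f hf) L := by
  intro k
  refine ⟨D.toNNReal ^ k, fun x => ?_⟩
  rw [Kernel.lintegral_deterministic' hf (by fun_prop)]
  push_cast
  gcongr
  rw [← ofReal_norm]
  exact ENNReal.ofReal_le_ofReal (hD x)

/-- A kernel close to a linear map that contracts the quadratic form `C` satisfies a drift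
condition for all powers of this form. -/
lemma DevBound.drift {κ : Kernel (ι → ℝ) (ι → ℝ)} [IsMarkovKernel κ] {L C : Matrix ι ι ℝ}
    (hκ : DevBound κ L) (hC : C.PosDef) {ρ : ℝ} (hρ0 : 0 ≤ ρ) (hρ1 : ρ < 1)
    (hL : ∀ x, (L *ᵥ x) ⬝ᵥ C *ᵥ (L *ᵥ x) ≤ ρ * (x ⬝ᵥ C *ᵥ x)) (l : ℕ) :
    ∃ γ b : ℝ, 0 ≤ γ ∧ γ < 1 ∧ 0 ≤ b ∧ ∀ x,
      ∫⁻ y, ENNReal.ofReal ((y ⬝ᵥ C *ᵥ y) ^ l) ∂(κ x) ≤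
        ENNReal.ofReal (γ * (x ⬝ᵥ C *ᵥ x) ^ l + b) := by
  obtain ⟨D, hD, hDle⟩ := exists_dotProduct_mulVec_le C
  obtain ⟨B, hB⟩ := hκ (2 * l)
  have hq := dotProduct_mulVec_nonneg_of_posDef hC
  -- Young's inequality with weight `ε` leaves room between `ρ` and `γ`; `E` is chosen for the
  -- convexity of `t ↦ t ^ l`
  set ε := (1 - ρ) / 2 with hε
  have hε0 : 0 < ε := by rw [hε]; linarith
  set γ := (1 + ρ) / 2 with hγ
  have hγ0 : 0 ≤ γ := by rw [hγ]; linarith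
  have hγ1 : 0 < 1 - γ := by rw [hγ]; linarith
  have hεγ : (1 + ε) * ρ ≤ γ := by rw [hε, hγ]; nlinarith
  set D' := (1 + ε⁻¹) * D / (1 - γ) with hD'
  have hD'0 : 0 ≤ D' := by positivity
  set E := (1 - γ) * D' ^ l with hE
  have hE0 : 0 ≤ E := by positivity
  have hpt : ∀ x y : ι → ℝ, (y ⬝ᵥ C *ᵥ y) ^ l ≤
      γ * (x ⬝ᵥ C *ᵥ x) ^ l + E * ‖y - L *ᵥ x‖ ^ (2 * l) := fun x y => by
    set d := y - L *ᵥ x with hd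
    have h1 : y ⬝ᵥ C *ᵥ y ≤ γ * (x ⬝ᵥ C *ᵥ x) + (1 - γ) * (D' * ‖d‖ ^ 2) := by
      have e : y = L *ᵥ x + d := by rw [hd]; abel
      calc y ⬝ᵥ C *ᵥ y ≤ (1 + ε) * ((L *ᵥ x) ⬝ᵥ C *ᵥ (L *ᵥ x)) + (1 + ε⁻¹) * (d ⬝ᵥ C *ᵥ d) := by
            conv_lhs => rw [e]
            exact dotProduct_mulVec_add_le hC hε0 _ _
        _ ≤ (1 + ε) * (ρ * (x ⬝ᵥ C *ᵥ x)) + (1 + ε⁻¹) * (D * ‖d‖ ^ 2) := by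
            gcongr
            · exact hL x
            · exact hDle d
        _ = (1 + ε) * ρ * (x ⬝ᵥ C *ᵥ x) + (1 - γ) * (D' * ‖d‖ ^ 2) := by
            rw [hD']
            field_simp
        _ ≤ _ := by
            gcongr
            exact hq x
    have h2 := (convexOn_pow l).2 (Set.mem_Ici.2 (hq x))
      (Set.mem_Ici.2 (show 0 ≤ D' * ‖d‖ ^ 2 by positivity)) hγ0 hγ1.le (by ring)
    simp only [smul_eq_mul] at h2
    calc _ ≤ (γ * (x ⬝ᵥ C *ᵥ x) + (1 - γ) * (D' * ‖d‖ ^ 2)) ^ l :=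
          pow_le_pow_left₀ (hq y) h1 l
      _ ≤ _ := h2
      _ = _ := by rw [hE, mul_pow, pow_mul]; ring
  refine ⟨γ, E * B, hγ0, by linarith, by positivity, fun x => ?_⟩
  have hx : 0 ≤ γ * (x ⬝ᵥ C *ᵥ x) ^ l := mul_nonneg hγ0 (pow_nonneg (hq x) l)
  calc ∫⁻ y, ENNReal.ofReal ((y ⬝ᵥ C *ᵥ y) ^ l) ∂(κ x)
      ≤ ∫⁻ y, (ENNReal.ofReal (γ * (x ⬝ᵥ C *ᵥ x) ^ l) +
          ENNReal.ofReal E * ‖y - L *ᵥ x‖ₑ ^ (2 * l)) ∂(κ x) := lintegral_mono fun y => by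
        rw [← ofReal_norm, ← ENNReal.ofReal_pow (norm_nonneg _),
          ← ENNReal.ofReal_mul hE0, ← ENNReal.ofReal_add hx (by positivity)]
        exact ENNReal.ofReal_le_ofReal (hpt x y)
    _ = ENNReal.ofReal (γ * (x ⬝ᵥ C *ᵥ x) ^ l) +
          ENNReal.ofReal E * ∫⁻ y, ‖y - L *ᵥ x‖ₑ ^ (2 * l) ∂(κ x) := by
        rw [lintegral_add_left measurable_const, lintegral_const_mul _ (by fun_prop)]
        simp
    _ ≤ ENNReal.ofReal (γ * (x ⬝ᵥ C *ᵥ x) ^ l) + ENNReal.ofReal E * B := by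
        gcongr
        exact hB x
    _ = _ := by
        rw [ENNReal.ofReal_add hx (by positivity), ENNReal.ofReal_mul hE0,
          ENNReal.ofReal_coe_nnreal]

/-- Markov's inequality: a kernel close to a linear map sends bounded sets to bounded sets with
probability at least one half. -/
lemma DevBound.exists_ball {κ : Kernel (ι → ℝ) (ι → ℝ)} [IsMarkovKernel κ] {L : Matrix ι ι ℝ}
    (hκ : DevBound κ L) (r : ℝ) : ∃ r' : ℝ, ∀ x, ‖x‖ ≤ r →
      (1 / 2 : ENNReal) ≤ κ x (Metric.closedBall 0 r') := by
  obtain ⟨B, hB⟩ := hκ 1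
  let T : (ι → ℝ) →L[ℝ] (ι → ℝ) := by
    classical exact LinearMap.toContinuousLinearMap (Matrix.mulVecLin L)
  refine ⟨‖T‖ * r + (2 * B + 1), fun x hx => ?_⟩
  have hbad : κ x (Metric.closedBall 0 (‖T‖ * r + (2 * B + 1)))ᶜ ≤ 1 / 2 := by
    have h1 := mul_meas_ge_le_lintegral₀ (μ := κ x) (f := fun y => ‖y - L *ᵥ x‖ₑ ^ 1)
      (measurable_enorm_sub_pow _ _).aemeasurable (((2 * B + 1 : NNReal) : ENNReal))
    have h2 : (Metric.closedBall 0 (‖T‖ * r + (2 * B + 1)))ᶜ ⊆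
        {y | ((2 * B + 1 : NNReal) : ENNReal) ≤ ‖y - L *ᵥ x‖ₑ ^ 1} := fun y hy => by
      simp only [Set.mem_compl_iff, Metric.mem_closedBall, dist_zero_right, not_le] at hy
      have h3 : ‖L *ᵥ x‖ ≤ ‖T‖ * r := (T.le_opNorm x).trans (by gcongr)
      have h4 := norm_sub_norm_le y (L *ᵥ x)
      simp only [Set.mem_ofPred_eq, pow_one]
      rw [← enorm_norm, ← ofReal_norm, norm_norm, ← ENNReal.ofReal_coe_nnreal]
      refine ENNReal.ofReal_le_ofReal ?_
      push_cast
      linarith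
    have h5 := (mul_le_mul_right (measure_mono h2) _).trans (h1.trans (hB x))
    by_contra! hlt
    have h6 : (B : ENNReal) < ((2 * B + 1 : NNReal) : ENNReal) * (1 / 2) := by
      have : ((2 * B + 1 : NNReal) : ENNReal) * (1 / 2) = ((B + 1 / 2 : NNReal) : ENNReal) := by
        rw [show (1 / 2 : ENNReal) = ((1 / 2 : NNReal) : ENNReal) by simp, ← ENNReal.coe_mul]
        congr 1
        field_simp
      rw [this]
      exact_mod_cast lt_add_of_pos_right B (by positivity)
    have h7 := (mul_le_mul_right hlt.le ((2 * B + 1 : NNReal) : ENNReal)).trans h5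
    exact absurd (h6.trans_le h7) (lt_irrefl _)
  have h3 := prob_add_prob_compl (μ := κ x)
    (Metric.isClosed_closedBall (x := (0 : ι → ℝ)) (ε := ‖T‖ * r + (2 * B + 1))).measurableSet
  by_contra! hlt
  have h4 : (1 : ENNReal) < 1 / 2 + 1 / 2 := by
    conv_lhs => rw [← h3]
    exact ENNReal.add_lt_add_of_lt_of_le (ne_top_of_le_ne_top (by simp) hbad) hlt hbad
  rw [ENNReal.add_halves] at h4
  exact lt_irrefl _ h4

end DevBound

/-! ### The linear part of the schemes -/

/-- The part of the drift matrix `G` that belongs to a substep. -/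
def Coeffs.partGen (c : Coeffs n m) (Ω : Matrix (Fin n) (Fin n) ℝ) :
    Part → Matrix (XIdx n m) (XIdx n m) ℝ
  | Part.A => Matrix.fromBlocks 0 (Matrix.fromCols (-c.M⁻¹) 0) 0 0
  | Part.B => Matrix.fromBlocks 0 0 (Matrix.fromRows Ω 0) 0
  | Part.O => Matrix.fromBlocks 0 0 0 c.ΓM

/-- The linear part of a substep of length `h`: the substep for the quadratic potential, without
noise. -/
def Coeffs.partLin (c : Coeffs n m) (Ω : Matrix (Fin n) (Fin n) ℝ) :
    Part → ℝ → Matrix (XIdx n m) (XIdx n m) ℝ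
  | Part.A => fun h => 1 - h • c.partGen Ω Part.A
  | Part.B => fun h => 1 - h • c.partGen Ω Part.B
  | Part.O => fun h => Matrix.fromBlocks 1 0 0 (c.F h)

lemma Coeffs.partLin_zero (c : Coeffs n m) (Ω : Matrix (Fin n) (Fin n) ℝ) (P : Part) :
    c.partLin Ω P 0 = 1 := by
  cases P <;> simp [partLin, F]

section Derivative

open scoped Matrix.Norms.Operator

lemma Coeffs.hasDerivAt_partLin (c : Coeffs n m) (Ω : Matrix (Fin n) (Fin n) ℝ) (P : Part) :
    HasDerivAt (c.partLin Ω P) (-c.partGen Ω P) 0 := by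
  have hlin : ∀ G : Matrix (XIdx n m) (XIdx n m) ℝ,
      HasDerivAt (fun h : ℝ => 1 - h • G) (-G) 0 := fun G => by
    have h := ((hasDerivAt_id (0 : ℝ)).smul_const G).const_sub 1
    rw [one_smul] at h
    exact h
  cases P with
  | A => exact hlin _
  | B => exact hlin _
  | O =>
    have h := hasDerivAt_exp_neg_smul c.ΓM 0
    rw [zero_smul, neg_zero, NormedSpace.exp_zero, mul_one] at h
    let T : Matrix (ZIdx n m) (ZIdx n m) ℝ →ₗ[ℝ] Matrix (XIdx n m) (XIdx n m) ℝ :=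
      { toFun := fun A => Matrix.fromBlocks 0 0 0 A
        map_add' := fun A B => by rw [Matrix.fromBlocks_add]; simp
        map_smul' := fun r A => by simp [Matrix.fromBlocks_smul] }
    have h2 := ((LinearMap.toContinuousLinearMap T).hasFDerivAt.comp_hasDerivAt
      (0 : ℝ) h).const_add (Matrix.fromBlocks 1 0 0 0)
    have e1 : c.partLin Ω Part.O = fun h => Matrix.fromBlocks 1 0 0 0 +
        (LinearMap.toContinuousLinearMap T) (NormedSpace.exp (-(h • c.ΓM))) := by
      funext h
      simp [T, partLin, F, Matrix.fromBlocks_add]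
    have e2 : -c.partGen Ω Part.O = (LinearMap.toContinuousLinearMap T) (-c.ΓM) := by
      rw [map_neg]
      rfl
    rw [e1, e2]
    exact h2

/-- The linear part of one step of the scheme. -/
def Coeffs.schemeLin (c : Coeffs n m) (Ω : Matrix (Fin n) (Fin n) ℝ) (X Y Z : Part) (h : ℝ) :
    Matrix (XIdx n m) (XIdx n m) ℝ :=
  c.partLin Ω X (h / 2) * (c.partLin Ω Y (h / 2) * (c.partLin Ω Z h *
    (c.partLin Ω Y (h / 2) * c.partLin Ω X (h / 2))))

lemma Coeffs.partGen_add (c : Coeffs n m) (Ω : Matrix (Fin n) (Fin n) ℝ) {X Y Z : Part}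
    (hXY : X ≠ Y) (hXZ : X ≠ Z) (hYZ : Y ≠ Z) :
    c.partGen Ω X + c.partGen Ω Y + c.partGen Ω Z = c.G Ω := by
  have h : c.partGen Ω Part.A + c.partGen Ω Part.B + c.partGen Ω Part.O = c.G Ω := by
    simp [partGen, G, Matrix.fromBlocks_add]
  cases X <;> cases Y <;> cases Z <;>
    first
    | exact absurd rfl hXY
    | exact absurd rfl hXZ
    | exact absurd rfl hYZ
    | (rw [← h] <;> abel)

/-- The scheme is consistent: to first order in `h`, the linear part of a step is that of the
equation. -/
lemma Coeffs.hasDerivAt_schemeLin (c : Coeffs n m) (Ω : Matrix (Fin n) (Fin n) ℝ) {X Y Z : Part}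
    (hXY : X ≠ Y) (hXZ : X ≠ Z) (hYZ : Y ≠ Z) :
    HasDerivAt (c.schemeLin Ω X Y Z) (-c.G Ω) 0 := by
  have hhalf : ∀ P, HasDerivAt (fun h : ℝ => c.partLin Ω P (h / 2))
      ((1 / 2 : ℝ) • -c.partGen Ω P) 0 := fun P => by
    have h1 : HasDerivAt (fun h : ℝ => h / 2) (1 / 2) 0 := (hasDerivAt_id (0 : ℝ)).div_const 2
    have h2 : HasDerivAt (c.partLin Ω P) (-c.partGen Ω P) (0 / 2) := by
      rw [zero_div]; exact c.hasDerivAt_partLin Ω P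
    exact h2.scomp (0 : ℝ) h1
  have h := (hhalf X).mul ((hhalf Y).mul ((c.hasDerivAt_partLin Ω Z).mul
    ((hhalf Y).mul (hhalf X))))
  refine HasDerivAt.congr_deriv h ?_
  simp only [Pi.mul_apply, zero_div, c.partLin_zero, mul_one, one_mul]
  rw [← c.partGen_add Ω hXY hXZ hYZ]
  module

end Derivative

lemma Coeffs.exists_contraction (c : Coeffs n m) {Ω : Matrix (Fin n) (Fin n) ℝ}
    {C : Matrix (XIdx n m) (XIdx n m) ℝ} (hC : c.IsWeightMatrix Ω C) {X Y Z : Part}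
    (hXY : X ≠ Y) (hXZ : X ≠ Z) (hYZ : Y ≠ Z) :
    ∃ h₀ : ℝ, 0 < h₀ ∧ ∀ h, 0 < h → h < h₀ → ∃ ρ : ℝ, 0 ≤ ρ ∧ ρ < 1 ∧ ∀ x,
      (c.schemeLin Ω X Y Z h *ᵥ x) ⬝ᵥ C *ᵥ (c.schemeLin Ω X Y Z h *ᵥ x) ≤
        ρ * (x ⬝ᵥ C *ᵥ x) :=
  exists_contraction_of_hasDerivAt hC.1 hC.2 (by simp [schemeLin, c.partLin_zero])
    (c.hasDerivAt_schemeLin Ω hXY hXZ hYZ)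

/-! ### The transition kernels are close to linear maps -/

instance (c : Coeffs n m) (U : (Fin n → ℝ) → ℝ) (S : ℝ → Matrix (ZIdx n m) (ZIdx n m) ℝ) (h : ℝ)
    (P : Part) : IsMarkovKernel (c.partKernel U S h P) := by
  cases P <;> (unfold Coeffs.partKernel; infer_instance)

instance (c : Coeffs n m) (U : (Fin n → ℝ) → ℝ) (S : ℝ → Matrix (ZIdx n m) (ZIdx n m) ℝ)
    (X Y Z : Part) (h : ℝ) : IsMarkovKernel (c.schemeKernel U S X Y Z h) := by
  unfold Coeffs.schemeKernel
  infer_instance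

section Potential

variable {U U₂ : (Fin n → ℝ) → ℝ} {Ω : Matrix (Fin n) (Fin n) ℝ}

lemma PotentialAssumption.grad_eq (hU : PotentialAssumption U Ω U₂) (q : Fin n → ℝ) :
    grad U q = Ω *ᵥ q + grad U₂ q := by
  have e : U = quadPotential Ω + U₂ := funext hU.eq_add
  funext i
  have h1 := pd_quadPotential hU.Ω_posDef.isSymm i q
  simp only [grad, Pi.add_apply]
  rw [← h1, e, pd, fderiv_add (differentiable_quadPotential Ω q)
    (hU.smooth.differentiable (by simp) q)]
  rfl

/-- The nonlinear part of the force is bounded. -/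
lemma PotentialAssumption.exists_norm_grad_le (hU : PotentialAssumption U Ω U₂) :
    ∃ D : ℝ, 0 ≤ D ∧ ∀ q, ‖grad U₂ q‖ ≤ D := by
  have h : ∀ i : Fin n, ∃ b : ℝ, ∀ q, |pd i U₂ q| ≤ b := fun i => by
    obtain ⟨b, hb⟩ := hU.bounded 1 le_rfl (fun _ => i)
    refine ⟨b, fun q => ?_⟩
    have := hb q
    rwa [iteratedFDeriv_one_apply] at this
  choose b hb using h
  refine ⟨∑ i, |b i|, Finset.sum_nonneg fun i _ => abs_nonneg _, fun q => ?_⟩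
  rw [pi_norm_le_iff_of_nonneg (Finset.sum_nonneg fun i _ => abs_nonneg _)]
  exact fun i => ((hb i q).trans (le_abs_self _)).trans
    (Finset.single_le_sum (f := fun i => |b i|) (fun j _ => abs_nonneg _) (Finset.mem_univ i))

lemma norm_le_of_abs_apply_single_le {ι : Type*} [Fintype ι] [DecidableEq ι]
    {T : (ι → ℝ) →L[ℝ] ℝ} {b : ι → ℝ} (h : ∀ i, |T (Pi.single i 1)| ≤ b i) :
    ‖T‖ ≤ ∑ i, b i := by
  have hb : ∀ i, 0 ≤ b i := fun i => (abs_nonneg _).trans (h i)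
  refine T.opNorm_le_bound (Finset.sum_nonneg fun i _ => hb i) fun x => ?_
  have e : T x = ∑ i, x i * T (Pi.single i 1) := by
    conv_lhs => rw [pi_eq_sum_univ' x]
    simp [map_sum]
  rw [e, Finset.sum_mul]
  refine (norm_sum_le _ _).trans (Finset.sum_le_sum fun i _ => ?_)
  rw [norm_mul, mul_comm]
  exact mul_le_mul (h i) (norm_le_pi_norm x i) (norm_nonneg _) (hb i)

/-- The force is globally Lipschitz. -/
lemma PotentialAssumption.exists_lipschitzWith_grad (hU : PotentialAssumption U Ω U₂) :
    ∃ K : NNReal, LipschitzWith K (grad U) := by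
  have hsmooth : ContDiff ℝ 1 (fderiv ℝ U₂) :=
    (contDiff_infty.1 hU.smooth 2).fderiv_right (by norm_num)
  have h2 : ∀ i j : Fin n, ∃ b : ℝ, ∀ q, |fderiv ℝ (pd i U₂) q (Pi.single j 1)| ≤ b := fun i j => by
    obtain ⟨b, hb⟩ := hU.bounded 2 (by norm_num) ![j, i]
    refine ⟨b, fun q => ?_⟩
    have h3 := hb q
    rw [iteratedFDeriv_two_apply] at h3
    have hd : DifferentiableAt ℝ (fderiv ℝ U₂) q :=
      hsmooth.differentiable (by simp) q
    have e : fderiv ℝ (pd i U₂) q (Pi.single j 1) =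
        fderiv ℝ (fderiv ℝ U₂) q (Pi.single j 1) (Pi.single i 1) := by
      have h4 := hd.hasFDerivAt.clm_apply (hasFDerivAt_const (Pi.single i (1 : ℝ)) q)
      have h5 : fderiv ℝ (pd i U₂) q = _ := h4.fderiv
      rw [h5]
      simp
    rw [e]
    simpa using h3
  choose b hb using h2
  have hdiff : ∀ i, Differentiable ℝ (pd i U₂) := fun i =>
    (hsmooth.clm_apply contDiff_const).differentiable (by simp)
  have hpd : ∀ i, LipschitzWith (∑ j, |b i j|).toNNReal (pd i U₂) := fun i => by
    refine lipschitzWith_of_nnnorm_fderiv_le (hdiff i) fun q => ?_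
    rw [← NNReal.coe_le_coe, coe_nnnorm, Real.coe_toNNReal _
      (Finset.sum_nonneg fun j _ => abs_nonneg _)]
    exact norm_le_of_abs_apply_single_le fun j => (hb i j q).trans (le_abs_self _)
  have hg : LipschitzWith (∑ i, (∑ j, |b i j|).toNNReal) (grad U₂) := by
    refine LipschitzWith.of_dist_le_mul fun q q' => ?_
    rw [dist_pi_le_iff (by positivity)]
    intro i
    refine ((hpd i).dist_le_mul q q').trans ?_
    gcongr
    exact Finset.single_le_sum (f := fun i => (∑ j, |b i j|).toNNReal)
      (fun j _ => zero_le) (Finset.mem_univ i)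
  let T : (Fin n → ℝ) →L[ℝ] (Fin n → ℝ) := LinearMap.toContinuousLinearMap (Matrix.mulVecLin Ω)
  have e : grad U = fun q => T q + grad U₂ q := funext hU.grad_eq
  rw [e]
  exact ⟨_, T.lipschitz.add hg⟩

end Potential

section Deviation

lemma Coeffs.partLin_A_mulVec (c : Coeffs n m) (Ω : Matrix (Fin n) (Fin n) ℝ) (h : ℝ)
    (x : State n m) : c.partLin Ω Part.A h *ᵥ x = c.flowA h x := by
  rw [partLin, Matrix.sub_mulVec, Matrix.one_mulVec, Matrix.smul_mulVec, partGen,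
    Matrix.fromBlocks_mulVec]
  ext (i | i | j)
  · simp [flowA, mkState3, mkState, qPart, pPart_def, Matrix.neg_mulVec, Function.comp_def]
  · simp [flowA, mkState3, mkState, pPart]
  · simp [flowA, mkState3, mkState, sPart]

lemma Coeffs.partLin_B_mulVec (c : Coeffs n m) (Ω : Matrix (Fin n) (Fin n) ℝ) (h : ℝ)
    (x : State n m) : c.partLin Ω Part.B h *ᵥ x =
      mkState3 (qPart x) (pPart x - h • (Ω *ᵥ qPart x)) (sPart x) := by
  rw [partLin, Matrix.sub_mulVec, Matrix.one_mulVec, Matrix.smul_mulVec, partGen,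
    Matrix.fromBlocks_mulVec]
  ext (i | i | j)
  · simp [mkState3, mkState, qPart]
  · simp [mkState3, mkState, pPart, qPart_def, Matrix.mulVec, dotProduct]
  · simp [mkState3, mkState, sPart]

lemma Coeffs.partLin_O_mulVec (c : Coeffs n m) (Ω : Matrix (Fin n) (Fin n) ℝ) (h : ℝ)
    (x : State n m) : c.partLin Ω Part.O h *ᵥ x = mkState (qPart x) (c.F h *ᵥ zPart x) := by
  rw [partLin, Matrix.fromBlocks_mulVec]
  ext (i | i)
  · simp [mkState, qPart]
  · simp [mkState, zPart_def, Function.comp_def]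

lemma norm_mkState_le (q : Fin n → ℝ) (z : ZIdx n m → ℝ) : ‖mkState q z‖ ≤ max ‖q‖ ‖z‖ := by
  rw [pi_norm_le_iff_of_nonneg (le_max_of_le_left (norm_nonneg _))]
  rintro (i | i)
  · exact (norm_le_pi_norm q i).trans (le_max_left _ _)
  · exact (norm_le_pi_norm z i).trans (le_max_right _ _)

/-- The law after an O-step. -/
lemma Coeffs.partKernel_O_apply (c : Coeffs n m) (U : (Fin n → ℝ) → ℝ)
    (S : ℝ → Matrix (ZIdx n m) (ZIdx n m) ℝ) (h : ℝ) (x : State n m) :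
    c.partKernel U S h Part.O x =
      (stdNormal n m).map fun R => mkState (qPart x) (c.F h *ᵥ zPart x + S h *ᵥ R) := by
  rw [partKernel, Kernel.deterministic_comp_eq_map,
    Kernel.map_apply _ (c.measurable_flowO S h), Kernel.prod_apply, Kernel.id_apply,
    Kernel.const_apply, Measure.dirac_prod, Measure.map_map (c.measurable_flowO S h) (by fun_prop)]
  rfl

lemma exists_moment_stdNormal (n m k : ℕ) :
    ∃ B : NNReal, ∫⁻ R : ZIdx n m → ℝ, ‖R‖ₑ ^ k ∂(stdNormal n m) ≤ B := by
  have h1 : ∀ i, ∫⁻ R : ZIdx n m → ℝ, ‖R i‖ₑ ^ k ∂(stdNormal n m) =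
      ∫⁻ t, ‖t‖ₑ ^ k ∂(gaussianReal 0 1) := fun i => by
    have := (measurePreserving_eval (fun _ : ZIdx n m => gaussianReal 0 1) i).lintegral_comp
      (f := fun t : ℝ => ‖t‖ₑ ^ k) (by fun_prop)
    exact this
  have h2 : ∫⁻ t, ‖t‖ₑ ^ k ∂(gaussianReal 0 1) ≠ ⊤ := by
    have := ((memLp_id_gaussianReal' (μ := 0) (v := 1) k (by simp)).integrable_norm_pow').2
    simpa [hasFiniteIntegral_iff_enorm, enorm_pow] using this.ne
  have h3 : ∀ R : ZIdx n m → ℝ, ‖R‖ₑ ^ k ≤ 1 + ∑ i, ‖R i‖ₑ ^ k := fun R => by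
    rcases isEmpty_or_nonempty (ZIdx n m) with he | hne
    · have : R = 0 := Subsingleton.elim _ _
      rw [this]
      simp only [enorm_zero]
      exact (pow_le_one₀ (by simp) (by simp)).trans le_self_add
    · obtain ⟨i, hi⟩ := Finite.exists_max fun i => ‖R i‖
      have h4 : ‖R‖ₑ ≤ ‖R i‖ₑ := by
        rw [← ofReal_norm, ← ofReal_norm]
        exact ENNReal.ofReal_le_ofReal ((pi_norm_le_iff_of_nonneg (norm_nonneg _)).2 hi)
      calc ‖R‖ₑ ^ k ≤ ‖R i‖ₑ ^ k := by gcongr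
        _ ≤ ∑ i, ‖R i‖ₑ ^ k := Finset.single_le_sum (f := fun i => ‖R i‖ₑ ^ k)
            (fun j _ => zero_le) (Finset.mem_univ i)
        _ ≤ _ := le_add_self
  have h5 : ∫⁻ R : ZIdx n m → ℝ, ‖R‖ₑ ^ k ∂(stdNormal n m) ≠ ⊤ := by
    refine ne_top_of_le_ne_top ?_ (lintegral_mono h3)
    rw [lintegral_add_left measurable_const, lintegral_finsetSum _ fun i _ => by fun_prop]
    simp only [h1]
    simp [ENNReal.mul_eq_top, h2]
  exact ⟨_, (ENNReal.coe_toNNReal h5).ge⟩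

lemma Coeffs.devBound_partKernel (c : Coeffs n m) {U U₂ : (Fin n → ℝ) → ℝ}
    {Ω : Matrix (Fin n) (Fin n) ℝ} (hU : PotentialAssumption U Ω U₂)
    (S : ℝ → Matrix (ZIdx n m) (ZIdx n m) ℝ) (h : ℝ) (P : Part) :
    DevBound (c.partKernel U S h P) (c.partLin Ω P h) := by
  cases P with
  | A =>
    refine DevBound.deterministic (D := 0) (c.measurable_flowA h) fun x => ?_
    rw [c.partLin_A_mulVec]
    simp
  | B =>
    obtain ⟨D, hD, hDle⟩ := hU.exists_norm_grad_le
    refine DevBound.deterministic (D := |h| * D) (measurable_flowB U h) fun x => ?_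
    have e : flowB U h x - c.partLin Ω Part.B h *ᵥ x =
        mkState3 0 (-(h • grad U₂ (qPart x))) 0 := by
      rw [c.partLin_B_mulVec, flowB, hU.grad_eq]
      ext (i | i | j)
      · simp [mkState3, mkState]
      · simp [mkState3, mkState]
      · simp [mkState3, mkState]
    rw [e, pi_norm_le_iff_of_nonneg (by positivity)]
    rintro (i | i | j)
    · simp [mkState3, mkState]
      positivity
    · simp only [mkState3, mkState, Sum.elim_inr, Sum.elim_inl, Pi.neg_apply, Pi.smul_apply,
        norm_neg, norm_smul, Real.norm_eq_abs h]
      gcongr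
      exact (norm_le_pi_norm _ i).trans (hDle _)
    · simp [mkState3, mkState]
      positivity
  | O =>
    intro k
    obtain ⟨B, hB⟩ := exists_moment_stdNormal n m k
    let T : (ZIdx n m → ℝ) →L[ℝ] (ZIdx n m → ℝ) :=
      LinearMap.toContinuousLinearMap (Matrix.mulVecLin (S h))
    refine ⟨‖T‖₊ ^ k * B, fun x => ?_⟩
    have hm : Measurable fun R => mkState (qPart x) (c.F h *ᵥ zPart x + S h *ᵥ R) :=
      measurable_mkState measurable_const ((measurable_mulVec _).const_add _)
    rw [c.partKernel_O_apply, lintegral_map (measurable_enorm_sub_pow _ _) hm]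
    have hpt : ∀ R, ‖mkState (qPart x) (c.F h *ᵥ zPart x + S h *ᵥ R) -
        c.partLin Ω Part.O h *ᵥ x‖ₑ ^ k ≤ ‖T‖ₑ ^ k * ‖R‖ₑ ^ k := fun R => by
      have e : mkState (qPart x) (c.F h *ᵥ zPart x + S h *ᵥ R) - c.partLin Ω Part.O h *ᵥ x =
          mkState 0 (T R) := by
        rw [c.partLin_O_mulVec]
        ext (i | i) <;> simp [mkState, T]
      rw [e, ← mul_pow]
      gcongr
      refine le_trans ?_ (T.le_opENorm R)
      rw [← ofReal_norm, ← ofReal_norm]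
      refine ENNReal.ofReal_le_ofReal ((norm_mkState_le _ _).trans ?_)
      simp
    refine (lintegral_mono hpt).trans ?_
    rw [lintegral_const_mul _ (by fun_prop)]
    push_cast
    exact mul_le_mul' le_rfl hB

lemma Coeffs.devBound_schemeKernel (c : Coeffs n m) {U U₂ : (Fin n → ℝ) → ℝ}
    {Ω : Matrix (Fin n) (Fin n) ℝ} (hU : PotentialAssumption U Ω U₂)
    (S : ℝ → Matrix (ZIdx n m) (ZIdx n m) ℝ) (X Y Z : Part) (h : ℝ) :
    DevBound (c.schemeKernel U S X Y Z h) (c.schemeLin Ω X Y Z h) := by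
  have hP := c.devBound_partKernel hU S
  have := (hP (h / 2) X).comp ((hP (h / 2) Y).comp ((hP h Z).comp
    ((hP (h / 2) Y).comp (hP (h / 2) X))))
  simpa only [schemeKernel, schemeLin, Kernel.comp_assoc] using this

end Deviation

/-! ### Density bounds for the noise -/

section NormalDensity

/-- A measure is dominated by a product measure if it is so on boxes, since the product measure
comes from the largest outer measure with the given bound on boxes. -/
lemma le_pi_of_le_box {ι : Type*} [Fintype ι] {μ : ι → Measure ℝ} [∀ i, SigmaFinite (μ i)]
    {ν : Measure (ι → ℝ)} (h : ∀ s : ι → Set ℝ, ν (Set.univ.pi s) ≤ ∏ i, μ i (s i)) :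
    ν ≤ Measure.pi μ := by
  have h1 : ν.toOuterMeasure ≤ OuterMeasure.pi fun i => (μ i).toOuterMeasure :=
    OuterMeasure.le_pi.2 fun s _ => h s
  refine Measure.le_iff.2 fun E hE => ?_
  rw [Measure.pi, toMeasure_apply _ _ hE]
  exact h1 E

lemma gaussianReal_le_volume : gaussianReal 0 1 ≤ (volume : Measure ℝ) := by
  rw [gaussianReal_of_var_ne_zero _ one_ne_zero]
  conv_rhs => rw [← withDensity_one (μ := (volume : Measure ℝ))]
  refine withDensity_mono (Filter.Eventually.of_forall fun t => ?_)
  rw [gaussianPDF, Pi.one_apply, ENNReal.ofReal_le_one, gaussianPDFReal]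
  refine mul_le_one₀ (inv_le_one_of_one_le₀ ?_) (Real.exp_pos _).le (Real.exp_le_one_iff.2 ?_)
  · rw [Real.one_le_sqrt]
    have := Real.pi_gt_three
    simp
    linarith
  · simp only [NNReal.coe_one, sub_zero, mul_one]
    have := sq_nonneg t
    rw [neg_div]
    linarith

lemma stdNormal_le_volume (n m : ℕ) : stdNormal n m ≤ volume := by
  rw [volume_pi]
  refine le_pi_of_le_box fun s => ?_
  rw [stdNormal, Measure.pi_pi]
  exact Finset.prod_le_prod' fun i _ => gaussianReal_le_volume _

lemma exists_mul_le_gaussianReal (r : ℝ) :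
    ∃ ε : NNReal, 0 < ε ∧ ∀ s : Set ℝ,
      ε * volume (s ∩ Metric.closedBall 0 r) ≤ gaussianReal 0 1 s := by
  let δ : ℝ := (√(2 * Real.pi * (1 : NNReal)))⁻¹ * Real.exp (-r ^ 2 / 2)
  have hδ : 0 < δ := by
    have := Real.pi_pos
    simp only [δ]
    positivity
  refine ⟨δ.toNNReal, Real.toNNReal_pos.2 hδ, fun s => ?_⟩
  rw [gaussianReal_apply _ one_ne_zero]
  refine le_trans ?_ (lintegral_mono_set (Set.inter_subset_left (t := Metric.closedBall 0 r)))
  rw [← setLIntegral_const]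
  refine setLIntegral_mono (measurable_gaussianPDF 0 1) fun t ht => ENNReal.ofReal_le_ofReal ?_
  have h1 : |t| ≤ r := by simpa using ht.2
  have h2 : t ^ 2 ≤ r ^ 2 := sq_le_sq' (by linarith [neg_abs_le t]) ((le_abs_self t).trans h1)
  simp only [δ, gaussianPDFReal, sub_zero, NNReal.coe_one, mul_one]
  gcongr

lemma exists_smul_restrict_le_stdNormal (n m : ℕ) {r : ℝ} (hr : 0 ≤ r) :
    ∃ ε : NNReal, 0 < ε ∧
      (ε : ENNReal) • volume.restrict (Metric.closedBall 0 r) ≤ stdNormal n m := by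
  obtain ⟨ε, hε, h⟩ := exists_mul_le_gaussianReal r
  refine ⟨ε ^ Fintype.card (ZIdx n m), by positivity, le_pi_of_le_box fun s => ?_⟩
  rw [Measure.smul_apply, Measure.restrict_apply' measurableSet_closedBall, closedBall_pi _ hr,
    ← Set.pi_inter_distrib, volume_pi_pi, smul_eq_mul]
  push_cast
  rw [← Finset.card_univ, ← Finset.prod_const, ← Finset.prod_mul_distrib]
  exact Finset.prod_le_prod' fun i _ => h (s i)

end NormalDensity

section AffineNormal

variable {n m : ℕ} {T : Matrix (ZIdx n m) (ZIdx n m) ℝ}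

lemma volume_preimage_affine (hT : IsUnit T.det) (v : ZIdx n m → ℝ) {E : Set (ZIdx n m → ℝ)}
    (hE : MeasurableSet E) :
    volume ((fun R => v + T *ᵥ R) ⁻¹' E) = ENNReal.ofReal |T.det⁻¹| * volume E := by
  have h1 := Real.map_matrix_volume_pi_eq_smul_volume_pi hT.ne_zero
  have h2 : MeasurableSet ((fun w => v + w) ⁻¹' E) := measurable_const_add v hE
  have h3 := congrArg (fun μ => μ ((fun w => v + w) ⁻¹' E)) h1
  simp only [Measure.smul_apply, smul_eq_mul, measure_preimage_add] at h3
  rw [← h3, Measure.map_apply (by exact measurable_mulVec T) h2]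
  rfl

lemma map_affine_stdNormal_absolutelyContinuous (hT : IsUnit T.det) (v : ZIdx n m → ℝ) :
    (stdNormal n m).map (fun R => v + T *ᵥ R) ≪ volume := by
  refine Measure.AbsolutelyContinuous.mk fun E hE h0 => ?_
  rw [Measure.map_apply ((measurable_mulVec T).const_add v) hE]
  refine le_antisymm ((stdNormal_le_volume n m _).trans ?_) zero_le
  rw [volume_preimage_affine hT v hE, h0, mul_zero]

/-- A nondegenerate Gaussian law dominates a multiple of Lebesgue measure on a ball, uniformly for
bounded means. -/
lemma exists_smul_restrict_le_map_affine (hT : IsUnit T.det) (r : ℝ) {ρ : ℝ} (hρ : 0 ≤ ρ) :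
    ∃ ε : NNReal, 0 < ε ∧ ∀ v : ZIdx n m → ℝ, ‖v‖ ≤ r →
      (ε : ENNReal) • volume.restrict (Metric.closedBall 0 ρ) ≤
        (stdNormal n m).map fun R => v + T *ᵥ R := by
  let L : (ZIdx n m → ℝ) →L[ℝ] (ZIdx n m → ℝ) :=
    LinearMap.toContinuousLinearMap (Matrix.mulVecLin T⁻¹)
  obtain ⟨ε, hε, h⟩ := exists_smul_restrict_le_stdNormal n m
    (r := ‖L‖ * (ρ + |r|)) (by positivity)
  have hd : 0 < |T.det⁻¹| := abs_pos.2 (inv_ne_zero hT.ne_zero)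
  refine ⟨ε * |T.det⁻¹|.toNNReal, mul_pos hε (Real.toNNReal_pos.2 hd), fun v hv =>
    Measure.le_iff.2 fun E hE => ?_⟩
  have hball : MeasurableSet (Metric.closedBall (0 : ZIdx n m → ℝ) ρ) := measurableSet_closedBall
  rw [Measure.map_apply ((measurable_mulVec T).const_add v) hE]
  refine le_trans ?_ (h _)
  rw [Measure.smul_apply, Measure.smul_apply, Measure.restrict_apply hE,
    Measure.restrict_apply (((measurable_mulVec T).const_add v) hE), smul_eq_mul, smul_eq_mul,
    ENNReal.coe_mul, mul_assoc]
  gcongr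
  change ENNReal.ofReal _ * _ ≤ _
  rw [← volume_preimage_affine hT v (hE.inter hball)]
  refine measure_mono fun R hR => ⟨hR.1, ?_⟩
  have e : R = L ((v + T *ᵥ R) - v) := by
    simp [L, Matrix.nonsing_inv_mul _ hT]
  rw [mem_closedBall_zero_iff, e]
  refine (L.le_opNorm _).trans ?_
  gcongr
  refine (norm_sub_le _ _).trans (add_le_add (mem_closedBall_zero_iff.1 hR.2) ?_)
  exact hv.trans (le_abs_self r)

end AffineNormal

/-! ### Lipschitz maps and Lebesgue measure -/

section Lipschitz

variable {ι : Type*} [Fintype ι] {f : (ι → ℝ) → ι → ℝ} {K : NNReal}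

/-- A Lipschitz map onto the space does not increase volumes by more than a constant factor, so
that Lebesgue measure is dominated by a multiple of its image. -/
lemma lintegral_le_of_lipschitz_surjective (hf : LipschitzWith K f)
    (hs : Function.Surjective f) {g : (ι → ℝ) → ENNReal} (hg : Measurable g) :
    ∫⁻ y, g y ≤ (K : ENNReal) ^ Fintype.card ι * ∫⁻ x, g (f x) := by
  have hfm : Measurable f := hf.continuous.measurable
  have h : (volume : Measure (ι → ℝ)) ≤
      (K : ENNReal) ^ Fintype.card ι • (volume : Measure (ι → ℝ)).map f := by
    refine Measure.le_iff.2 fun E hE => ?_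
    rw [Measure.smul_apply, Measure.map_apply hfm hE, smul_eq_mul]
    have h1 := hf.hausdorffMeasure_image_le (d := Fintype.card ι) (Nat.cast_nonneg _) (f ⁻¹' E)
    rw [Set.image_preimage_eq _ hs, hausdorffMeasure_pi_real, ENNReal.rpow_natCast] at h1
    exact h1
  refine (lintegral_mono' h le_rfl).trans ?_
  rw [lintegral_smul_measure, lintegral_map hg hfm, smul_eq_mul]

lemma quasiMeasurePreserving_of_antilipschitz (hfm : Measurable f) (hf : AntilipschitzWith K f) :
    Measure.QuasiMeasurePreserving f volume volume := by
  refine ⟨hfm, Measure.AbsolutelyContinuous.mk fun E hE h0 => ?_⟩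
  rw [Measure.map_apply hfm hE]
  have h1 := hf.hausdorffMeasure_preimage_le (d := Fintype.card ι) (Nat.cast_nonneg _) E
  rw [hausdorffMeasure_pi_real, h0, mul_zero] at h1
  exact le_antisymm h1 zero_le

lemma antilipschitzWith_of_leftInverse {α β : Type*} [PseudoEMetricSpace α]
    [PseudoEMetricSpace β] {f : α → β} {g : β → α} {K : NNReal} (hg : LipschitzWith K g)
    (h : Function.LeftInverse g f) : AntilipschitzWith K f := fun x y => by
  have := hg (f x) (f y)
  rwa [h x, h y] at this

end Lipschitz

/-! ### Two noise substeps separated by a mixing map -/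

section TwoNoiseSteps

lemma measurable_mkState_right (q : Fin n → ℝ) :
    Measurable fun z : ZIdx n m → ℝ => (mkState q z : State n m) :=
  measurable_mkState measurable_const measurable_id

lemma measurePreserving_mkState :
    MeasurePreserving (fun y : (Fin n → ℝ) × (ZIdx n m → ℝ) => (mkState y.1 y.2 : State n m))
      (volume.prod volume) volume := by
  have h := volume_measurePreserving_sumPiEquivProdPi_symm (fun _ : XIdx n m => ℝ)
  have e : (fun y : (Fin n → ℝ) × (ZIdx n m → ℝ) => (mkState y.1 y.2 : State n m)) =
      (MeasurableEquiv.sumPiEquivProdPi fun _ : XIdx n m => ℝ).symm := by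
    funext y i
    cases i <;> rfl
  rw [e]
  exact h

/-- Almost every `q`-slice of a null set is null. -/
lemma ae_volume_slice_eq_zero {E : Set (State n m)} (hE : MeasurableSet E) (h0 : volume E = 0) :
    ∀ᵐ q : Fin n → ℝ, volume {z | (mkState q z : State n m) ∈ E} = 0 := by
  have h1 := (measurePreserving_mkState (n := n) (m := m)).measure_preimage hE.nullMeasurableSet
  rw [h0] at h1
  exact Measure.measure_ae_null_of_prod_null h1

lemma quasiMeasurePreserving_inl {ι κ : Type*} [Fintype ι] [Fintype κ] :
    Measure.QuasiMeasurePreserving (fun z : ι ⊕ κ → ℝ => fun i : ι => z (Sum.inl i))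
      volume volume :=
  Measure.quasiMeasurePreserving_fst.comp
    (volume_measurePreserving_sumPiEquivProdPi (fun _ : ι ⊕ κ => ℝ)).quasiMeasurePreserving

variable {c : Coeffs n m} {U : (Fin n → ℝ) → ℝ} {S : ℝ → Matrix (ZIdx n m) (ZIdx n m) ℝ}

variable (c S) in
/-- The law of `F_h z + S_h R`. -/
def Coeffs.noiseLaw (h : ℝ) (z : ZIdx n m → ℝ) : Measure (ZIdx n m → ℝ) :=
  (stdNormal n m).map fun R => c.F h *ᵥ z + S h *ᵥ R

lemma Coeffs.partKernel_O_eq_map {h : ℝ} (x : State n m) :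
    c.partKernel U S h Part.O x = (c.noiseLaw S h (zPart x)).map fun z => mkState (qPart x) z := by
  have hm : Measurable fun R => c.F h *ᵥ zPart x + S h *ᵥ R := (measurable_mulVec _).const_add _
  rw [c.partKernel_O_apply, noiseLaw,
    Measure.map_map (measurable_mkState_right _) hm]
  rfl

lemma Coeffs.partKernel_O_apply_set {h : ℝ} (x : State n m) {E : Set (State n m)}
    (hE : MeasurableSet E) :
    c.partKernel U S h Part.O x E =
      c.noiseLaw S h (zPart x) {z | (mkState (qPart x) z : State n m) ∈ E} := by
  rw [c.partKernel_O_eq_map,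
    Measure.map_apply (measurable_mkState_right _) hE]
  rfl

lemma Coeffs.noiseLaw_absolutelyContinuous {h : ℝ} (hS : IsUnit (S h).det) (z : ZIdx n m → ℝ) :
    c.noiseLaw S h z ≪ volume :=
  map_affine_stdNormal_absolutelyContinuous hS _

lemma Coeffs.exists_smul_restrict_le_noiseLaw {h : ℝ} (hS : IsUnit (S h).det) (r : ℝ) {ρ : ℝ}
    (hρ : 0 ≤ ρ) : ∃ ε : NNReal, 0 < ε ∧ ∀ z : ZIdx n m → ℝ, ‖z‖ ≤ r →
      (ε : ENNReal) • volume.restrict (Metric.closedBall 0 ρ) ≤ c.noiseLaw S h z := by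
  let L : (ZIdx n m → ℝ) →L[ℝ] (ZIdx n m → ℝ) :=
    LinearMap.toContinuousLinearMap (Matrix.mulVecLin (c.F h))
  obtain ⟨ε, hε, H⟩ := exists_smul_restrict_le_map_affine hS (‖L‖ * r) hρ
  refine ⟨ε, hε, fun z hz => H _ ?_⟩
  exact (L.le_opNorm z).trans (by gcongr)

/-- A deterministic map in which, for fixed `q`, the new position is a bi-Lipschitz function of
the momentum onto `ℝⁿ`, with constants independent of `q`. Noise in `z` before the map and noise
in `z` after it then reach every coordinate. -/
structure IsMixing (D : State n m → State n m) : Prop where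
  lipschitz : ∃ K : NNReal, LipschitzWith K D
  position : ∃ (φ : (Fin n → ℝ) → (Fin n → ℝ) → Fin n → ℝ) (K K' : NNReal),
    (∀ q z, qPart (D (mkState q z)) = φ q fun i => z (Sum.inl i)) ∧
    ∀ q, LipschitzWith K (φ q) ∧ AntilipschitzWith K' (φ q) ∧ Function.Surjective (φ q)

lemma IsMixing.measurable {D : State n m → State n m} (hD : IsMixing D) : Measurable D := by
  obtain ⟨K, hK⟩ := hD.lipschitz
  exact hK.continuous.measurable

lemma Coeffs.twoNoise_apply {s t : ℝ} {D : State n m → State n m} (hD : Measurable D)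
    (x : State n m) {E : Set (State n m)} (hE : MeasurableSet E) :
    (c.partKernel U S s Part.O ∘ₖ Kernel.deterministic D hD ∘ₖ c.partKernel U S t Part.O) x E =
      ∫⁻ w, c.partKernel U S s Part.O (D (mkState (qPart x) w)) E ∂(c.noiseLaw S t (zPart x)) := by
  have hk : Measurable fun y => c.partKernel U S s Part.O (D y) E :=
    (Kernel.measurable_coe _ hE).comp hD
  rw [Kernel.comp_apply' _ _ _ hE, Kernel.comp_deterministic_eq_comap]
  simp only [Kernel.comap_apply]
  rw [c.partKernel_O_eq_map, lintegral_map hk (measurable_mkState_right _)]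

/-- The second noise substep makes the law absolutely continuous in `z` for given position, and the
position is absolutely continuous by the first noise substep and the mixing map. -/
lemma Coeffs.twoNoise_absolutelyContinuous {s t : ℝ} (hs : IsUnit (S s).det)
    (ht : IsUnit (S t).det) {D : State n m → State n m} (hD : IsMixing D) (x : State n m) :
    (c.partKernel U S s Part.O ∘ₖ Kernel.deterministic D hD.measurable ∘ₖ
      c.partKernel U S t Part.O) x ≪ volume := by
  refine Measure.AbsolutelyContinuous.mk fun E hE h0 => ?_
  obtain ⟨φ, K, K', hφ, hK⟩ := hD.position
  rw [c.twoNoise_apply hD.measurable x hE]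
  have h1 := ((quasiMeasurePreserving_of_antilipschitz (hK (qPart x)).1.continuous.measurable
    (hK (qPart x)).2.1).comp (quasiMeasurePreserving_inl (κ := Fin m))).ae
    (ae_volume_slice_eq_zero hE h0)
  rw [lintegral_congr_ae (g := 0) ?_]
  · simp
  refine (c.noiseLaw_absolutelyContinuous ht _).ae_le (h1.mono fun w hw => ?_)
  change c.partKernel U S s Part.O (D (mkState (qPart x) w)) E = 0
  rw [c.partKernel_O_apply_set _ hE]
  refine c.noiseLaw_absolutelyContinuous hs _ ?_
  rw [hφ]
  exact hw

lemma norm_qPart_le (x : State n m) : ‖qPart x‖ ≤ ‖x‖ :=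
  (pi_norm_le_iff_of_nonneg (norm_nonneg _)).2 fun i => norm_le_pi_norm x (Sum.inl i)

lemma norm_zPart_le (x : State n m) : ‖zPart x‖ ≤ ‖x‖ :=
  (pi_norm_le_iff_of_nonneg (norm_nonneg _)).2 fun i => norm_le_pi_norm x (Sum.inr i)

lemma LipschitzWith.norm_le_add {E F : Type*} [SeminormedAddCommGroup E]
    [SeminormedAddCommGroup F] {f : E → F} {K : NNReal} (hf : LipschitzWith K f) (x : E) :
    ‖f x‖ ≤ ‖f 0‖ + K * ‖x‖ := by
  have h1 := hf.norm_sub_le x 0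
  rw [sub_zero] at h1
  have h2 := norm_le_norm_add_norm_sub' (f x) (f 0)
  linarith

/-- The law after two noise steps separated by a mixing map charges a fixed measure, uniformly for
starting points in a ball. -/
lemma Coeffs.exists_le_twoNoise {s t : ℝ} (hs : IsUnit (S s).det)
    (ht : IsUnit (S t).det) {D : State n m → State n m} (hD : IsMixing D) (r : ℝ) :
    ∃ ν : Measure (State n m), IsFiniteMeasure ν ∧ ν ≠ 0 ∧ ∀ x : State n m, ‖x‖ ≤ r →
      ν ≤ (c.partKernel U S s Part.O ∘ₖ Kernel.deterministic D hD.measurable ∘ₖ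
        c.partKernel U S t Part.O) x := by
  obtain ⟨φ, K, K', hφ, hK⟩ := hD.position
  obtain ⟨KD, hKD⟩ := hD.lipschitz
  let B : Set (ZIdx n m → ℝ) := Metric.closedBall 0 1
  have hBm : MeasurableSet B := measurableSet_closedBall
  have hBtop : volume B ≠ ⊤ := measure_closedBall_lt_top.ne
  have hB0 : volume B ≠ 0 := (Metric.measure_closedBall_pos _ _ one_pos).ne'
  -- `ρ` bounds the momenta and auxiliary variables that the mixing map sends into `B`,
  -- `r'` bounds the image of these points under the map
  let ρ : ℝ := K' * (1 + (‖D 0‖ + KD * |r|)) + 1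
  have hρ : 0 ≤ ρ := by positivity
  let r' : ℝ := ‖D 0‖ + KD * (|r| + ρ)
  obtain ⟨ε₁, hε₁, h₁⟩ := c.exists_smul_restrict_le_noiseLaw ht r hρ
  obtain ⟨ε₂, hε₂, h₂⟩ := c.exists_smul_restrict_le_noiseLaw hs r' (zero_le_one' ℝ)
  let d : ℕ := Fintype.card (ZIdx n m)
  let L : NNReal := max K 1
  have hL : 0 < L := lt_of_lt_of_le one_pos (le_max_right _ _)
  let J : (ZIdx n m → ℝ) × (ZIdx n m → ℝ) → State n m :=
    fun y => mkState (fun i => y.1 (Sum.inl i)) y.2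
  have hJ : Measurable J := measurable_mkState
    (measurable_pi_lambda _ fun i => (measurable_pi_apply _).comp measurable_fst) measurable_snd
  let ν₀ : Measure (State n m) := ((volume.restrict B).prod (volume.restrict B)).map J
  have hfin : IsFiniteMeasure (volume.restrict B) := ⟨by simpa using hBtop.lt_top⟩
  let c₀ : NNReal := ε₁ * ε₂ * (L ^ d)⁻¹
  have hc₀ : c₀ ≠ 0 := by positivity
  refine ⟨c₀ • ν₀, inferInstance, fun h0 => ?_, fun x hx => Measure.le_iff.2 fun E hE => ?_⟩
  · have h3 := congrArg (fun μ => μ Set.univ) h0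
    have h4 : ν₀ Set.univ = volume B * volume B := by
      rw [Measure.map_apply hJ MeasurableSet.univ, Set.preimage_univ, ← Set.univ_prod_univ,
        Measure.prod_prod, Measure.restrict_apply_univ]
    rw [Measure.smul_apply, h4, ENNReal.smul_def, smul_eq_mul] at h3
    exact mul_ne_zero (ENNReal.coe_ne_zero.2 hc₀) (mul_ne_zero hB0 hB0) h3
  · -- `Ψ` replaces the momentum by the new position
    let Ψ : (ZIdx n m → ℝ) → ZIdx n m → ℝ := fun w =>
      Sum.elim (φ (qPart x) fun i => w (Sum.inl i)) fun j => w (Sum.inr j)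
    have hΨL : LipschitzWith L Ψ := by
      refine LipschitzWith.of_dist_le_mul fun w w' => ?_
      rw [dist_pi_le_iff (by positivity)]
      rintro (i | j)
      · refine (dist_le_pi_dist _ _ i).trans (((hK (qPart x)).1.dist_le_mul _ _).trans ?_)
        gcongr
        · exact le_max_left _ _
        · exact (dist_pi_le_iff dist_nonneg).2 fun i => dist_le_pi_dist w w' (Sum.inl i)
      · refine (dist_le_pi_dist w w' (Sum.inr j)).trans (le_mul_of_one_le_left dist_nonneg ?_)
        exact_mod_cast le_max_right K 1
    have hΨs : Function.Surjective Ψ := fun w => by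
      obtain ⟨p, hp⟩ := (hK (qPart x)).2.2 fun i => w (Sum.inl i)
      refine ⟨Sum.elim p fun j => w (Sum.inr j), ?_⟩
      ext (i | j)
      · simp [Ψ, hp]
      · simp [Ψ]
    let g : (ZIdx n m → ℝ) → ENNReal :=
      B.indicator fun w => volume.restrict B (Prod.mk w ⁻¹' (J ⁻¹' E))
    have hg : Measurable g := (measurable_measure_prodMk_left (hJ hE)).indicator hBm
    have hν₀ : ν₀ E = ∫⁻ w, g w := by
      rw [Measure.map_apply hJ hE, Measure.prod_apply (hJ hE), lintegral_indicator hBm]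
    have hqx : ‖qPart x‖ ≤ |r| := (norm_qPart_le x).trans (hx.trans (le_abs_self r))
    have hΨB : ∀ w, Ψ w ∈ B → ‖w‖ ≤ ρ := fun w hw => by
      have hw1 : ∀ a, ‖Ψ w a‖ ≤ 1 :=
        (pi_norm_le_iff_of_nonneg zero_le_one).1 (mem_closedBall_zero_iff.1 hw)
      have hφ0 : ‖φ (qPart x) 0‖ ≤ ‖D 0‖ + KD * |r| := by
        have e := hφ (qPart x) 0
        change _ = φ (qPart x) 0 at e
        rw [← e]
        refine (norm_qPart_le _).trans ((LipschitzWith.norm_le_add hKD _).trans ?_)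
        gcongr
        refine (norm_mkState_le _ _).trans ?_
        simpa using hqx
      have hφw : ‖φ (qPart x) fun i => w (Sum.inl i)‖ ≤ 1 :=
        (pi_norm_le_iff_of_nonneg zero_le_one).2 fun i => hw1 (Sum.inl i)
      have hp : ‖fun i => w (Sum.inl i)‖ ≤ K' * (1 + (‖D 0‖ + KD * |r|)) := by
        have h3 := (hK (qPart x)).2.1.le_mul_dist (fun i => w (Sum.inl i)) 0
        rw [dist_zero_right, dist_eq_norm] at h3
        refine h3.trans ?_
        gcongr
        exact (norm_sub_le _ _).trans (add_le_add hφw hφ0)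
      refine (pi_norm_le_iff_of_nonneg hρ).2 ?_
      rintro (i | j)
      · exact (norm_le_pi_norm (fun i => w (Sum.inl i)) i).trans (hp.trans (by simp [ρ]))
      · exact (hw1 (Sum.inr j)).trans (le_add_of_nonneg_left (by positivity))
    have hpt : ∀ w, ε₂ * g (Ψ w) ≤ (Metric.closedBall 0 ρ).indicator
        (fun w => c.partKernel U S s Part.O (D (mkState (qPart x) w)) E) w := fun w => by
      by_cases hw : Ψ w ∈ B
      · have hwρ := hΨB w hw
        have hDw : ‖zPart (D (mkState (qPart x) w))‖ ≤ r' := by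
          refine (norm_zPart_le _).trans ((LipschitzWith.norm_le_add hKD _).trans ?_)
          simp only [r']
          gcongr
          refine (norm_mkState_le _ _).trans (max_le ?_ ?_)
          · exact hqx.trans (le_add_of_nonneg_right hρ)
          · exact hwρ.trans (le_add_of_nonneg_left (abs_nonneg r))
        rw [Set.indicator_of_mem (mem_closedBall_zero_iff.2 hwρ), c.partKernel_O_apply_set _ hE]
        refine le_trans (le_of_eq ?_) (h₂ _ hDw _)
        rw [hφ, Measure.smul_apply, smul_eq_mul]
        simp only [g, Set.indicator_of_mem hw]
        rfl
      · simp [g, Set.indicator_of_notMem hw]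
    have hint := lintegral_le_of_lipschitz_surjective hΨL hΨs hg
    rw [c.twoNoise_apply hD.measurable x hE]
    calc (c₀ • ν₀) E = c₀ * ∫⁻ w, g w := by rw [Measure.smul_apply, hν₀]; rfl
      _ ≤ c₀ * ((L : ENNReal) ^ d * ∫⁻ w, g (Ψ w)) := by gcongr
      _ = ε₁ * ∫⁻ w, ε₂ * g (Ψ w) := by
        have hgΨ : Measurable fun w => g (Ψ w) := hg.comp hΨL.continuous.measurable
        rw [lintegral_const_mul _ hgΨ, ← mul_assoc, ← mul_assoc]
        congr 1
        rw [← ENNReal.coe_pow, ← ENNReal.coe_mul, ← ENNReal.coe_mul]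
        congr 1
        simp only [c₀]
        field_simp
      _ ≤ ε₁ * ∫⁻ w in Metric.closedBall 0 ρ,
          c.partKernel U S s Part.O (D (mkState (qPart x) w)) E := by
        rw [← lintegral_indicator measurableSet_closedBall]
        gcongr with w
        exact hpt w
      _ ≤ _ := by
        rw [← smul_eq_mul, ← lintegral_smul_measure]
        exact lintegral_mono' (h₁ _ ((norm_zPart_le x).trans hx)) le_rfl

end TwoNoiseSteps

/-! ### The substeps without noise -/

section MixingMaps

variable {c : Coeffs n m} {U : (Fin n → ℝ) → ℝ} {D : State n m → State n m}

lemma Coeffs.exists_lipschitzWith_flowA (c : Coeffs n m) (h : ℝ) :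
    ∃ K : NNReal, LipschitzWith K (c.flowA h) := by
  let T : State n m →L[ℝ] State n m :=
    LinearMap.toContinuousLinearMap (Matrix.mulVecLin (c.partLin 0 Part.A h))
  have e : c.flowA h = T := funext fun x => (c.partLin_A_mulVec 0 h x).symm
  exact ⟨_, e ▸ T.lipschitz⟩

lemma lipschitzWith_flowB {K : NNReal} (hK : LipschitzWith K (grad U)) (h : ℝ) :
    LipschitzWith (1 + ‖h‖₊ * K) (flowB U h : State n m → State n m) := by
  refine LipschitzWith.of_dist_le_mul fun x y => ?_
  have h1 : dist x y ≤ ↑(1 + ‖h‖₊ * K) * dist x y :=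
    le_mul_of_one_le_left dist_nonneg (by exact_mod_cast le_self_add)
  rw [dist_pi_le_iff (by positivity)]
  rintro (i | i | j)
  · exact (dist_le_pi_dist x y (Sum.inl i)).trans h1
  · have h2 : dist (grad U (qPart x) i) (grad U (qPart y) i) ≤ K * dist x y := by
      refine (dist_le_pi_dist _ _ i).trans ((hK.dist_le_mul _ _).trans ?_)
      gcongr
      exact (dist_pi_le_iff dist_nonneg).2 fun i => dist_le_pi_dist x y (Sum.inl i)
    have h3 := dist_le_pi_dist x y (Sum.inr (Sum.inl i))
    rw [Real.dist_eq] at h2 h3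
    simp only [flowB, mkState3, mkState, Sum.elim_inr, Sum.elim_inl, Pi.sub_apply, Pi.smul_apply,
      smul_eq_mul, pPart, Real.dist_eq]
    calc _ = |(x (Sum.inr (Sum.inl i)) - y (Sum.inr (Sum.inl i))) -
          h * (grad U (qPart x) i - grad U (qPart y) i)| := by ring_nf
      _ ≤ dist x y + |h| * (K * dist x y) := by
        refine (abs_sub _ _).trans (add_le_add h3 ?_)
        rw [abs_mul]
        gcongr
      _ = _ := by
        push_cast
        rw [Real.norm_eq_abs]
        ring
  · exact (dist_le_pi_dist x y (Sum.inr (Sum.inr j))).trans h1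

lemma Coeffs.flowA_zero (c : Coeffs n m) : c.flowA 0 = id := by
  funext x
  ext (i | i | j) <;> simp [flowA, mkState3, mkState, qPart, pPart, sPart]

lemma flowB_flowB (a b : ℝ) :
    (flowB U a ∘ flowB U b : State n m → State n m) = flowB U (a + b) := by
  funext x
  ext (i | i | j)
  · rfl
  · change pPart x i - b * grad U (qPart x) i - a * grad U (qPart x) i =
      pPart x i - (a + b) * grad U (qPart x) i
    ring
  · rfl

lemma flowB_zero : (flowB U 0 : State n m → State n m) = id := by
  funext x
  ext (i | i | j) <;> simp [flowB, mkState3, mkState, qPart, pPart, sPart]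

lemma Coeffs.leftInverse_flowA (c : Coeffs n m) (h : ℝ) :
    Function.LeftInverse (c.flowA (-h)) (c.flowA h) := fun x => by
  ext (i | i | j)
  · change x (Sum.inl i) + h * (c.M⁻¹ *ᵥ pPart x) i + -h * (c.M⁻¹ *ᵥ pPart x) i = x (Sum.inl i)
    ring
  · rfl
  · rfl

lemma leftInverse_flowB (h : ℝ) :
    Function.LeftInverse (flowB U (-h)) (flowB U h : State n m → State n m) := fun x => by
  have e := congrFun (flowB_flowB (U := U) (-h) h) x
  rw [neg_add_cancel, flowB_zero] at e
  exact e

lemma IsMixing.flowB_comp (hD : IsMixing D) {K : NNReal} (hK : LipschitzWith K (grad U)) (b : ℝ) :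
    IsMixing (flowB U b ∘ D) := by
  obtain ⟨KD, hKD⟩ := hD.lipschitz
  obtain ⟨φ, K₁, K₂, h⟩ := hD.position
  exact ⟨⟨_, (lipschitzWith_flowB hK b).comp hKD⟩, φ, K₁, K₂, h⟩

lemma IsMixing.comp_flowB (hD : IsMixing D) {K : NNReal} (hK : LipschitzWith K (grad U)) (b : ℝ) :
    IsMixing (D ∘ flowB U b) := by
  obtain ⟨KD, hKD⟩ := hD.lipschitz
  obtain ⟨φ, K₁, K₂, hφ, h⟩ := hD.position
  refine ⟨⟨_, hKD.comp (lipschitzWith_flowB hK b)⟩, fun q p => φ q (p - b • grad U q), K₁, K₂,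
    fun q z => hφ q _, fun q => ⟨fun p p' => ?_, fun p p' => ?_, fun y => ?_⟩⟩
  · simpa only [edist_sub_right] using (h q).1 (p - b • grad U q) (p' - b • grad U q)
  · simpa only [edist_sub_right] using (h q).2.1 (p - b • grad U q) (p' - b • grad U q)
  · obtain ⟨p, hp⟩ := (h q).2.2 y
    exact ⟨p + b • grad U q, by simpa using hp⟩

/-- The new position after the substeps A, B, A is, as a function of the old momentum, a small
Lipschitz perturbation of an invertible linear map. -/
lemma Coeffs.exists_isMixing (c : Coeffs n m) (hM : IsUnit c.M.det) {K : NNReal}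
    (hK : LipschitzWith K (grad U)) :
    ∃ θ : ℝ, 0 ≤ θ ∧ ∀ a₁ a₂ b : ℝ, 0 < a₁ → 0 ≤ a₂ → 0 ≤ b → a₂ * b * θ < 1 →
      IsMixing (c.flowA a₂ ∘ flowB U b ∘ c.flowA a₁) := by
  let Mf : (Fin n → ℝ) →L[ℝ] (Fin n → ℝ) := LinearMap.toContinuousLinearMap (Matrix.mulVecLin c.M)
  let Mi : (Fin n → ℝ) →L[ℝ] (Fin n → ℝ) :=
    LinearMap.toContinuousLinearMap (Matrix.mulVecLin c.M⁻¹)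
  have hfi : ∀ v, Mf (Mi v) = v := fun v => by simp [Mf, Mi, Matrix.mul_nonsing_inv _ hM]
  have hif : ∀ v, Mi (Mf v) = v := fun v => by simp [Mf, Mi, Matrix.nonsing_inv_mul _ hM]
  refine ⟨‖Mi‖ ^ 2 * K * ‖Mf‖, by positivity, fun a₁ a₂ b h₁ h₂ hb hθ => ?_⟩
  have ha : 0 < a₁ + a₂ := by positivity
  obtain ⟨K₁, hK₁⟩ := c.exists_lipschitzWith_flowA a₁
  obtain ⟨K₂, hK₂⟩ := c.exists_lipschitzWith_flowA a₂
  refine ⟨⟨_, hK₂.comp ((lipschitzWith_flowB hK b).comp hK₁)⟩, ?_⟩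
  -- the linear part `(a₁ + a₂) M⁻¹` is that of the free motion; the force adds a Lipschitz
  -- perturbation with constant `k`
  let φ : (Fin n → ℝ) → (Fin n → ℝ) → Fin n → ℝ := fun q p =>
    (q + a₁ • Mi p) + a₂ • Mi (p - b • grad U (q + a₁ • Mi p))
  let T : (Fin n → ℝ) ≃L[ℝ] (Fin n → ℝ) :=
    ContinuousLinearEquiv.equivOfInverse ((a₁ + a₂) • Mi) ((a₁ + a₂)⁻¹ • Mf)
      (fun v => by simp [hfi, smul_smul, ha.ne']) (fun v => by simp [hif, smul_smul, ha.ne'])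
  let k : NNReal := (a₂ * b * a₁).toNNReal * (‖Mi‖₊ ^ 2 * K)
  have hk : (k : ℝ) = a₂ * b * a₁ * (‖Mi‖ ^ 2 * K) := by
    simp only [k]
    push_cast
    rw [Real.coe_toNNReal _ (by positivity)]
  have happ : ∀ q, ApproximatesLinearOn (φ q) (T : (Fin n → ℝ) →L[ℝ] (Fin n → ℝ)) Set.univ k := by
    intro q p _ p' _
    have e : φ q p - φ q p' - (a₁ + a₂) • Mi (p - p') =
        -((a₂ * b) • Mi (grad U (q + a₁ • Mi p) - grad U (q + a₁ • Mi p'))) := by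
      simp only [φ, map_sub, map_smul]
      module
    change ‖φ q p - φ q p' - (a₁ + a₂) • Mi (p - p')‖ ≤ _
    rw [e, norm_neg, norm_smul, Real.norm_of_nonneg (by positivity), hk]
    have h3 := hK.norm_sub_le (q + a₁ • Mi p) (q + a₁ • Mi p')
    have e2 : q + a₁ • Mi p - (q + a₁ • Mi p') = a₁ • Mi (p - p') := by
      rw [map_sub]
      module
    rw [e2, norm_smul, Real.norm_of_nonneg h₁.le] at h3
    calc _ ≤ a₂ * b * (‖Mi‖ * (K * (a₁ * (‖Mi‖ * ‖p - p'‖)))) := by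
          gcongr
          refine (Mi.le_opNorm _).trans ?_
          gcongr
          refine h3.trans ?_
          gcongr
          exact Mi.le_opNorm _
      _ = _ := by ring
  have hsmall : Subsingleton (Fin n → ℝ) ∨
      k < ‖(T.symm : (Fin n → ℝ) →L[ℝ] (Fin n → ℝ))‖₊⁻¹ := by
    refine T.subsingleton_or_nnnorm_symm_pos.imp_right fun hpos => ?_
    rw [← one_div, lt_div_iff₀ hpos, ← NNReal.coe_lt_coe]
    push_cast
    have h4 : ‖(T.symm : (Fin n → ℝ) →L[ℝ] (Fin n → ℝ))‖ ≤ (a₁ + a₂)⁻¹ * ‖Mf‖ := by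
      change ‖(a₁ + a₂)⁻¹ • Mf‖ ≤ _
      rw [norm_smul, Real.norm_of_nonneg (by positivity)]
    rw [hk]
    calc _ ≤ a₂ * b * a₁ * (‖Mi‖ ^ 2 * K) * ((a₁ + a₂)⁻¹ * ‖Mf‖) := by gcongr
      _ = (a₁ / (a₁ + a₂)) * (a₂ * b * (‖Mi‖ ^ 2 * K * ‖Mf‖)) := by ring
      _ ≤ 1 * (a₂ * b * (‖Mi‖ ^ 2 * K * ‖Mf‖)) := by
        gcongr
        rw [div_le_one ha]
        linarith
      _ < 1 := by rwa [one_mul]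
  exact ⟨φ, _, _, fun q z => rfl, fun q =>
    ⟨fun p p' => (happ q).lipschitz ⟨p, trivial⟩ ⟨p', trivial⟩,
      fun p p' => (happ q).antilipschitz hsmall ⟨p, trivial⟩ ⟨p', trivial⟩,
      (happ q).surjective hsmall⟩⟩

end MixingMaps

/-! ### Preservation of null sets -/

section NullSets

/-- For almost every starting point, the law after a step gives no mass to a given null set. -/
def NullPreserving (κ : Kernel (State n m) (State n m)) : Prop :=
  ∀ E : Set (State n m), MeasurableSet E → volume E = 0 → ∀ᵐ x, κ x E = 0

lemma NullPreserving.comp {η κ : Kernel (State n m) (State n m)} (hη : NullPreserving η)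
    (hκ : NullPreserving κ) : NullPreserving (η ∘ₖ κ) := fun E hE h0 => by
  have hm : MeasurableSet {y | η y E ≠ 0} :=
    (Kernel.measurable_coe η hE (measurableSet_singleton 0)).compl
  filter_upwards [hκ _ hm (hη E hE h0)] with x hx
  rw [Kernel.comp_apply' _ _ _ hE, lintegral_eq_zero_iff (Kernel.measurable_coe η hE)]
  exact hx

lemma NullPreserving.id : NullPreserving (Kernel.id : Kernel (State n m) (State n m)) :=
  fun E hE h0 => by
    filter_upwards [measure_eq_zero_iff_ae_notMem.1 h0] with x hx
    simp [Kernel.id_apply, hE, hx]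

lemma NullPreserving.deterministic {f : State n m → State n m} (hf : Measurable f) {K : NNReal}
    {g : State n m → State n m} (hg : LipschitzWith K g) (hgf : Function.LeftInverse g f) :
    NullPreserving (Kernel.deterministic f hf) := fun E hE h0 => by
  have h1 := (quasiMeasurePreserving_of_antilipschitz hf
    (antilipschitzWith_of_leftInverse hg hgf)).ae (measure_eq_zero_iff_ae_notMem.1 h0)
  filter_upwards [h1] with x hx
  simp [Kernel.deterministic_apply, hE, hx]

lemma Coeffs.nullPreserving_partKernel (c : Coeffs n m) {U : (Fin n → ℝ) → ℝ} {K : NNReal}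
    (hK : LipschitzWith K (grad U)) {S : ℝ → Matrix (ZIdx n m) (ZIdx n m) ℝ} {h : ℝ}
    (hS : IsUnit (S h).det) (P : Part) : NullPreserving (c.partKernel U S h P) := by
  cases P with
  | A =>
    obtain ⟨K', hK'⟩ := c.exists_lipschitzWith_flowA (-h)
    exact NullPreserving.deterministic (c.measurable_flowA h) hK' (c.leftInverse_flowA h)
  | B =>
    exact NullPreserving.deterministic (measurable_flowB U h)
      (lipschitzWith_flowB hK _) (leftInverse_flowB h)
  | O =>
    intro E hE h0
    filter_upwards [(quasiMeasurePreserving_inl (κ := ZIdx n m)).ae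
      (ae_volume_slice_eq_zero hE h0)] with x hx
    rw [c.partKernel_O_apply_set _ hE]
    exact c.noiseLaw_absolutelyContinuous hS _ hx

end NullSets

/-! ### Two steps of the scheme -/

section TwoSteps

variable {c : Coeffs n m} {U : (Fin n → ℝ) → ℝ} {S : ℝ → Matrix (ZIdx n m) (ZIdx n m) ℝ}

/-- A minorization on balls survives composition with a kernel before it that does not let mass
escape, and with any Markov kernel after it. -/
lemma exists_le_comp_comp {K₀ N K₂ : Kernel (State n m) (State n m)} [IsMarkovKernel K₀]
    [IsMarkovKernel N] [IsMarkovKernel K₂] {L : Matrix (XIdx n m) (XIdx n m) ℝ}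
    (hK₀ : DevBound K₀ L)
    (hN : ∀ r : ℝ, ∃ ν : Measure (State n m), IsFiniteMeasure ν ∧ ν ≠ 0 ∧
      ∀ x : State n m, ‖x‖ ≤ r → ν ≤ N x) (r : ℝ) :
    ∃ ν : Measure (State n m), IsFiniteMeasure ν ∧ ν ≠ 0 ∧
      ∀ x : State n m, ‖x‖ ≤ r → ν ≤ (K₂ ∘ₖ N ∘ₖ K₀) x := by
  obtain ⟨r', hr'⟩ := hK₀.exists_ball r
  obtain ⟨ν, hν, hν0, hle⟩ := hN r'
  have hmass : (ν.bind K₂) Set.univ = ν Set.univ := by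
    simp [Measure.bind_apply MeasurableSet.univ K₂.aemeasurable]
  refine ⟨(2⁻¹ : NNReal) • ν.bind K₂, ?_, fun h0 => ?_, fun x hx => Measure.le_iff.2 fun E hE => ?_⟩
  · have : IsFiniteMeasure (ν.bind K₂) := ⟨by rw [hmass]; exact measure_lt_top _ _⟩
    infer_instance
  · have h1 := congrArg (fun μ => μ Set.univ) h0
    rw [Measure.smul_apply, hmass, ENNReal.smul_def, smul_eq_mul] at h1
    exact mul_ne_zero (by simp) (Measure.measure_univ_ne_zero.2 hν0) h1
  · have h2 : ∀ y ∈ Metric.closedBall (0 : State n m) r', (ν.bind K₂) E ≤ (K₂ ∘ₖ N) y E := by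
      intro y hy
      rw [Kernel.comp_apply, Measure.bind_apply hE K₂.aemeasurable,
        Measure.bind_apply hE K₂.aemeasurable]
      exact lintegral_mono' (hle y (mem_closedBall_zero_iff.1 hy)) le_rfl
    rw [Kernel.comp_apply' _ _ _ hE, Measure.smul_apply, ENNReal.smul_def, smul_eq_mul]
    calc _ ≤ (ν.bind K₂) E * K₀ x (Metric.closedBall 0 r') := by
          rw [mul_comm]
          gcongr
          simpa using hr' x hx
      _ = ∫⁻ _ in Metric.closedBall 0 r', (ν.bind K₂) E ∂(K₀ x) := by rw [setLIntegral_const]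
      _ ≤ ∫⁻ y in Metric.closedBall 0 r', (K₂ ∘ₖ N) y E ∂(K₀ x) :=
        setLIntegral_mono (Kernel.measurable_coe _ hE) h2
      _ ≤ _ := setLIntegral_le_lintegral _ _

lemma comp_comp_absolutelyContinuous {K₀ N K₂ : Kernel (State n m) (State n m)}
    (hK₂ : NullPreserving K₂) (hN : ∀ x, N x ≪ volume) (x : State n m) :
    (K₂ ∘ₖ N ∘ₖ K₀) x ≪ volume := by
  refine Measure.AbsolutelyContinuous.mk fun E hE h0 => ?_
  have h1 : ∀ y, (K₂ ∘ₖ N) y E = 0 := fun y => by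
    rw [Kernel.comp_apply' _ _ _ hE, lintegral_eq_zero_iff (Kernel.measurable_coe _ hE)]
    exact (hN y).ae_le (hK₂ E hE h0)
  rw [Kernel.comp_apply' _ _ _ hE]
  simp [h1]

/-- A kernel with a minorization that is uniform on balls and with absolutely continuous
transition laws. -/
structure IsSmoothing (κ : Kernel (State n m) (State n m)) : Prop where
  minorization : ∀ r : ℝ, ∃ ν : Measure (State n m), IsFiniteMeasure ν ∧ ν ≠ 0 ∧
      ∀ x : State n m, ‖x‖ ≤ r → ν ≤ κ x
  absolutelyContinuous : ∀ x, κ x ≪ volume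

lemma Coeffs.isSmoothing_of_eq {s t : ℝ} (hs : IsUnit (S s).det) (ht : IsUnit (S t).det)
    {D : State n m → State n m} (hD : IsMixing D) {K₀ K₂ DK κ : Kernel (State n m) (State n m)}
    [IsMarkovKernel K₀] [IsMarkovKernel K₂] {L : Matrix (XIdx n m) (XIdx n m) ℝ}
    (hK₀ : DevBound K₀ L) (hK₂ : NullPreserving K₂)
    (hDK : Kernel.deterministic D hD.measurable = DK)
    (hκ : κ = K₂ ∘ₖ (c.partKernel U S s Part.O ∘ₖ DK ∘ₖ c.partKernel U S t Part.O) ∘ₖ K₀) :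
    IsSmoothing κ := by
  subst hDK hκ
  exact ⟨fun r => exists_le_comp_comp hK₀ (c.exists_le_twoNoise hs ht hD) r,
    comp_comp_absolutelyContinuous hK₂ (c.twoNoise_absolutelyContinuous hs ht hD)⟩

/-- In two consecutive steps of any of the schemes there are two noise substeps that are separated
by a mixing map, if the step size is small. -/
theorem Coeffs.exists_isSmoothing (c : Coeffs n m) (hM : IsUnit c.M.det) {U₂ : (Fin n → ℝ) → ℝ}
    {Ω : Matrix (Fin n) (Fin n) ℝ} (hU : PotentialAssumption U Ω U₂)
    (hS : ∀ h, 0 < h → IsUnit (S h).det) {X Y Z : Part} (hXY : X ≠ Y) (hXZ : X ≠ Z)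
    (hYZ : Y ≠ Z) :
    ∃ h₀ : ℝ, 0 < h₀ ∧ ∀ h : ℝ, 0 < h → h < h₀ →
      IsSmoothing (c.schemeKernel U S X Y Z h ∘ₖ c.schemeKernel U S X Y Z h) := by
  obtain ⟨K, hK⟩ := hU.exists_lipschitzWith_grad
  obtain ⟨θ, hθ, hmix⟩ := c.exists_isMixing hM hK
  -- then `h < 1` and `h θ < 1`, which suffices for the smallness condition `(h / 2) h θ < 1`
  refine ⟨min 1 (θ + 1)⁻¹, by positivity, fun h h0 hlt => ?_⟩
  have hh1 : h < 1 := hlt.trans_le (min_le_left _ _)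
  have hh2 : h * θ < 1 := by
    have h1 : h < (θ + 1)⁻¹ := hlt.trans_le (min_le_right _ _)
    rw [← one_div, lt_div_iff₀ (by positivity)] at h1
    linarith
  have h2 : 0 < h / 2 := by positivity
  have hABA : IsMixing (c.flowA (h / 2) ∘ flowB U h ∘ c.flowA (h / 2)) :=
    hmix _ _ _ h2 h2.le h0.le (by nlinarith)
  have hAA : IsMixing (c.flowA (h / 2) ∘ c.flowA (h / 2)) := by
    have := hmix (h / 2) (h / 2) 0 h2 h2.le le_rfl (by simp)
    rwa [flowB_zero] at this
  have hA : IsMixing (c.flowA h) := by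
    have := hmix h 0 0 h0 le_rfl le_rfl (by simp)
    rwa [flowB_zero, c.flowA_zero] at this
  have hBAB := (hA.comp_flowB hK (h / 2)).flowB_comp hK (h / 2)
  have hBAAB := (hAA.comp_flowB hK (h / 2)).flowB_comp hK (h / 2)
  have hdev := c.devBound_partKernel hU S
  have hnull : ∀ a, 0 < a → ∀ P, NullPreserving (c.partKernel U S a P) := fun a ha P =>
    c.nullPreserving_partKernel hK (hS a ha) P
  have hP := c.devBound_schemeKernel hU S
  cases X <;> cases Y <;> cases Z <;> try contradiction
  · -- `A B O B A`
    refine c.isSmoothing_of_eq (U := U) (hS h h0) (hS h h0) hBAAB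
      (DK := c.partKernel U S (h / 2) Part.B ∘ₖ (c.partKernel U S (h / 2) Part.A ∘ₖ
        c.partKernel U S (h / 2) Part.A) ∘ₖ c.partKernel U S (h / 2) Part.B)
      (K₂ := c.partKernel U S (h / 2) Part.A ∘ₖ c.partKernel U S (h / 2) Part.B)
      (K₀ := c.partKernel U S (h / 2) Part.B ∘ₖ c.partKernel U S (h / 2) Part.A)
      ((hdev _ _).comp (hdev _ _)) ((hnull _ h2 _).comp (hnull _ h2 _)) ?_ ?_
    · simp only [partKernel, Kernel.deterministic_comp_deterministic]
      rfl
    · simp only [schemeKernel, Kernel.comp_assoc]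
  · -- `A O B O A`
    refine c.isSmoothing_of_eq (U := U) (hS _ h2) (hS _ h2) hAA
      (DK := c.partKernel U S (h / 2) Part.A ∘ₖ c.partKernel U S (h / 2) Part.A)
      (K₂ := c.partKernel U S (h / 2) Part.A ∘ₖ c.partKernel U S (h / 2) Part.O ∘ₖ
        c.partKernel U S h Part.B)
      (K₀ := c.partKernel U S h Part.B ∘ₖ c.partKernel U S (h / 2) Part.O ∘ₖ
        c.partKernel U S (h / 2) Part.A)
      (((hdev _ _).comp (hdev _ _)).comp (hdev _ _))
      (((hnull _ h2 _).comp (hnull _ h2 _)).comp (hnull _ h0 _)) ?_ ?_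
    · simp only [partKernel, Kernel.deterministic_comp_deterministic]
    · simp only [schemeKernel, Kernel.comp_assoc]
  · -- `B A O A B`
    have hABBA : IsMixing
        (c.flowA (h / 2) ∘ (flowB U (h / 2) ∘ flowB U (h / 2)) ∘ c.flowA (h / 2)) := by
      rwa [flowB_flowB, add_halves]
    refine c.isSmoothing_of_eq (U := U) (hS h h0) (hS h h0) hABBA
      (DK := c.partKernel U S (h / 2) Part.A ∘ₖ (c.partKernel U S (h / 2) Part.B ∘ₖ
        c.partKernel U S (h / 2) Part.B) ∘ₖ c.partKernel U S (h / 2) Part.A)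
      (K₂ := c.partKernel U S (h / 2) Part.B ∘ₖ c.partKernel U S (h / 2) Part.A)
      (K₀ := c.partKernel U S (h / 2) Part.A ∘ₖ c.partKernel U S (h / 2) Part.B)
      ((hdev _ _).comp (hdev _ _)) ((hnull _ h2 _).comp (hnull _ h2 _)) ?_ ?_
    · simp only [partKernel, Kernel.deterministic_comp_deterministic]
      rfl
    · simp only [schemeKernel, Kernel.comp_assoc]
  · -- `B O A O B`
    refine c.isSmoothing_of_eq (U := U) (hS _ h2) (hS _ h2) hA (DK := c.partKernel U S h Part.A)
      (K₂ := c.partKernel U S (h / 2) Part.B)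
      (K₀ := c.partKernel U S (h / 2) Part.B ∘ₖ c.schemeKernel U S Part.B Part.O Part.A h)
      ((hdev _ _).comp (hP _ _ _ _)) (hnull _ h2 _) rfl ?_
    simp only [schemeKernel, Kernel.comp_assoc]
  · -- `O A B A O`
    refine c.isSmoothing_of_eq (U := U) (hS _ h2) (hS _ h2) hABA
      (DK := c.partKernel U S (h / 2) Part.A ∘ₖ c.partKernel U S h Part.B ∘ₖ
        c.partKernel U S (h / 2) Part.A) (K₂ := Kernel.id)
      (K₀ := c.schemeKernel U S Part.O Part.A Part.B h) (hP _ _ _ _) NullPreserving.id ?_ ?_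
    · simp only [partKernel, Kernel.deterministic_comp_deterministic]
      rfl
    · simp only [schemeKernel, Kernel.comp_assoc, Kernel.id_comp]
  · -- `O B A B O`
    refine c.isSmoothing_of_eq (U := U) (hS _ h2) (hS _ h2) hBAB
      (DK := c.partKernel U S (h / 2) Part.B ∘ₖ c.partKernel U S h Part.A ∘ₖ
        c.partKernel U S (h / 2) Part.B) (K₂ := Kernel.id)
      (K₀ := c.schemeKernel U S Part.O Part.B Part.A h) (hP _ _ _ _) NullPreserving.id ?_ ?_
    · simp only [partKernel, Kernel.deterministic_comp_deterministic]
      rfl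
    · simp only [schemeKernel, Kernel.comp_assoc, Kernel.id_comp]

end TwoSteps

/-! ### Geometric ergodicity -/

section Ergodicity

open Filter Topology

/-- Two applications of the kernel carry an invariant measure to itself, so that it inherits the
absolute continuity of the two-step transition laws. -/
lemma absolutelyContinuous_of_invariant {α : Type*} [MeasurableSpace α] {μ : Measure α}
    {κ : Kernel α α} {π : Measure α} (hπ : Kernel.Invariant κ π) (h : ∀ x, (κ ∘ₖ κ) x ≪ μ) :
    π ≪ μ := by
  refine Measure.AbsolutelyContinuous.mk fun E hE h0 => ?_
  rw [← (hπ.comp hπ).def, Measure.bind_apply hE (Kernel.aemeasurable _)]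
  simp [h _ h0]

/-- Geometric ergodicity of a chain that is close to a linear contraction and whose two-step kernel
is smoothing. -/
theorem exists_geometricallyErgodic {κ : Kernel (State n m) (State n m)} [IsMarkovKernel κ]
    {L C : Matrix (XIdx n m) (XIdx n m) ℝ} (hκ : DevBound κ L) (hC : C.PosDef) {ρ : ℝ}
    (hρ0 : 0 ≤ ρ) (hρ1 : ρ < 1) (hL : ∀ x, (L *ᵥ x) ⬝ᵥ C *ᵥ (L *ᵥ x) ≤ ρ * (x ⬝ᵥ C *ᵥ x))
    (hsmooth : IsSmoothing (κ ∘ₖ κ)) {l : ℕ} (hl : 0 < l) :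
    ∃ π : Measure (State n m), (IsProbabilityMeasure π ∧ Kernel.Invariant κ π) ∧
      (∀ π' : Measure (State n m), IsProbabilityMeasure π' → Kernel.Invariant κ π' → π' = π) ∧
      (∃ f : State n m → ENNReal, Measurable f ∧ π = volume.withDensity f) ∧
      (∀ l' : ℕ, Integrable (lyapunov C l') π) ∧ GeometricallyErgodic κ π (lyapunov C l) := by
  have hVm : ∀ k : ℕ, Measurable fun x : State n m => (x ⬝ᵥ C *ᵥ x) ^ k := fun k =>
    ((continuous_dotProduct_mulVec C).pow k).measurable
  have hV0 : ∀ (k : ℕ) (x : State n m), 0 ≤ (x ⬝ᵥ C *ᵥ x) ^ k := fun k x =>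
    pow_nonneg (dotProduct_mulVec_nonneg_of_posDef hC x) k
  have hminor : ∀ R : ℝ, ∃ ν : Measure (State n m), IsFiniteMeasure ν ∧ ν ≠ 0 ∧
      ∀ x : State n m, (x ⬝ᵥ C *ᵥ x) ^ l ≤ R → ν ≤ (κ ∘ₖ κ) x := fun R => by
    obtain ⟨w, hw, hwle⟩ := exists_norm_sq_le_of_posDef hC
    obtain ⟨ν, h1, h2, h3⟩ := hsmooth.minorization (√((|R| + 1) / w))
    refine ⟨ν, h1, h2, fun x hx => h3 x (Real.le_sqrt_of_sq_le ?_)⟩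
    rw [le_div_iff₀ hw, mul_comm]
    refine (hwle x).trans ?_
    by_contra! hlt
    have h4 : (1 : ℝ) ≤ x ⬝ᵥ C *ᵥ x := by linarith [abs_nonneg R]
    have h5 := le_self_pow₀ h4 hl.ne'
    linarith [le_abs_self R]
  obtain ⟨γ, b, hγ0, hγ1, hb, hdrift⟩ := hκ.drift hC hρ0 hρ1 hL l
  obtain ⟨π, hπ, hinv, huniq, hconv, hgeom⟩ :=
    harris (hVm l) (hV0 l) hγ0 hγ1 hb hdrift hminor
  refine ⟨π, ⟨hπ, hinv⟩, huniq, ?_, fun l' => ?_, hgeom⟩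
  · have hac := absolutelyContinuous_of_invariant hinv hsmooth.absolutelyContinuous
    exact ⟨π.rnDeriv volume, Measure.measurable_rnDeriv _ _,
      (Measure.withDensity_rnDeriv_eq _ _ hac).symm⟩
  · obtain ⟨γ', b', hγ0', hγ1', hb', hdrift'⟩ := hκ.drift hC hρ0 hρ1 hL l'
    have h1 := lintegral_le_of_tendsto_setwise (hconv 0) tendsto_const_nhds
      fun k => lintegral_iterKernel_le (hVm l') (hV0 l') hγ0' hγ1' hb' hdrift' k 0
    exact (integrable_of_lintegral_ofReal_le (hVm l') (hV0 l') h1).add (integrable_const 1)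

end Ergodicity

end

end GLE

theorem mainTheorem1 (n m : ℕ) (hnm : n ≤ m) (c : GLE.Coeffs n m)
    (Q : Matrix (Fin m) (Fin m) ℝ) (hc : c.Structural Q)
    (U : (Fin n → ℝ) → ℝ) (Ω : Matrix (Fin n) (Fin n) ℝ) (U₂ : (Fin n → ℝ) → ℝ)
    (hU : GLE.PotentialAssumption U Ω U₂) (hhypo : c.Hypo Ω)
    (S : ℝ → Matrix (GLE.ZIdx n m) (GLE.ZIdx n m) ℝ) (hS : c.IsNoiseFactor Q S)
    (X Y Z : GLE.Part) (hXY : X ≠ Y) (hXZ : X ≠ Z) (hYZ : Y ≠ Z) :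
    (∃ C : Matrix (GLE.XIdx n m) (GLE.XIdx n m) ℝ, c.IsWeightMatrix Ω C) ∧
    ∀ C : Matrix (GLE.XIdx n m) (GLE.XIdx n m) ℝ, c.IsWeightMatrix Ω C →
      ∀ l : ℕ, 0 < l → ∃ hstar : ℝ, 0 < hstar ∧ ∀ h : ℝ, 0 < h → h < hstar →
        ∃ π : MeasureTheory.Measure (GLE.State n m),
          (MeasureTheory.IsProbabilityMeasure π ∧
            ProbabilityTheory.Kernel.Invariant (c.schemeKernel U S X Y Z h) π) ∧
          (∀ π' : MeasureTheory.Measure (GLE.State n m),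
            MeasureTheory.IsProbabilityMeasure π' →
            ProbabilityTheory.Kernel.Invariant (c.schemeKernel U S X Y Z h) π' → π' = π) ∧
          (∃ ρ : GLE.State n m → ENNReal, Measurable ρ ∧
            π = MeasureTheory.volume.withDensity ρ) ∧
          (∀ l' : ℕ, MeasureTheory.Integrable (GLE.lyapunov C l') π) ∧
          GLE.GeometricallyErgodic (c.schemeKernel U S X Y Z h) π (GLE.lyapunov C l) := by
  refine ⟨GLE.Coeffs.exists_isWeightMatrix hc hU.Ω_posDef hhypo.hypoelliptic,
    fun C hC l hl => ?_⟩
  obtain ⟨h₁, h₁pos, hcontr⟩ := c.exists_contraction hC hXY hXZ hYZ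
  obtain ⟨h₂, h₂pos, hsmooth⟩ := c.exists_isSmoothing hc.M_posDef.det_pos.ne'.isUnit hU
    (fun h hpos => hS.isUnit_det hc hhypo hpos) hXY hXZ hYZ
  refine ⟨min h₁ h₂, lt_min h₁pos h₂pos, fun h hpos hlt => ?_⟩
  obtain ⟨ρ, hρ0, hρ1, hρ⟩ := hcontr h hpos (hlt.trans_le (min_le_left _ _))
  exact GLE.exists_geometricallyErgodic (c.devBound_schemeKernel hU S X Y Z h) hC.1 hρ0 hρ1 hρ
    (hsmooth h hpos (hlt.trans_le (min_le_right _ _))) hl
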